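/- Call a set $C$ of vertices of a simple graph $G$ a *wide diamond* if there are distinct vertices $v,u\in V(G)\setminus C$ such that $N_G(c)=\{v,u\}$ for all $c\in C$. For a finite graph $G$ and an integer $k$, let $\#\mathrm{minDS}(G,k)$ be the number of minimum-cardinality dominating sets of $G$ that have size at most $k$ (so it is $0$ if the domination number of $G$ exceeds $k$). For a vertex set $X$, let $N_G(X)$ be the set of vertices outside $X$ with a neighbour in $X$, and $G-X$ the graph obtained by deleting $X$. **Lemma.** There are a polynomial-time algorithm and an absolute constant $c$ such that the following holds. Given a finite simple planar graph $G$, a wide diamond $C$ of $G$ and an integer $k$, the algorithm outputs a finite simple planar graph $G'$, obtained from $G$ by replacing $C$ with some vertex set $C'\subseteq V(G')$, and an integer $k'$, such that - $\#\mathrm{minDS}(G,k)=\#\mathrm{minDS}(G',k')$, - $G-C=G'-C'$, - $N_G(C)=N_{G'}(C')$, - $|C'|\le c\cdot\log^2(|C|+1)$, and - $k\le k'\le k+c\cdot\log^2(|C|+1)$. -/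

import Mathlib

/-! ## Graphs

A finite simple graph with vertices named by natural numbers is a subgraph of the complete graph
on `ℕ` (its finiteness is part of being encoded by a finite list, see below). Vertex names are
kept when vertices are deleted, so that `G - C = G' - C'` is an honest equality. -/

/-- Simple undirected graphs whose vertex set is a set of natural numbers. -/
abbrev NatGraph : Type := SimpleGraph.Subgraph (⊤ : SimpleGraph ℕ)

/-- The open neighbourhood `N_G(X)` of a vertex set. -/
def openNbhd (G : NatGraph) (X : Set ℕ) : Set ℕ :=
  {w | (∃ x ∈ X, G.Adj x w) ∧ w ∉ X}

/-- The closed neighbourhood `N_G[X]` of a vertex set `X ⊆ V(G)`. -/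
def closedNbhd (G : NatGraph) (X : Set ℕ) : Set ℕ :=
  {w | w ∈ X ∨ ∃ x ∈ X, G.Adj x w}

/-- A planar embedding: vertices are distinct points of the plane, every edge is a simple curve
joining its two endpoints, and edges meet vertices and each other only at common endpoints. -/
structure PlanarEmbedding (G : NatGraph) where
  pos : ℕ → ℝ × ℝ
  arc : Sym2 ℕ → unitInterval → ℝ × ℝ
  pos_injOn : Set.InjOn pos G.verts
  arc_continuous : ∀ e ∈ G.edgeSet, Continuous (arc e)
  arc_injective : ∀ e ∈ G.edgeSet, Function.Injective (arc e)
  arc_ends : ∀ e ∈ G.edgeSet, s(arc e 0, arc e 1) = Sym2.map pos e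
  arc_ne_pos : ∀ e ∈ G.edgeSet, ∀ t : unitInterval, t ≠ 0 → t ≠ 1 →
    ∀ v ∈ G.verts, arc e t ≠ pos v
  arc_ne_arc : ∀ e ∈ G.edgeSet, ∀ e' ∈ G.edgeSet, e ≠ e' →
    ∀ t t' : unitInterval, t ≠ 0 → t ≠ 1 → t' ≠ 0 → t' ≠ 1 → arc e t ≠ arc e' t'

/-- A graph is planar if it has a planar embedding. -/
def IsPlanar (G : NatGraph) : Prop := Nonempty (PlanarEmbedding G)

/-- `C` is a wide diamond of `G`: there are distinct vertices `v, u` outside `C` such that every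
vertex of `C` has neighbourhood exactly `{v, u}`. -/
def IsWideDiamond (G : NatGraph) (C : Finset ℕ) : Prop :=
  (C : Set ℕ) ⊆ G.verts ∧
    ∃ v u : ℕ, v ∈ G.verts \ (C : Set ℕ) ∧ u ∈ G.verts \ (C : Set ℕ) ∧ v ≠ u ∧
      ∀ c ∈ C, G.neighborSet c = {v, u}

/-! ## Dominating sets -/

/-- `D` is a dominating set of `G`. -/
def IsDominatingSet (G : NatGraph) (D : Finset ℕ) : Prop :=
  (D : Set ℕ) ⊆ G.verts ∧ closedNbhd G (D : Set ℕ) = G.verts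

/-- `D` is a dominating set of `G` of minimum size. -/
def IsMinDominatingSet (G : NatGraph) (D : Finset ℕ) : Prop :=
  IsDominatingSet G D ∧ ∀ D' : Finset ℕ, IsDominatingSet G D' → D.card ≤ D'.card

/-- The number of minimum dominating sets of `G` that have size at most `k`. -/
noncomputable def numMinDS (G : NatGraph) (k : ℤ) : ℕ :=
  Set.ncard {D : Finset ℕ | IsMinDominatingSet G D ∧ (D.card : ℤ) ≤ k}

/-! ## A random access machine

Registers and memory cells hold integers. The instructions are those of the usual unit-cost RAM
with addition and subtraction as only arithmetic (no multiplication), which is polynomially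
equivalent to Turing machines; control flow is structured. -/

namespace RAM

/-- Programs. Arguments of type `ℕ` are register names. -/
inductive Cmd : Type
  | skip : Cmd
  | const (r : ℕ) (z : ℤ) : Cmd
  | add (r s t : ℕ) : Cmd
  | sub (r s t : ℕ) : Cmd
  | load (r s : ℕ) : Cmd
  | store (r s : ℕ) : Cmd
  | write (r : ℕ) : Cmd
  | seq (a b : Cmd) : Cmd
  | ifPos (r : ℕ) (a b : Cmd) : Cmd
  | whilePos (r : ℕ) (a : Cmd) : Cmd

/-- A configuration: registers, memory, and the word written so far on the output tape. -/
structure State : Type where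
  reg : ℕ → ℤ
  mem : ℤ → ℤ
  out : List ℤ

/-- `Exec a σ n τ`: started in `σ`, the program `a` halts in `τ` after exactly `n` steps, where
each basic instruction and each test of a branch or a loop is one step. -/
inductive Exec : Cmd → State → ℕ → State → Prop
  | skip (σ : State) : Exec .skip σ 1 σ
  | const (σ : State) (r : ℕ) (z : ℤ) :
      Exec (.const r z) σ 1 { σ with reg := Function.update σ.reg r z }
  | add (σ : State) (r s t : ℕ) :
      Exec (.add r s t) σ 1 { σ with reg := Function.update σ.reg r (σ.reg s + σ.reg t) }
  | sub (σ : State) (r s t : ℕ) :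
      Exec (.sub r s t) σ 1 { σ with reg := Function.update σ.reg r (σ.reg s - σ.reg t) }
  | load (σ : State) (r s : ℕ) :
      Exec (.load r s) σ 1 { σ with reg := Function.update σ.reg r (σ.mem (σ.reg s)) }
  | store (σ : State) (r s : ℕ) :
      Exec (.store r s) σ 1 { σ with mem := Function.update σ.mem (σ.reg r) (σ.reg s) }
  | write (σ : State) (r : ℕ) :
      Exec (.write r) σ 1 { σ with out := σ.out ++ [σ.reg r] }
  | seq {a b : Cmd} {σ τ υ : State} {m n : ℕ} :
      Exec a σ m τ → Exec b τ n υ → Exec (.seq a b) σ (m + n) υ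
  | ifPos_true {r : ℕ} {a b : Cmd} {σ τ : State} {n : ℕ} :
      0 < σ.reg r → Exec a σ n τ → Exec (.ifPos r a b) σ (1 + n) τ
  | ifPos_false {r : ℕ} {a b : Cmd} {σ τ : State} {n : ℕ} :
      ¬ 0 < σ.reg r → Exec b σ n τ → Exec (.ifPos r a b) σ (1 + n) τ
  | while_true {r : ℕ} {a : Cmd} {σ τ υ : State} {m n : ℕ} :
      0 < σ.reg r → Exec a σ m τ → Exec (.whilePos r a) τ n υ →
      Exec (.whilePos r a) σ (1 + m + n) υ
  | while_false {r : ℕ} {a : Cmd} {σ : State} :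
      ¬ 0 < σ.reg r → Exec (.whilePos r a) σ 1 σ

/-- The initial configuration on input `w`: the word stands in the memory cells
`0, …, w.length - 1`, its length in register `0`; everything else is zero, the output is empty. -/
def init (w : List ℤ) : State where
  reg := fun r => if r = 0 then (w.length : ℤ) else 0
  mem := fun i => if 0 ≤ i then w.getD i.toNat 0 else 0
  out := []

/-- On input `w` the program halts within `n` steps with output `w'`. -/
def OutputsWithin (a : Cmd) (w : List ℤ) (n : ℕ) (w' : List ℤ) : Prop :=
  ∃ (t : ℕ) (τ : State), t ≤ n ∧ Exec a (init w) t τ ∧ τ.out = w'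

/-- The length of an input word: the total number of bits of its entries, with one extra symbol
per entry (sign or separator). -/
def inputSize (w : List ℤ) : ℕ := (w.map fun z => z.natAbs.size + 1).sum

end RAM

/-! ## Encodings

A list of naturals or of pairs is written down entry by entry and closed by `-1`. -/

/-- `w` is an encoding of the finite set `S`: its elements in some order, closed by `-1`. -/
def EncodesSet (w : List ℤ) (S : Set ℕ) : Prop :=
  ∃ L : List ℕ, L.Nodup ∧ (∀ a, a ∈ L ↔ a ∈ S) ∧ w = L.map (fun a : ℕ => (a : ℤ)) ++ [-1]

/-- `w` is an encoding of the finite edge set `S`: each edge once, given by its two endpoints in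
either order, and the whole closed by `-1`. -/
def EncodesEdges (w : List ℤ) (S : Set (Sym2 ℕ)) : Prop :=
  ∃ L : List (ℕ × ℕ), (L.map fun p => s(p.1, p.2)).Nodup ∧
    (∀ e, e ∈ L.map (fun p => s(p.1, p.2)) ↔ e ∈ S) ∧
    w = L.flatMap (fun p : ℕ × ℕ => [(p.1 : ℤ), (p.2 : ℤ)]) ++ [-1]

/-- `w` is an encoding of the finite graph `G`: its vertices, then its edges. -/
def EncodesGraph (w : List ℤ) (G : NatGraph) : Prop :=
  ∃ x y : List ℤ, EncodesSet x G.verts ∧ EncodesEdges y G.edgeSet ∧ w = x ++ y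

/-- `w` is an encoding of the input `(G, C, k)`. -/
def EncodesInput (w : List ℤ) (G : NatGraph) (C : Finset ℕ) (k : ℤ) : Prop :=
  ∃ x y : List ℤ, EncodesGraph x G ∧ EncodesSet y (C : Set ℕ) ∧ w = x ++ y ++ [k]

/-- `w` is an encoding of the output `(G, k)`. -/
def EncodesOutput (w : List ℤ) (G : NatGraph) (k : ℤ) : Prop :=
  ∃ x : List ℤ, EncodesGraph x G ∧ w = x ++ [k]

/-!
Let `n` be the size of the wide diamond between `v` and `u`. A minimum dominating set that contains
neither `v` nor `u` would contain the whole diamond, so for `n ≥ 3` it contains `v` or `u`, and at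
most one vertex of the diamond, which then saves one of the vertices `v`, `u`: only the number `n`
of choices for it matters. The diamond is replaced by a gadget with the same two neighbours: roots
adjacent to `v` and `u`, and paths of length three, the legs, hanging from the roots. A minimum
dominating set contains exactly one of the three vertices of each leg; it is the middle one, unless
the root of the leg is chosen as well, in which case it may also be the outermost one. Hence a root
with `b` legs can be chosen in `2 ^ b` ways, and the bound grows by the number of legs. Writing `n`
greedily as a sum of powers of two takes `O(log n)` roots and `O(log² n)` vertices, no more than `n`
for `n ≥ 128`; smaller diamonds are left alone.

The gadget stays planar because a root has degree two: it can be slid along the curve through it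
from `v` to `u` to a point on the boundary of a disc that misses the drawing, and all its legs can
be drawn as straight segments into that disc.
-/

section

open Set Metric

variable {E : Type*} [NormedAddCommGroup E] [NormedSpace ℝ E]

theorem exists_mem_sphere_eq_pointReflection (hE : 1 < Module.rank ℝ E) {α : Type*} [LinearOrder α]
    [TopologicalSpace α] [OrderClosedTopology α] {x : E} {r : ℝ} (hr : 0 ≤ r) {g : E → α}
    (hg : ContinuousOn g (sphere x r)) :
    ∃ y ∈ sphere x r, g y = g (Equiv.pointReflection x y) := by
  have : Nontrivial E := (rank_pos_iff_nontrivial (R := ℝ)).mp (zero_lt_one.trans hE)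
  obtain ⟨a, ha⟩ : (sphere x r).Nonempty := NormedSpace.sphere_nonempty.mpr hr
  have hmaps : MapsTo (Equiv.pointReflection x) (sphere x r) (sphere x r) := fun y hy => by
    rw [mem_sphere, dist_comm, dist_left_pointReflection, dist_comm]
    exact hy
  have hg' : ContinuousOn (fun y => g (Equiv.pointReflection x y)) (sphere x r) :=
    hg.comp (AffineIsometryEquiv.pointReflection ℝ x).continuous.continuousOn hmaps
  have hconn := isPreconnected_sphere hE x r
  rcases le_total (g a) (g (Equiv.pointReflection x a)) with h | h
  · exact hconn.intermediate_value₂ ha (hmaps ha) hg hg' h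
      (by rwa [Equiv.pointReflection_involutive])
  · exact hconn.intermediate_value₂ (hmaps ha) ha hg hg'
      (by rwa [Equiv.pointReflection_involutive]) h

theorem interior_range_eq_empty_of_injective (hE : 1 < Module.rank ℝ E) {γ : unitInterval → E}
    (hγ : Continuous γ) (hinj : Function.Injective γ) : interior (range γ) = ∅ := by
  refine eq_empty_of_forall_notMem fun x hx => ?_
  obtain ⟨ε, hε, hball⟩ := Metric.mem_nhds_iff.mp (mem_interior_iff_mem_nhds.mp hx)
  have hright : ∀ y ∈ range γ, γ (Function.invFun γ y) = y := fun y => Function.invFun_eq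
  have hinv : ContinuousOn (Function.invFun γ) (range γ) :=
    (hγ.isClosedEmbedding hinj).isInducing.continuousOn_iff.mpr
      (continuousOn_id.congr fun y hy => hright y hy)
  have hsphere : sphere x (ε / 2) ⊆ range γ :=
    (sphere_subset_ball (half_lt_self hε)).trans hball
  obtain ⟨y, hy, heq⟩ := exists_mem_sphere_eq_pointReflection hE (half_pos hε).le
    (hinv.mono hsphere)
  have hrefl : Equiv.pointReflection x y ∈ range γ := hsphere (by
    rw [mem_sphere, dist_comm, dist_left_pointReflection, dist_comm]; exact hy)
  have hfix : y = Equiv.pointReflection x y :=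
    (hright y (hsphere hy)).symm.trans ((congrArg γ heq).trans (hright _ hrefl))
  have hyx : y = x := (AffineEquiv.pointReflection_fixed_iff_of_module ℝ).mp hfix.symm
  rw [hyx, mem_sphere, dist_self] at hy
  linarith

theorem exists_rays_into_ball (hE : 1 < Module.rank ℝ E) {p y : E} (hpy : p ≠ y) {L : ℝ}
    (hL : 0 < L) :
    ∃ w : ℕ → E, (∀ n (s : ℝ), 0 < s → s ≤ L → p + s • w n ∈ ball y (dist y p)) ∧
      ∀ n n' (s s' : ℝ), 0 < s → s • w n = s' • w n' → n = n' ∧ s = s' := by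
  have hd : y - p ≠ 0 := sub_ne_zero.mpr hpy.symm
  obtain ⟨e, he⟩ := exists_linearIndependent_pair_of_one_lt_rank hE hd
  rw [LinearIndependent.pair_iff] at he
  obtain ⟨ε, hε, hεe⟩ := exists_pos_mul_lt (norm_pos_iff.mpr hd) ‖e‖
  have hinj : ∀ m n : ℕ, ε / (m + 1) = ε / (n + 1) → m = n := fun m n h => by
    simpa [div_eq_mul_inv, hε.ne'] using h
  have hball : ∀ n : ℕ, y + (ε / (n + 1)) • e ∈ ball y (dist y p) := fun n => by
    rw [mem_ball, dist_self_add_left, norm_smul, Real.norm_of_nonneg (by positivity), dist_eq_norm]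
    calc ε / (n + 1) * ‖e‖ ≤ ε * ‖e‖ := by
          gcongr
          exact div_le_self hε.le (by linarith [(Nat.cast_nonneg n : (0 : ℝ) ≤ n)])
      _ < ‖y - p‖ := by rwa [mul_comm]
  have hp : p ∈ closure (ball y (dist y p)) := by
    rw [closure_ball y (dist_ne_zero.mpr hpy.symm), mem_closedBall, dist_comm]
  refine ⟨fun n => L⁻¹ • (y - p + (ε / (n + 1)) • e), fun n s hs hsL => ?_,
    fun n n' s s' hs h => ?_⟩
  · have hmem := (convex_ball y (dist y p)).add_smul_sub_mem_interior' hp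
      (by rw [isOpen_ball.interior_eq]; exact hball n) (t := s / L)
      ⟨by positivity, (div_le_one hL).mpr hsL⟩
    rw [isOpen_ball.interior_eq] at hmem
    convert hmem using 2
    rw [smul_smul, ← div_eq_mul_inv, add_sub_right_comm]
  · have hlin : (L⁻¹ * (s - s')) • (y - p) +
        (L⁻¹ * (s * (ε / (n + 1)) - s' * (ε / (n' + 1)))) • e = 0 := by
      rw [← sub_eq_zero.mpr h]; module
    obtain ⟨h₁, h₂⟩ := he _ _ hlin
    obtain rfl : s = s' := by simpa [hL.ne', sub_eq_zero] using h₁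
    exact ⟨hinj _ _ (mul_left_cancel₀ hs.ne' (by simpa [hL.ne', sub_eq_zero] using h₂)), rfl⟩

theorem exists_ball_disjoint_union {X : Type*} [PseudoMetricSpace X] [ProperSpace X] {D Γ : Set X}
    (hD : IsClosed D) (hΓ : IsClosed Γ) (hint : interior Γ = ∅) {x : X} (hxΓ : x ∈ Γ)
    (hxD : x ∉ D) :
    ∃ y ∉ Γ, ∃ p ∈ Γ \ D, Disjoint (ball y (dist y p)) (D ∪ Γ) := by
  obtain ⟨δ, hδ, hball⟩ := Metric.mem_nhds_iff.mp (hD.isOpen_compl.mem_nhds hxD)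
  obtain ⟨y, hyx, hyΓ⟩ := (interior_eq_empty_iff_dense_compl.mp hint).exists_mem_open isOpen_ball
    ⟨x, mem_ball_self (half_pos hδ)⟩ |>.imp fun _ h => h.symm
  obtain ⟨p, hp, hdist⟩ := (hD.union hΓ).exists_infDist_eq_dist ⟨x, Or.inr hxΓ⟩ y
  have hmin : ∀ z ∈ D ∪ Γ, dist y p ≤ dist y z := fun z hz => hdist ▸ infDist_le_dist_of_mem hz
  have hpD : p ∉ D := hball <| by
    calc dist p x ≤ dist p y + dist y x := dist_triangle _ _ _
      _ ≤ dist y x + dist y x := by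
        rw [dist_comm p y]
        gcongr
        exact hmin x (Or.inr hxΓ)
      _ < δ := by linarith [mem_ball.mp hyx]
  refine ⟨y, hyΓ, p, ⟨hp.resolve_left hpD, hpD⟩, Set.disjoint_left.mpr fun z hz hzD => ?_⟩
  rw [mem_ball, dist_comm] at hz
  exact (hmin z hzD).not_gt hz

theorem path_trans_injective {X : Type*} [TopologicalSpace X] {a b c : X} {η : Path a b}
    {θ : Path b c} (hη : Function.Injective η) (hθ : Function.Injective θ)
    (h : ∀ s t, η s = θ t → s = 1 ∧ t = 0) : Function.Injective (η.trans θ) := by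
  intro s t hst
  rw [Path.trans_apply, Path.trans_apply] at hst
  split_ifs at hst with hs ht ht
  · exact Subtype.ext (by simpa using hη hst)
  · exact absurd (congrArg Subtype.val (h _ _ hst).2) (by dsimp only [Icc.coe_zero]; linarith)
  · exact absurd (congrArg Subtype.val (h _ _ hst.symm).2) (by dsimp only [Icc.coe_zero]; linarith)
  · exact Subtype.ext (by simpa using hθ hst)

theorem subpath_injective {X : Type*} [TopologicalSpace X] {a b : X} {γ : Path a b}
    (hγ : Function.Injective γ) {t₀ t₁ : unitInterval} (h : t₀ ≠ t₁) :
    Function.Injective (γ.subpath t₀ t₁) := by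
  refine hγ.comp fun s t hst => ?_
  have hlin : ((t₁ : ℝ) - t₀) * (s - t) = 0 := by
    have := congrArg Subtype.val hst
    simp only [Icc.convexComb] at this
    linear_combination this
  exact Subtype.ext (sub_eq_zero.mp ((mul_eq_zero.mp hlin).resolve_left
    (sub_ne_zero.mpr fun h' => h (Subtype.ext h'.symm))))

end

theorem finite_edgeSet_of_finite_verts {G : NatGraph} (hG : G.verts.Finite) : G.edgeSet.Finite :=
  ((hG.prod hG).image fun p : ℕ × ℕ => s(p.1, p.2)).subset fun e =>
    e.ind fun a b h => ⟨(a, b), ⟨G.edge_vert h, G.edge_vert h.symm⟩, rfl⟩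

/-! ### Planar embeddings -/

namespace PlanarEmbedding

open Set

variable {G H K : NatGraph}

/-- The points of the plane covered by a planar embedding. -/
def drawing (E : PlanarEmbedding G) : Set (ℝ × ℝ) :=
  E.pos '' G.verts ∪ ⋃ e ∈ G.edgeSet, range (E.arc e)

section

variable (E : PlanarEmbedding G)

theorem pos_mem_drawing {a : ℕ} (ha : a ∈ G.verts) : E.pos a ∈ E.drawing :=
  Or.inl (mem_image_of_mem _ ha)

theorem arc_mem_drawing {e : Sym2 ℕ} (he : e ∈ G.edgeSet) (t : unitInterval) :
    E.arc e t ∈ E.drawing :=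
  Or.inr (mem_biUnion he (mem_range_self t))

theorem exists_mem_arc_eq_pos {e : Sym2 ℕ} (he : e ∈ G.edgeSet) {t : unitInterval}
    (ht : t = 0 ∨ t = 1) : ∃ a ∈ e, E.arc e t = E.pos a := by
  have hmem : E.arc e t ∈ Sym2.map E.pos e := by
    rw [← E.arc_ends e he]
    rcases ht with rfl | rfl
    · exact Sym2.mem_mk_left _ _
    · exact Sym2.mem_mk_right _ _
  obtain ⟨a, ha, h⟩ := Sym2.mem_map.mp hmem
  exact ⟨a, ha, h.symm⟩

theorem mem_drawing_iff {x : ℝ × ℝ} : x ∈ E.drawing ↔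
    (∃ a ∈ G.verts, E.pos a = x) ∨ ∃ e ∈ G.edgeSet, ∃ t, t ≠ 0 ∧ t ≠ 1 ∧ E.arc e t = x := by
  constructor
  · rintro (hx | hx)
    · exact Or.inl hx
    · obtain ⟨e, he, t, rfl⟩ := mem_iUnion₂.mp hx
      by_cases ht : t = 0 ∨ t = 1
      · obtain ⟨a, ha, h⟩ := E.exists_mem_arc_eq_pos he ht
        exact Or.inl ⟨a, SimpleGraph.Subgraph.mem_verts_of_mem_edge he ha, h.symm⟩
      · rw [not_or] at ht
        exact Or.inr ⟨e, he, t, ht.1, ht.2, rfl⟩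
  · rintro (⟨a, ha, rfl⟩ | ⟨e, he, t, -, -, rfl⟩)
    · exact E.pos_mem_drawing ha
    · exact E.arc_mem_drawing he t

theorem isClosed_drawing (hfin : G.verts.Finite) : IsClosed E.drawing :=
  (hfin.image _).isClosed.union <| (finite_edgeSet_of_finite_verts hfin).isClosed_biUnion
    fun e he => (isCompact_range (E.arc_continuous e he)).isClosed

/-- A planar embedding of `G`, regarded as one of a subgraph of `G`. -/
def restrict (h : H ≤ G) : PlanarEmbedding H where
  pos := E.pos
  arc := E.arc
  pos_injOn := E.pos_injOn.mono h.1
  arc_continuous e he := E.arc_continuous e (SimpleGraph.Subgraph.edgeSet_mono h he)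
  arc_injective e he := E.arc_injective e (SimpleGraph.Subgraph.edgeSet_mono h he)
  arc_ends e he := E.arc_ends e (SimpleGraph.Subgraph.edgeSet_mono h he)
  arc_ne_pos e he t h0 h1 v hv :=
    E.arc_ne_pos e (SimpleGraph.Subgraph.edgeSet_mono h he) t h0 h1 v (h.1 hv)
  arc_ne_arc e he e' he' := E.arc_ne_arc e (SimpleGraph.Subgraph.edgeSet_mono h he) e'
    (SimpleGraph.Subgraph.edgeSet_mono h he')

theorem drawing_restrict_subset (h : H ≤ G) : (E.restrict h).drawing ⊆ E.drawing :=
  union_subset_union (image_mono h.1)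
    (biUnion_subset_biUnion_left (SimpleGraph.Subgraph.edgeSet_mono h))

theorem pos_notMem_drawing_restrict (h : H ≤ G) {a : ℕ} (ha : a ∈ G.verts) (haH : a ∉ H.verts) :
    E.pos a ∉ (E.restrict h).drawing := by
  rw [mem_drawing_iff]
  rintro (⟨b, hb, hba⟩ | ⟨e, he, t, h0, h1, hta⟩)
  · exact haH (E.pos_injOn (h.1 hb) ha hba ▸ hb)
  · exact E.arc_ne_pos e (SimpleGraph.Subgraph.edgeSet_mono h he) t h0 h1 a ha hta

theorem arc_notMem_drawing_restrict (h : H ≤ G) {e : Sym2 ℕ} (he : e ∈ G.edgeSet)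
    (heH : e ∉ H.edgeSet) {t : unitInterval} (h0 : t ≠ 0) (h1 : t ≠ 1) :
    E.arc e t ∉ (E.restrict h).drawing := by
  rw [mem_drawing_iff]
  rintro (⟨a, ha, hat⟩ | ⟨e', he', t', h0', h1', htt⟩)
  · exact E.arc_ne_pos e he t h0 h1 a (h.1 ha) hat.symm
  · exact E.arc_ne_arc e' (SimpleGraph.Subgraph.edgeSet_mono h he') e he
      (fun hee => heH (hee ▸ he')) t' t h0' h1' h0 h1 htt

theorem exists_path_of_adj {a b : ℕ} (h : G.Adj a b) :
    ∃ η : Path (E.pos a) (E.pos b), Function.Injective η ∧ range η ⊆ range (E.arc s(a, b)) ∧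
      ∀ ⦃H : NatGraph⦄ (hH : H ≤ G), ¬ H.Adj a b → ∀ t, t ≠ 0 → t ≠ 1 →
        η t ∉ (E.restrict hH).drawing := by
  have he : s(a, b) ∈ G.edgeSet := h
  have hends := E.arc_ends _ he
  rw [Sym2.map_mk, Sym2.eq_iff] at hends
  rcases hends with ⟨h0, h1⟩ | ⟨h0, h1⟩
  · exact ⟨⟨⟨E.arc s(a, b), E.arc_continuous _ he⟩, h0, h1⟩, E.arc_injective _ he, Subset.rfl,
      fun H hH hab t => E.arc_notMem_drawing_restrict hH he hab⟩
  · refine ⟨⟨⟨E.arc s(a, b) ∘ unitInterval.symm,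
      (E.arc_continuous _ he).comp unitInterval.continuous_symm⟩, ?_, ?_⟩,
      (E.arc_injective _ he).comp unitInterval.symm_bijective.injective,
      range_subset_iff.mpr fun t => ⟨unitInterval.symm t, rfl⟩,
      fun H hH hab t ht0 ht1 => E.arc_notMem_drawing_restrict hH he hab ?_ ?_⟩
    · simpa using h1
    · simpa using h0
    · rwa [ne_eq, unitInterval.symm_eq_zero]
    · rwa [ne_eq, unitInterval.symm_eq_one]

end

/-- Two planar embeddings that agree on the common vertices of the embedded graphs and whose
drawings meet nowhere else, so that together they form a planar embedding of the union. -/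
structure Glueable (E : PlanarEmbedding H) (F : PlanarEmbedding K) : Prop where
  pos_eq : ∀ a ∈ H.verts, a ∈ K.verts → E.pos a = F.pos a
  drawing_inter_subset : E.drawing ∩ F.drawing ⊆ E.pos '' (H.verts ∩ K.verts)

namespace Glueable

variable {E : PlanarEmbedding H} {F : PlanarEmbedding K}

theorem symm (h : Glueable E F) : Glueable F E where
  pos_eq a haK haH := (h.pos_eq a haH haK).symm
  drawing_inter_subset := by
    rintro x ⟨hxF, hxE⟩
    obtain ⟨a, ⟨haH, haK⟩, rfl⟩ := h.drawing_inter_subset ⟨hxE, hxF⟩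
    exact ⟨a, ⟨haK, haH⟩, (h.pos_eq a haH haK).symm⟩

theorem arc_notMem_drawing (h : Glueable E F) {e : Sym2 ℕ} (he : e ∈ H.edgeSet)
    {t : unitInterval} (h0 : t ≠ 0) (h1 : t ≠ 1) : E.arc e t ∉ F.drawing := fun hF => by
  obtain ⟨a, ⟨haH, -⟩, hat⟩ := h.drawing_inter_subset ⟨E.arc_mem_drawing he t, hF⟩
  exact E.arc_ne_pos e he t h0 h1 a haH hat.symm

theorem eq_of_pos_eq (h : Glueable E F) {a b : ℕ} (ha : a ∈ H.verts) (hb : b ∈ K.verts)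
    (hab : E.pos a = F.pos b) : a = b := by
  obtain ⟨d, ⟨hdH, hdK⟩, hd⟩ :=
    h.drawing_inter_subset ⟨E.pos_mem_drawing ha, hab ▸ F.pos_mem_drawing hb⟩
  obtain rfl := E.pos_injOn hdH ha hd
  exact F.pos_injOn hdK hb ((h.pos_eq d hdH hdK).symm.trans hab)

open Classical in
/-- The vertex positions of the union of two planar embeddings. -/
noncomputable def gluePos (E : PlanarEmbedding H) (F : PlanarEmbedding K) (a : ℕ) : ℝ × ℝ :=
  if a ∈ H.verts then E.pos a else F.pos a

open Classical in
/-- The edges of the union of two planar embeddings; a common edge is drawn as in the first. -/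
noncomputable def glueArc (E : PlanarEmbedding H) (F : PlanarEmbedding K) (e : Sym2 ℕ) :
    unitInterval → ℝ × ℝ :=
  if e ∈ H.edgeSet then E.arc e else F.arc e

theorem gluePos_left {a : ℕ} (ha : a ∈ H.verts) : gluePos E F a = E.pos a := if_pos ha

theorem gluePos_right (h : Glueable E F) {a : ℕ} (ha : a ∈ K.verts) :
    gluePos E F a = F.pos a := by
  unfold gluePos
  split_ifs with haH
  · exact h.pos_eq a haH ha
  · rfl

theorem glueArc_cases {e : Sym2 ℕ} (he : e ∈ (H ⊔ K).edgeSet) :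
    (e ∈ H.edgeSet ∧ glueArc E F e = E.arc e) ∨ (e ∈ K.edgeSet ∧ glueArc E F e = F.arc e) := by
  unfold glueArc
  split_ifs with heH
  · exact Or.inl ⟨heH, rfl⟩
  · rw [SimpleGraph.Subgraph.edgeSet_sup] at he
    exact Or.inr ⟨he.resolve_left heH, rfl⟩

theorem gluePos_injOn (h : Glueable E F) : InjOn (gluePos E F) (H ⊔ K).verts := by
  rintro a (ha | ha) b (hb | hb) hab
  · rw [gluePos_left ha, gluePos_left hb] at hab
    exact E.pos_injOn ha hb hab
  · rw [gluePos_left ha, h.gluePos_right hb] at hab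
    exact h.eq_of_pos_eq ha hb hab
  · rw [h.gluePos_right ha, gluePos_left hb] at hab
    exact (h.eq_of_pos_eq hb ha hab.symm).symm
  · rw [h.gluePos_right ha, h.gluePos_right hb] at hab
    exact F.pos_injOn ha hb hab

theorem glueArc_ends (h : Glueable E F) {e : Sym2 ℕ} (he : e ∈ (H ⊔ K).edgeSet) :
    s(glueArc E F e 0, glueArc E F e 1) = Sym2.map (gluePos E F) e := by
  rcases glueArc_cases (E := E) (F := F) he with ⟨heH, h'⟩ | ⟨heK, h'⟩
  · rw [h', E.arc_ends e heH]
    exact Sym2.map_congr fun a ha =>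
      (gluePos_left (SimpleGraph.Subgraph.mem_verts_of_mem_edge heH ha)).symm
  · rw [h', F.arc_ends e heK]
    exact Sym2.map_congr fun a ha =>
      (h.gluePos_right (SimpleGraph.Subgraph.mem_verts_of_mem_edge heK ha)).symm

theorem glueArc_ne_pos (h : Glueable E F) {e : Sym2 ℕ} (he : e ∈ (H ⊔ K).edgeSet)
    {t : unitInterval} (h0 : t ≠ 0) (h1 : t ≠ 1) {a : ℕ} (ha : a ∈ (H ⊔ K).verts) :
    glueArc E F e t ≠ gluePos E F a := by
  rcases glueArc_cases (E := E) (F := F) he with ⟨heH, h'⟩ | ⟨heK, h'⟩ <;> rcases ha with ha | ha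
  · rw [h', gluePos_left ha]
    exact E.arc_ne_pos e heH t h0 h1 a ha
  · rw [h', h.gluePos_right ha]
    exact fun hta => h.arc_notMem_drawing heH h0 h1 (hta ▸ F.pos_mem_drawing ha)
  · rw [h', gluePos_left ha]
    exact fun hta => h.symm.arc_notMem_drawing heK h0 h1 (hta ▸ E.pos_mem_drawing ha)
  · rw [h', h.gluePos_right ha]
    exact F.arc_ne_pos e heK t h0 h1 a ha

theorem glueArc_ne_glueArc (h : Glueable E F) {e e' : Sym2 ℕ} (he : e ∈ (H ⊔ K).edgeSet)
    (he' : e' ∈ (H ⊔ K).edgeSet) (hee : e ≠ e') {t t' : unitInterval} (h0 : t ≠ 0) (h1 : t ≠ 1)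
    (h0' : t' ≠ 0) (h1' : t' ≠ 1) : glueArc E F e t ≠ glueArc E F e' t' := by
  rcases glueArc_cases (E := E) (F := F) he with ⟨heH, hG⟩ | ⟨heK, hG⟩ <;>
    rcases glueArc_cases (E := E) (F := F) he' with ⟨heH', hG'⟩ | ⟨heK', hG'⟩ <;> rw [hG, hG']
  · exact E.arc_ne_arc e heH e' heH' hee t t' h0 h1 h0' h1'
  · exact fun htt => h.arc_notMem_drawing heH h0 h1 (htt ▸ F.arc_mem_drawing heK' t')
  · exact fun htt => h.symm.arc_notMem_drawing heK h0 h1 (htt ▸ E.arc_mem_drawing heH' t')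
  · exact F.arc_ne_arc e heK e' heK' hee t t' h0 h1 h0' h1'

/-- The union of two glueable planar embeddings. -/
noncomputable def glue (h : Glueable E F) : PlanarEmbedding (H ⊔ K) where
  pos := gluePos E F
  arc := glueArc E F
  pos_injOn := h.gluePos_injOn
  arc_continuous e he := by
    rcases glueArc_cases (E := E) (F := F) he with ⟨heH, h'⟩ | ⟨heK, h'⟩
    · exact h' ▸ E.arc_continuous e heH
    · exact h' ▸ F.arc_continuous e heK
  arc_injective e he := by
    rcases glueArc_cases (E := E) (F := F) he with ⟨heH, h'⟩ | ⟨heK, h'⟩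
    · exact h' ▸ E.arc_injective e heH
    · exact h' ▸ F.arc_injective e heK
  arc_ends _ he := h.glueArc_ends he
  arc_ne_pos _ he _ h0 h1 _ ha := h.glueArc_ne_pos he h0 h1 ha
  arc_ne_arc _ he _ he' hee _ _ h0 h1 h0' h1' := h.glueArc_ne_glueArc he he' hee h0 h1 h0' h1'

theorem glue_pos_left (h : Glueable E F) {a : ℕ} (ha : a ∈ H.verts) : h.glue.pos a = E.pos a :=
  gluePos_left ha

theorem glue_pos_right (h : Glueable E F) {a : ℕ} (ha : a ∈ K.verts) : h.glue.pos a = F.pos a :=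
  h.gluePos_right ha

theorem drawing_glue_subset (h : Glueable E F) : h.glue.drawing ⊆ E.drawing ∪ F.drawing := by
  rintro x (⟨a, ha | ha, rfl⟩ | hx)
  · exact Or.inl (h.glue_pos_left ha ▸ E.pos_mem_drawing ha)
  · exact Or.inr (h.glue_pos_right ha ▸ F.pos_mem_drawing ha)
  · obtain ⟨e, he, t, rfl⟩ := mem_iUnion₂.mp hx
    rcases glueArc_cases (E := E) (F := F) he with ⟨heH, h'⟩ | ⟨heK, h'⟩
    · exact Or.inl ((congrFun h' t).symm ▸ E.arc_mem_drawing heH t :)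
    · exact Or.inr ((congrFun h' t).symm ▸ F.arc_mem_drawing heK t :)

end Glueable

end PlanarEmbedding

theorem IsPlanar.mono {G H : NatGraph} (hG : IsPlanar G) (h : H ≤ G) : IsPlanar H :=
  hG.map fun E => E.restrict h

theorem one_lt_rank_plane : 1 < Module.rank ℝ (ℝ × ℝ) := by
  rw [rank_prod', Module.rank_self, one_add_one_eq_two]
  exact Cardinal.one_lt_two

namespace PlanarEmbedding

open Set Metric

variable {G H : NatGraph}

/-- The planar embedding of a single edge along a simple curve. -/
noncomputable def ofPath {a b : ℕ} (hab : (⊤ : SimpleGraph ℕ).Adj a b) {x y : ℝ × ℝ} (γ : Path x y)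
    (hγ : Function.Injective γ) : PlanarEmbedding (SimpleGraph.subgraphOfAdj ⊤ hab) where
  pos n := if n = a then x else y
  arc _ := γ
  pos_injOn := by
    have hxy : x ≠ y := fun h => zero_ne_one (hγ (γ.source.trans (h.trans γ.target.symm)))
    rintro m (rfl | rfl) n (rfl | rfl) h <;>
      simp_all [hab.ne, hab.ne.symm, hxy.symm]
  arc_continuous _ _ := γ.continuous
  arc_injective _ _ := hγ
  arc_ends e he := by
    rw [SimpleGraph.edgeSet_subgraphOfAdj, mem_singleton_iff] at he
    subst he
    simp [hab.ne.symm]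
  arc_ne_pos _ _ t h0 h1 n _ := by
    split_ifs
    · exact fun h => h0 (hγ (h.trans γ.source.symm))
    · exact fun h => h1 (hγ (h.trans γ.target.symm))
  arc_ne_arc e he e' he' hee := by
    rw [SimpleGraph.edgeSet_subgraphOfAdj, mem_singleton_iff] at he he'
    exact absurd (he.trans he'.symm) hee

theorem ofPath_pos_left {a b : ℕ} (hab : (⊤ : SimpleGraph ℕ).Adj a b) {x y : ℝ × ℝ} (γ : Path x y)
    (hγ : Function.Injective γ) : (ofPath hab γ hγ).pos a = x := if_pos rfl

theorem ofPath_pos_right {a b : ℕ} (hab : (⊤ : SimpleGraph ℕ).Adj a b) {x y : ℝ × ℝ} (γ : Path x y)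
    (hγ : Function.Injective γ) : (ofPath hab γ hγ).pos b = y := if_neg hab.ne.symm

theorem drawing_ofPath_subset {a b : ℕ} (hab : (⊤ : SimpleGraph ℕ).Adj a b) {x y : ℝ × ℝ}
    (γ : Path x y) (hγ : Function.Injective γ) : (ofPath hab γ hγ).drawing ⊆ range γ := by
  rintro z (⟨n, -, rfl⟩ | hz)
  · rcases eq_or_ne n a with rfl | hn
    · exact ⟨0, γ.source.trans (ofPath_pos_left hab γ hγ).symm⟩
    · exact ⟨1, γ.target.trans (if_neg hn).symm⟩
  · obtain ⟨e, -, t, rfl⟩ := mem_iUnion₂.mp hz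
    exact mem_range_self t

theorem glueable_ofPath {E : PlanarEmbedding H} {a b : ℕ} (hab : (⊤ : SimpleGraph ℕ).Adj a b)
    {x y : ℝ × ℝ} {γ : Path x y} (hγ : Function.Injective γ) (ha : a ∈ H.verts → E.pos a = x)
    (hb : b ∈ H.verts → E.pos b = y)
    (hmeet : ∀ z ∈ range γ, z ∈ E.drawing → z = x ∧ a ∈ H.verts ∨ z = y ∧ b ∈ H.verts) :
    Glueable E (ofPath hab γ hγ) where
  pos_eq n hn := by
    rintro (rfl | rfl)
    · rw [ofPath_pos_left, ha hn]
    · rw [ofPath_pos_right, hb hn]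
  drawing_inter_subset := by
    rintro z ⟨hzE, hzγ⟩
    rcases hmeet z (drawing_ofPath_subset hab γ hγ hzγ) hzE with ⟨rfl, haH⟩ | ⟨rfl, hbH⟩
    · exact ⟨a, ⟨haH, Or.inl rfl⟩, ha haH⟩
    · exact ⟨b, ⟨hbH, Or.inr rfl⟩, hb hbH⟩

theorem exists_path_through (E : PlanarEmbedding G) {c v u : ℕ} (hcv : G.Adj c v)
    (hcu : G.Adj c u) (hvu : v ≠ u) (hH : H ≤ G) (hcH : c ∉ H.verts) :
    ∃ γ : Path (E.pos v) (E.pos u), Function.Injective γ ∧ E.pos c ∈ range γ ∧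
      ∀ t, γ t ∈ (E.restrict hH).drawing → t = 0 ∨ t = 1 := by
  obtain ⟨η, hη, hηarc, hηoff⟩ := E.exists_path_of_adj hcv.symm
  obtain ⟨θ, hθ, -, hθoff⟩ := E.exists_path_of_adj hcu
  have hc : E.pos c ∉ (E.restrict hH).drawing :=
    E.pos_notMem_drawing_restrict hH (G.edge_vert hcv) hcH
  have hηH : ∀ s, η s ∈ (E.restrict hH).drawing → s = 0 := fun s hs => by
    by_contra h0
    rcases eq_or_ne s 1 with rfl | h1
    · exact hc (η.target ▸ hs)
    · exact hηoff hH (fun h => hcH (H.edge_vert h.symm)) s h0 h1 hs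
  have hθH : ∀ s, θ s ∈ (E.restrict hH).drawing → s = 1 := fun s hs => by
    by_contra h1
    rcases eq_or_ne s 0 with rfl | h0
    · exact hc (θ.source ▸ hs)
    · exact hθoff hH (fun h => hcH (H.edge_vert h)) s h0 h1 hs
  have hmeet : ∀ s t, η s = θ t → s = 1 ∧ t = 0 := fun s t hst => by
    have hle := SimpleGraph.subgraphOfAdj_le_of_adj G hcv.symm
    have hmem : θ t ∈ (E.restrict hle).drawing := by
      obtain ⟨s', hs'⟩ := hηarc ⟨s, rfl⟩
      exact hst ▸ hs' ▸ (E.restrict hle).arc_mem_drawing (by simp) s'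
    have ht : t = 0 := by
      by_contra h0
      rcases eq_or_ne t 1 with rfl | h1
      · rw [θ.target] at hmem
        exact E.pos_notMem_drawing_restrict hle (G.edge_vert hcu.symm)
          (by simp [hvu.symm, (G.adj_sub hcu).ne.symm]) hmem
      · exact hθoff hle (by simp [hvu, (G.adj_sub hcu).ne]) t h0 h1 hmem
    subst ht
    exact ⟨hη (hst.trans (θ.source.trans η.target.symm)), rfl⟩
  refine ⟨η.trans θ, path_trans_injective hη hθ hmeet, ?_, fun t ht => ?_⟩
  · rw [Path.trans_range]
    exact Or.inl ⟨1, η.target⟩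
  · rw [Path.trans_apply] at ht
    split_ifs at ht
    · exact Or.inl (Subtype.ext (by simpa using congrArg Subtype.val (hηH _ ht)))
    · refine Or.inr (Subtype.ext ?_)
      have := congrArg Subtype.val (hθH _ ht)
      simp only [Icc.coe_one] at this ⊢
      linarith

theorem exists_sup_subgraphOfAdj (E : PlanarEmbedding H) {c v u : ℕ}
    (hvc : (⊤ : SimpleGraph ℕ).Adj v c) (hcu : (⊤ : SimpleGraph ℕ).Adj c u) (hv : v ∈ H.verts)
    (hu : u ∈ H.verts) (hc : c ∉ H.verts) {γ : Path (E.pos v) (E.pos u)}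
    (hγ : Function.Injective γ) (hγE : ∀ t, γ t ∈ E.drawing → t = 0 ∨ t = 1) {τ : unitInterval}
    (h0 : τ ≠ 0) (h1 : τ ≠ 1) :
    ∃ E' : PlanarEmbedding
        (H ⊔ SimpleGraph.subgraphOfAdj ⊤ hvc ⊔ SimpleGraph.subgraphOfAdj ⊤ hcu),
      E'.pos c = γ τ ∧ E'.drawing ⊆ E.drawing ∪ range γ := by
  have hγ₁ := subpath_injective hγ h0.symm
  have hγ₂ := subpath_injective hγ h1
  have hrange₁ := γ.range_subpath_of_le 0 τ unitInterval.nonneg'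
  have hrange₂ := γ.range_subpath_of_le τ 1 unitInterval.le_one'
  have hglue₁ : Glueable E (ofPath hvc (γ.subpath 0 τ) hγ₁) := by
    refine glueable_ofPath _ hγ₁ (fun _ => γ.source.symm) (fun h => absurd h hc) fun z hz hzE => ?_
    obtain ⟨t, ht, rfl⟩ := hrange₁ ▸ hz
    rcases hγE t hzE with rfl | rfl
    · exact Or.inl ⟨rfl, hv⟩
    · exact absurd (le_antisymm unitInterval.le_one' ht.2) h1
  have hglue₂ : Glueable hglue₁.glue (ofPath hcu (γ.subpath τ 1) hγ₂) := by
    refine glueable_ofPath _ hγ₂ (fun _ => ?_) (fun _ => ?_) fun z hz hzE => ?_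
    · rw [hglue₁.glue_pos_right (Or.inr rfl), ofPath_pos_right]
    · rw [hglue₁.glue_pos_left hu, γ.target]
    · obtain ⟨t, ht, rfl⟩ := hrange₂ ▸ hz
      rcases hglue₁.drawing_glue_subset hzE with hzE | hzγ
      · rcases hγE t hzE with rfl | rfl
        · exact absurd (le_antisymm ht.1 unitInterval.nonneg') h0
        · exact Or.inr ⟨rfl, Or.inl hu⟩
      · obtain ⟨t', ht', htt⟩ := hrange₁ ▸ drawing_ofPath_subset _ _ _ hzγ
        obtain rfl := hγ htt
        exact Or.inl ⟨congrArg γ (le_antisymm ht'.2 ht.1), Or.inr (Or.inr rfl)⟩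
  refine ⟨hglue₂.glue, (hglue₂.glue_pos_right (Or.inl rfl)).trans (ofPath_pos_left _ _ _), ?_⟩
  have hsub₁ := (drawing_ofPath_subset hvc _ hγ₁).trans
    (hrange₁.trans_subset (image_subset_range _ _))
  have hsub₂ := (drawing_ofPath_subset hcu _ hγ₂).trans
    (hrange₂.trans_subset (image_subset_range _ _))
  exact hglue₂.drawing_glue_subset.trans (union_subset (hglue₁.drawing_glue_subset.trans
    (union_subset_union_right _ hsub₁)) (hsub₂.trans subset_union_right))

theorem le_deleteVerts_sup {c v u : ℕ} (hvc : (⊤ : SimpleGraph ℕ).Adj v c)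
    (hcu : (⊤ : SimpleGraph ℕ).Adj c u) (hc : G.neighborSet c ⊆ {v, u}) :
    G ≤ G.deleteVerts {c} ⊔ SimpleGraph.subgraphOfAdj ⊤ hvc ⊔ SimpleGraph.subgraphOfAdj ⊤ hcu := by
  have hadj : ∀ b, G.Adj c b → b = v ∨ b = u := fun b hb => hc hb
  refine ⟨fun a ha => ?_, fun a b hab => ?_⟩
  · by_cases hac : a = c <;> simp [ha, hac]
  · by_cases hac : a = c
    · subst hac
      rcases hadj b hab with rfl | rfl <;> simp
    · by_cases hbc : b = c
      · subst hbc
        rcases hadj a hab.symm with rfl | rfl <;> simp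
      · simp [hab, G.edge_vert hab, G.edge_vert hab.symm, hac, hbc]

theorem exists_disjoint_ball (E : PlanarEmbedding G) (hfin : G.verts.Finite) {c v u : ℕ}
    (hvu : v ≠ u) (hc : G.neighborSet c = {v, u}) :
    ∃ (E' : PlanarEmbedding G) (y : ℝ × ℝ), E'.pos c ≠ y ∧
      Disjoint (ball y (dist y (E'.pos c))) E'.drawing := by
  have hcv : G.Adj c v := hc.ge (mem_insert v {u})
  have hcu : G.Adj c u := hc.ge (mem_insert_of_mem v rfl)
  have hH : G.deleteVerts {c} ≤ G := SimpleGraph.Subgraph.deleteVerts_le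
  have hcH : c ∉ (G.deleteVerts {c}).verts := fun h => h.2 rfl
  obtain ⟨γ, hγ, hcγ, hγG⟩ := E.exists_path_through hcv hcu hvu hH hcH
  obtain ⟨y, hy, p, ⟨⟨τ, rfl⟩, hτ⟩, hdisj⟩ := exists_ball_disjoint_union
    ((E.restrict hH).isClosed_drawing (hfin.subset hH.1)) (isCompact_range γ.continuous).isClosed
    (interior_range_eq_empty_of_injective one_lt_rank_plane γ.continuous hγ) hcγ
    (E.pos_notMem_drawing_restrict hH (G.edge_vert hcv) hcH)
  have hvH : v ∈ (G.deleteVerts {c}).verts := ⟨G.edge_vert hcv.symm, (G.adj_sub hcv).ne'⟩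
  have huH : u ∈ (G.deleteVerts {c}).verts := ⟨G.edge_vert hcu.symm, (G.adj_sub hcu).ne'⟩
  have h0 : τ ≠ 0 := fun h => hτ (h ▸ γ.source.symm ▸ (E.restrict hH).pos_mem_drawing hvH)
  have h1 : τ ≠ 1 := fun h => hτ (h ▸ γ.target.symm ▸ (E.restrict hH).pos_mem_drawing huH)
  obtain ⟨E', hE'c, hE'⟩ := (E.restrict hH).exists_sup_subgraphOfAdj (G.adj_sub hcv.symm)
    (G.adj_sub hcu) hvH huH hcH hγ hγG h0 h1
  refine ⟨E'.restrict (le_deleteVerts_sup _ _ hc.le), y, fun h => hy ⟨τ, hE'c.symm.trans h⟩, ?_⟩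
  exact hE'c ▸ hdisj.mono_right ((E'.drawing_restrict_subset _).trans hE')

/-- A straight-line planar embedding. -/
noncomputable def ofSegments (pos : ℕ → ℝ × ℝ) (hpos : InjOn pos G.verts)
    (hvert : ∀ a b d, G.Adj a b → d ∈ G.verts → pos d ∉ openSegment ℝ (pos a) (pos b))
    (hdisj : ∀ a b a' b', G.Adj a b → G.Adj a' b' → s(a, b) ≠ s(a', b') →
      Disjoint (openSegment ℝ (pos a) (pos b)) (openSegment ℝ (pos a') (pos b'))) :
    PlanarEmbedding G :=
  have hout (e : Sym2 ℕ) : s(e.out.1, e.out.2) = e := Quot.out_eq e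
  have hadj : ∀ e ∈ G.edgeSet, G.Adj e.out.1 e.out.2 := fun e he => by
    rwa [← SimpleGraph.Subgraph.mem_edgeSet, hout]
  have hmem (e : Sym2 ℕ) {t : unitInterval} (h0 : t ≠ 0) (h1 : t ≠ 1) :
      AffineMap.lineMap (pos e.out.1) (pos e.out.2) (t : ℝ) ∈
        openSegment ℝ (pos e.out.1) (pos e.out.2) :=
    lineMap_mem_openSegment ℝ _ _ ⟨unitInterval.pos_iff_ne_zero.mpr h0,
      unitInterval.lt_one_iff_ne_one.mpr h1⟩
  { pos := pos
    arc := fun e t => AffineMap.lineMap (pos e.out.1) (pos e.out.2) (t : ℝ)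
    pos_injOn := hpos
    arc_continuous := fun _ _ => AffineMap.lineMap_continuous.comp continuous_subtype_val
    arc_injective := fun e he => (AffineMap.lineMap_injective ℝ (hpos.ne (G.edge_vert (hadj e he))
      (G.edge_vert (hadj e he).symm) (G.adj_sub (hadj e he)).ne)).comp Subtype.val_injective
    arc_ends := fun e _ => by
      conv_rhs => rw [← hout e]
      simp
    arc_ne_pos := fun e he _ h0 h1 d hd h => hvert _ _ d (hadj e he) hd (h ▸ hmem e h0 h1)
    arc_ne_arc := fun e he e' he' hee _ _ h0 h1 h0' h1' =>
      (hdisj _ _ _ _ (hadj e he) (hadj e' he') (by rwa [hout, hout])).ne_of_mem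
        (hmem e h0 h1) (hmem e' h0' h1') }

theorem drawing_subset_of_pos_of_segment {pos : ℕ → ℝ × ℝ} {hpos : InjOn pos G.verts} {hvert hdisj}
    {s : Set (ℝ × ℝ)} (hverts : ∀ a ∈ G.verts, pos a ∈ s)
    (hedges : ∀ a b, G.Adj a b → openSegment ℝ (pos a) (pos b) ⊆ s) :
    (ofSegments pos hpos hvert hdisj).drawing ⊆ s := by
  intro x hx
  rcases (mem_drawing_iff _).mp hx with ⟨a, ha, rfl⟩ | ⟨e, he, t, h0, h1, rfl⟩
  · exact hverts a ha
  · refine hedges e.out.1 e.out.2 ?_ (lineMap_mem_openSegment ℝ _ _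
      ⟨unitInterval.pos_iff_ne_zero.mpr h0, unitInterval.lt_one_iff_ne_one.mpr h1⟩)
    have hout : s(e.out.1, e.out.2) = e := Quot.out_eq e
    rwa [← SimpleGraph.Subgraph.mem_edgeSet, hout]

end PlanarEmbedding

/-! ### Families of legs -/

section Legs

variable {ι : Type*} {ℓ : ℕ} {R : Finset ℕ} {J : Finset ι} {node : ι → ℕ → ℕ}

/-- A family of legs: pairwise disjoint paths of length `ℓ`, indexed by `J`, the one with index `j`
starting at the root `node j 0` in `R` and visiting `node j 1, …, node j ℓ` outside `R`. -/
structure IsLegFamily (ℓ : ℕ) (R : Finset ℕ) (J : Finset ι) (node : ι → ℕ → ℕ) : Prop where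
  root_mem : ∀ j ∈ J, node j 0 ∈ R
  notMem_root : ∀ j ∈ J, ∀ k < ℓ, node j (k + 1) ∉ R
  inj : ∀ j ∈ J, ∀ k < ℓ, ∀ j' ∈ J, ∀ k' < ℓ, node j (k + 1) = node j' (k' + 1) → j = j' ∧ k = k'

/-- The oriented edges of a family of legs, pointing away from the roots. -/
def LegEdge (ℓ : ℕ) (J : Finset ι) (node : ι → ℕ → ℕ) (a b : ℕ) : Prop :=
  ∃ j ∈ J, ∃ k < ℓ, a = node j k ∧ b = node j (k + 1)

/-- The union of the legs of a family, roots included. -/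
def legGraph (ℓ : ℕ) (J : Finset ι) (node : ι → ℕ → ℕ) : NatGraph where
  verts := {a | ∃ j ∈ J, ∃ k ≤ ℓ, node j k = a}
  Adj a b := a ≠ b ∧ (LegEdge ℓ J node a b ∨ LegEdge ℓ J node b a)
  adj_sub h := h.1
  edge_vert := by
    rintro a b ⟨-, ⟨j, hj, k, hk, rfl, -⟩ | ⟨j, hj, k, hk, -, rfl⟩⟩
    · exact ⟨j, hj, k, hk.le, rfl⟩
    · exact ⟨j, hj, k + 1, hk, rfl⟩
  symm := ⟨fun _ _ h => ⟨h.1.symm, h.2.symm⟩⟩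

theorem exists_of_legGraph_adj {a b : ℕ} (h : (legGraph ℓ J node).Adj a b) :
    ∃ j ∈ J, ∃ k < ℓ, s(a, b) = s(node j k, node j (k + 1)) := by
  rcases h.2 with ⟨j, hj, k, hk, rfl, rfl⟩ | ⟨j, hj, k, hk, rfl, rfl⟩
  · exact ⟨j, hj, k, hk, rfl⟩
  · exact ⟨j, hj, k, hk, Sym2.eq_swap⟩

theorem legGraph_empty : legGraph ℓ (∅ : Finset ι) node = ⊥ := by
  ext <;> simp [legGraph, LegEdge]

theorem finite_verts_legGraph : (legGraph ℓ J node).verts.Finite :=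
  ((J ×ˢ Finset.Iic ℓ).finite_toSet.image fun x => node x.1 x.2).subset
    fun _ ⟨j, hj, k, hk, h⟩ => ⟨(j, k), by simpa using ⟨hj, hk⟩, h⟩

theorem IsLegFamily.mono {J' : Finset ι} (h : IsLegFamily ℓ R J node) (hJ : J' ⊆ J) :
    IsLegFamily ℓ R J' node where
  root_mem j hj := h.root_mem j (hJ hj)
  notMem_root j hj := h.notMem_root j (hJ hj)
  inj j hj k hk j' hj' := h.inj j (hJ hj) k hk j' (hJ hj')

namespace PlanarEmbedding

open Set Metric

theorem openSegment_add_smul_subset {E : Type*} [AddCommGroup E] [Module ℝ E] (p w : E) {a b : ℝ}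
    (hab : a < b) :
    openSegment ℝ (p + a • w) (p + b • w) ⊆ (fun s : ℝ => p + s • w) '' Ioo a b := by
  have h := image_openSegment ℝ (AffineMap.lineMap p (p + w)) a b
  simp only [openSegment_eq_Ioo hab, AffineMap.lineMap_apply, vsub_eq_sub, vadd_eq_add,
    add_sub_cancel_left, add_comm _ p] at h
  refine h.ge.trans (image_congr fun s _ => ?_).subset
  rw [AffineMap.lineMap_apply, vsub_eq_sub, vadd_eq_add, add_sub_cancel_left, add_comm]

theorem exists_pos_legs {c : ℕ} (h : IsLegFamily ℓ {c} J node) {E : Type*} [AddCommGroup E]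
    [Module ℝ E] (p : E) (w : ι → E) :
    ∃ pos : ℕ → E, ∀ j ∈ J, ∀ k ≤ ℓ, pos (node j k) = p + (k : ℝ) • w j := by
  let f : {x : ι × ℕ // x.1 ∈ J ∧ x.2 ≤ ℓ} → ℕ := fun x => node x.1.1 x.1.2
  let g : {x : ι × ℕ // x.1 ∈ J ∧ x.2 ≤ ℓ} → E := fun x => p + (x.1.2 : ℝ) • w x.1.1
  have hfg : g.FactorsThrough f := by
    rintro ⟨⟨j, k⟩, hj, hk⟩ ⟨⟨j', k'⟩, hj', hk'⟩ (hjk : node j k = node j' k')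
    have hroot := Finset.mem_singleton.mp (h.root_mem j hj)
    have hroot' := Finset.mem_singleton.mp (h.root_mem j' hj')
    rcases k with - | k <;> rcases k' with - | k'
    · simp [g]
    · exact absurd (Finset.mem_singleton.mpr (hjk.symm.trans hroot)) (h.notMem_root j' hj' k' hk')
    · exact absurd (Finset.mem_singleton.mpr (hjk.trans hroot')) (h.notMem_root j hj k hk)
    · obtain ⟨rfl, rfl⟩ := h.inj j hj k hk j' hj' k' hk' hjk
      rfl
  exact ⟨Function.extend f g 0, fun j hj k hk => hfg.extend_apply 0 ⟨(j, k), hj, hk⟩⟩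

section Rays

variable {c : ℕ} (h : IsLegFamily ℓ {c} J node) {E : Type*} [AddCommGroup E] [Module ℝ E]
  {p : E} {w : ι → E} {pos : ℕ → E} (hpos : ∀ j ∈ J, ∀ k ≤ ℓ, pos (node j k) = p + (k : ℝ) • w j)
  (hw : ∀ j ∈ J, ∀ j' ∈ J, ∀ s s' : ℝ, 0 < s → s • w j = s' • w j' → j = j' ∧ s = s')

include h hpos hw in
theorem injOn_verts_of_rays : InjOn pos (legGraph ℓ J node).verts := by
  rintro _ ⟨j, hj, k, hk, rfl⟩ _ ⟨j', hj', k', hk', rfl⟩ hjk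
  rw [hpos j hj k hk, hpos j' hj' k' hk', add_right_inj] at hjk
  rcases k.eq_zero_or_pos with rfl | h0
  · rcases k'.eq_zero_or_pos with rfl | h0'
    · exact (Finset.mem_singleton.mp (h.root_mem j hj)).trans
        (Finset.mem_singleton.mp (h.root_mem j' hj')).symm
    · exact absurd (hw j' hj' j hj _ _ (Nat.cast_pos.mpr h0') hjk.symm).2 (by simpa using h0'.ne')
  · obtain ⟨rfl, hkk⟩ := hw j hj j' hj' _ _ (Nat.cast_pos.mpr h0) hjk
    rw [Nat.cast_injective hkk]

include hpos in
theorem exists_openSegment_subset_ray {a b : ℕ} (hab : (legGraph ℓ J node).Adj a b) :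
    ∃ j ∈ J, ∃ k < ℓ, s(a, b) = s(node j k, node j (k + 1)) ∧
      openSegment ℝ (pos a) (pos b) ⊆ (fun s : ℝ => p + s • w j) '' Ioo (k : ℝ) (k + 1) := by
  obtain ⟨j, hj, k, hk, hjk⟩ := exists_of_legGraph_adj hab
  have hseg := openSegment_add_smul_subset p (w j) (lt_add_one (k : ℝ))
  rw [← hpos j hj k hk.le, ← Nat.cast_succ, ← hpos j hj (k + 1) hk, Nat.cast_succ] at hseg
  refine ⟨j, hj, k, hk, hjk, ?_⟩
  rcases Sym2.eq_iff.mp hjk with ⟨rfl, rfl⟩ | ⟨rfl, rfl⟩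
  · exact hseg
  · rwa [openSegment_symm]

end Rays

theorem exists_legs_along_rays {c : ℕ} (h : IsLegFamily ℓ {c} J node) (p : ℝ × ℝ)
    {w : ι → ℝ × ℝ} (hw : ∀ j ∈ J, ∀ j' ∈ J, ∀ s s' : ℝ, 0 < s → s • w j = s' • w j' →
      j = j' ∧ s = s') :
    ∃ F : PlanarEmbedding (legGraph ℓ J node), (∀ j ∈ J, F.pos (node j 0) = p) ∧
      F.drawing ⊆ insert p {x | ∃ j ∈ J, ∃ s : ℝ, 0 < s ∧ s ≤ ℓ ∧ p + s • w j = x} := by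
  obtain ⟨pos, hpos⟩ := exists_pos_legs h p w
  have hseg {a b} (hab) := exists_openSegment_subset_ray hpos (a := a) (b := b) hab
  refine ⟨ofSegments pos (injOn_verts_of_rays h hpos hw) ?_ ?_, fun j hj => ?_,
    drawing_subset_of_pos_of_segment ?_ fun a b hab => ?_⟩
  · rintro a b _ hab ⟨j', hj', k', hk', rfl⟩ hmem
    obtain ⟨j, hj, k, -, -, hsub⟩ := hseg hab
    obtain ⟨s, ⟨hks, hsk⟩, hs⟩ := hsub hmem
    rw [hpos j' hj' k' hk', add_right_inj] at hs
    obtain ⟨-, rfl⟩ := hw j hj j' hj' s k' (k.cast_nonneg.trans_lt hks) hs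
    norm_cast at hks hsk
    omega
  · refine fun a b a' b' hab hab' hne => disjoint_left.mpr fun x hx hx' => hne ?_
    obtain ⟨j, hj, k, -, heq, hsub⟩ := hseg hab
    obtain ⟨j', hj', k', -, heq', hsub'⟩ := hseg hab'
    obtain ⟨s, ⟨hks, hsk⟩, rfl⟩ := hsub hx
    obtain ⟨s', ⟨hks', hsk'⟩, hs⟩ := hsub' hx'
    obtain ⟨rfl, rfl⟩ := hw j hj j' hj' s s' (k.cast_nonneg.trans_lt hks) (add_left_cancel hs).symm
    have hkk : k < k' + 1 := by exact_mod_cast hks.trans hsk'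
    have hkk' : k' < k + 1 := by exact_mod_cast hks'.trans hsk
    rw [heq, heq', le_antisymm (Nat.le_of_lt_succ hkk) (Nat.le_of_lt_succ hkk')]
  · exact (hpos j hj 0 ℓ.zero_le).trans (by simp)
  · rintro _ ⟨j, hj, k, hk, rfl⟩
    rw [hpos j hj k hk]
    rcases k.eq_zero_or_pos with rfl | h0
    · exact Or.inl (by simp)
    · exact Or.inr ⟨j, hj, k, Nat.cast_pos.mpr h0, Nat.cast_le.mpr hk, rfl⟩
  · obtain ⟨j, hj, k, hk, -, hsub⟩ := hseg hab
    refine (hsub.trans ?_).trans (subset_insert _ _)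
    rintro _ ⟨s, ⟨hks, hsk⟩, rfl⟩
    exact ⟨j, hj, s, k.cast_nonneg.trans_lt hks, hsk.le.trans (mod_cast hk), rfl⟩

theorem exists_legs_in_ball {c : ℕ} (h : IsLegFamily ℓ {c} J node) (hℓ : 0 < ℓ) {p y : ℝ × ℝ}
    (hpy : p ≠ y) :
    ∃ F : PlanarEmbedding (legGraph ℓ J node), (∀ j ∈ J, F.pos (node j 0) = p) ∧
      F.drawing ⊆ insert p (ball y (dist y p)) := by
  obtain ⟨w, hwball, hw⟩ := exists_rays_into_ball one_lt_rank_plane hpy (Nat.cast_pos.mpr hℓ)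
  obtain ⟨F, hF, hFdraw⟩ := exists_legs_along_rays h p (w := fun j => w (node j 1))
    fun j hj j' hj' s s' h0 hs => by
      obtain ⟨hjj, rfl⟩ := hw _ _ s s' h0 hs
      exact ⟨(h.inj j hj 0 hℓ j' hj' 0 hℓ hjj).1, rfl⟩
  refine ⟨F, hF, hFdraw.trans (insert_subset_insert ?_)⟩
  rintro _ ⟨j, -, s, h0, hs, rfl⟩
  exact hwball _ s h0 hs

end PlanarEmbedding

theorem IsPlanar.sup_legGraph {K : NatGraph} (hK : IsPlanar K) (hfin : K.verts.Finite)
    {c v u : ℕ} (hvu : v ≠ u) (hc : K.neighborSet c = {v, u}) (hℓ : 0 < ℓ)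
    (h : IsLegFamily ℓ {c} J node) (hnew : ∀ j ∈ J, ∀ k < ℓ, node j (k + 1) ∉ K.verts) :
    IsPlanar (K ⊔ legGraph ℓ J node) := by
  rcases J.eq_empty_or_nonempty with rfl | ⟨j, hj⟩
  · rwa [legGraph_empty, sup_bot_eq]
  obtain ⟨E⟩ := hK
  obtain ⟨E', y, hy, hdisj⟩ := E.exists_disjoint_ball hfin hvu hc
  obtain ⟨F, hF, hFdraw⟩ := PlanarEmbedding.exists_legs_in_ball h hℓ hy
  have hcK : c ∈ K.verts := K.edge_vert (show v ∈ K.neighborSet c from hc ▸ Or.inl rfl)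
  have hroot (i) (hi : i ∈ J) : node i 0 = c := Finset.mem_singleton.mp (h.root_mem i hi)
  have hglue : PlanarEmbedding.Glueable E' F :=
    { pos_eq := by
        rintro _ haK ⟨i, hi, k, hk, rfl⟩
        cases k with
        | zero => rw [hF i hi, hroot i hi]
        | succ k => exact absurd haK (hnew i hi k hk)
      drawing_inter_subset := by
        rintro x ⟨hxE, hxF⟩
        obtain rfl := (hFdraw hxF).resolve_right fun hx => hdisj.ne_of_mem hx hxE rfl
        exact ⟨c, ⟨hcK, j, hj, 0, ℓ.zero_le, hroot j hj⟩, rfl⟩ }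
  exact ⟨hglue.glue⟩

end Legs

/-! ### Minimum dominating sets of a graph with a gadget -/

section Counting

open Set

/-- A set of vertices of `H` that dominates all vertices of `H` outside `X`. -/
def DominatesOff (H : NatGraph) (X : Set ℕ) (D : Finset ℕ) : Prop :=
  (D : Set ℕ) ⊆ H.verts ∧ ∀ a ∈ H.verts, a ∉ X → a ∈ D ∨ ∃ d ∈ D, H.Adj d a

/-- The dominating sets of `H` that contain `v` or `u`. -/
def touchingDS (H : NatGraph) (v u : ℕ) : Set (Finset ℕ) :=
  {D | (v ∈ D ∨ u ∈ D) ∧ IsDominatingSet H D}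

/-- The least size of a dominating set of `H` that contains `v` or `u`. -/
noncomputable def touchingNumber (H : NatGraph) (v u : ℕ) : ℕ :=
  sInf (Finset.card '' touchingDS H v u)

/-- The minimum dominating sets of `H` among those containing `v` or `u`. -/
def minTouchingDS (H : NatGraph) (v u : ℕ) : Set (Finset ℕ) :=
  {D | D ∈ touchingDS H v u ∧ D.card = touchingNumber H v u}

/-- The sets containing `v` or `u` that dominate all of `H` but possibly the other one of the two,
with one vertex less than a dominating set containing `v` or `u` needs. -/
def savingSets (H : NatGraph) (v u : ℕ) : Set (Finset ℕ) :=
  {D | (v ∈ D ∨ u ∈ D) ∧ DominatesOff H {v, u} D ∧ D.card + 1 = touchingNumber H v u}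

section

variable {H : NatGraph} {X : Set ℕ} {v u : ℕ} {D : Finset ℕ}

theorem isDominatingSet_iff : IsDominatingSet H D ↔ DominatesOff H ∅ D := by
  refine and_congr_right fun hD => ⟨fun h a ha _ => ?_, fun h => ?_⟩
  · rwa [← h] at ha
  · refine Subset.antisymm ?_ fun a ha => h a ha (notMem_empty a)
    rintro a (ha | ⟨d, -, hda⟩)
    · exact hD ha
    · exact H.edge_vert hda.symm

theorem DominatesOff.insert_of_mem {a : ℕ} (h : DominatesOff H (insert a X) D) (ha : a ∈ H.verts) :
    DominatesOff H X (insert a D) := by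
  refine ⟨by simpa using insert_subset ha h.1, fun b hb hbX => ?_⟩
  rcases eq_or_ne b a with rfl | hba
  · exact Or.inl (Finset.mem_insert_self b D)
  · refine (h.2 b hb (by simp [hba, hbX])).imp Finset.mem_insert_of_mem ?_
    exact fun ⟨d, hd, hdb⟩ => ⟨d, Finset.mem_insert_of_mem hd, hdb⟩

theorem DominatesOff.isDominatingSet_insert {a : ℕ} (h : DominatesOff H {a} D) (ha : a ∈ H.verts) :
    IsDominatingSet H (insert a D) := by
  rw [← insert_empty_eq a] at h
  exact isDominatingSet_iff.mpr (h.insert_of_mem ha)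

theorem touchingNumber_le (h : D ∈ touchingDS H v u) : touchingNumber H v u ≤ D.card :=
  Nat.sInf_le ⟨D, h, rfl⟩

theorem touchingNumber_le_card_add_two (h : DominatesOff H {v, u} D) (hv : v ∈ H.verts)
    (hu : u ∈ H.verts) : touchingNumber H v u ≤ D.card + 2 := by
  have hmem : insert u (insert v D) ∈ touchingDS H v u :=
    ⟨Or.inr (Finset.mem_insert_self _ _), (h.insert_of_mem hv).isDominatingSet_insert hu⟩
  have hcard := Finset.card_insert_le u (insert v D)
  have hcard' := Finset.card_insert_le v D
  exact (touchingNumber_le hmem).trans (by omega)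

theorem touchingNumber_le_card_add_one (h : DominatesOff H {v, u} D) (hv : v ∈ H.verts)
    (hu : u ∈ H.verts) (hvu : v ∈ D ∨ u ∈ D) : touchingNumber H v u ≤ D.card + 1 := by
  rcases hvu with hvD | huD
  · have hoff := h.insert_of_mem hv
    rw [Finset.insert_eq_of_mem hvD] at hoff
    exact (touchingNumber_le ⟨Or.inl (Finset.mem_insert_of_mem hvD),
      hoff.isDominatingSet_insert hu⟩).trans (Finset.card_insert_le u D)
  · have hoff := (pair_comm v u ▸ h).insert_of_mem hu
    rw [Finset.insert_eq_of_mem huD] at hoff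
    exact (touchingNumber_le ⟨Or.inr (Finset.mem_insert_of_mem huD),
      hoff.isDominatingSet_insert hv⟩).trans (Finset.card_insert_le v D)

theorem minTouchingDS_nonempty (hfin : H.verts.Finite) (hv : v ∈ H.verts) :
    (minTouchingDS H v u).Nonempty := by
  have hverts : hfin.toFinset ∈ touchingDS H v u :=
    ⟨Or.inl (by simpa using hv), isDominatingSet_iff.mpr
      ⟨by simp, fun a ha _ => Or.inl (by simpa using ha)⟩⟩
  obtain ⟨D, hD, hcard⟩ := Nat.sInf_mem (Set.Nonempty.image Finset.card ⟨_, hverts⟩)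
  exact ⟨D, hD, hcard⟩

theorem disjoint_minTouchingDS_savingSets : Disjoint (minTouchingDS H v u) (savingSets H v u) :=
  Set.disjoint_left.mpr fun D hmin hsav => by
    have := hmin.2
    have := hsav.2.2
    omega

theorem finite_of_forall_subset_verts (hfin : H.verts.Finite) {𝒟 : Set (Finset ℕ)}
    (h : ∀ D ∈ 𝒟, (D : Set ℕ) ⊆ H.verts) : 𝒟.Finite :=
  hfin.toFinset.powerset.finite_toSet.subset fun D hD =>
    Finset.mem_powerset.mpr fun _ ha => hfin.mem_toFinset.mpr (h D hD ha)

end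

section Gadget

variable {G : NatGraph} {C : Finset ℕ} {v u : ℕ} {R : Finset ℕ} {ι : Type*} {J : Finset ι}
  {node : ι → ℕ → ℕ}

/-- The vertices of a gadget with roots `R` and legs of length three indexed by `J`. -/
def gadgetVerts (R : Finset ℕ) (J : Finset ι) (node : ι → ℕ → ℕ) : Finset ℕ :=
  R ∪ (J ×ˢ Finset.range 3).image fun x => node x.1 (x.2 + 1)

/-- A gadget between `v` and `u`: its roots are adjacent to `v` and `u`, and legs of length three
hang from some of the roots. A wide diamond is a gadget without legs. -/
structure IsGadget (G : NatGraph) (C : Finset ℕ) (v u : ℕ) (R : Finset ℕ) (J : Finset ι)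
    (node : ι → ℕ → ℕ) : Prop extends IsLegFamily 3 R J node where
  ne : v ≠ u
  v_mem : v ∈ G.verts
  v_notMem : v ∉ C
  u_mem : u ∈ G.verts
  u_notMem : u ∉ C
  subset : (C : Set ℕ) ⊆ G.verts
  eq_gadgetVerts : C = gadgetVerts R J node
  adj_root : ∀ c ∈ R, ∀ a, G.Adj c a ↔ a = v ∨ a = u ∨ ∃ j ∈ J, node j 0 = c ∧ a = node j 1
  adj_one : ∀ j ∈ J, ∀ a, G.Adj (node j 1) a ↔ a = node j 0 ∨ a = node j 2
  adj_two : ∀ j ∈ J, ∀ a, G.Adj (node j 2) a ↔ a = node j 1 ∨ a = node j 3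
  adj_three : ∀ j ∈ J, ∀ a, G.Adj (node j 3) a ↔ a = node j 2

theorem mem_gadgetVerts {a : ℕ} :
    a ∈ gadgetVerts R J node ↔ a ∈ R ∨ ∃ j ∈ J, ∃ k < 3, node j (k + 1) = a := by
  simp [gadgetVerts, and_assoc]

theorem mem_verts_deleteVerts_coe {a : ℕ} :
    a ∈ (G.deleteVerts (C : Set ℕ)).verts ↔ a ∈ G.verts ∧ a ∉ C := by
  simp

theorem adj_deleteVerts_coe {a b : ℕ} :
    (G.deleteVerts (C : Set ℕ)).Adj a b ↔ G.Adj a b ∧ a ∉ C ∧ b ∉ C := by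
  rw [SimpleGraph.Subgraph.deleteVerts_adj]
  exact ⟨fun ⟨_, ha, _, hb, h⟩ => ⟨h, ha, hb⟩, fun ⟨h, ha, hb⟩ =>
    ⟨G.edge_vert h, ha, G.edge_vert h.symm, hb, h⟩⟩

theorem IsWideDiamond.exists_isGadget (h : IsWideDiamond G C) :
    ∃ v u, IsGadget G C v u C (∅ : Finset Empty) fun _ _ => 0 := by
  obtain ⟨hC, v, u, hv, hu, hne, hN⟩ := h
  refine ⟨v, u, ⟨by simp, by simp, by simp⟩, hne, hv.1, hv.2, hu.1, hu.2, hC, by simp [gadgetVerts],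
    fun c hc a => ?_, by simp, by simp, by simp⟩
  simpa using Set.ext_iff.mp (hN c hc) a

/-- The number of vertices of the leg `j` that belong to `D`. -/
def legCount (node : ι → ℕ → ℕ) (D : Finset ℕ) (j : ι) : ℕ :=
  ((Finset.range 3).filter fun k => node j (k + 1) ∈ D).card

theorem legCount_eq (D : Finset ℕ) (j : ι) : legCount node D j =
    (if node j 1 ∈ D then 1 else 0) + (if node j 2 ∈ D then 1 else 0) +
      (if node j 3 ∈ D then 1 else 0) := by
  rw [legCount, Finset.card_filter, Finset.sum_range_succ, Finset.sum_range_succ,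
    Finset.sum_range_one]

/-- The second vertices of all legs, except that the third one is taken from the legs in `T`. -/
def legSet [DecidableEq ι] (J : Finset ι) (node : ι → ℕ → ℕ) (T : Finset ι) : Finset ℕ :=
  J.image fun j => if j ∈ T then node j 3 else node j 2

theorem mem_legSet [DecidableEq ι] {T : Finset ι} {a : ℕ} : a ∈ legSet J node T ↔
    ∃ j ∈ J, (j ∈ T ∧ a = node j 3) ∨ (j ∉ T ∧ a = node j 2) := by
  rw [legSet, Finset.mem_image]
  refine exists_congr fun j => and_congr_right fun _ => ?_
  split_ifs with hT <;> simp [hT, eq_comm]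

namespace IsGadget

variable {D : Finset ℕ}

theorem root_mem_gadget (h : IsGadget G C v u R J node) {c : ℕ} (hc : c ∈ R) : c ∈ C :=
  h.eq_gadgetVerts ▸ mem_gadgetVerts.mpr (Or.inl hc)

theorem leg_mem_gadget (h : IsGadget G C v u R J node) {j : ι} (hj : j ∈ J) {k : ℕ} (hk : k < 3) :
    node j (k + 1) ∈ C :=
  h.eq_gadgetVerts ▸ mem_gadgetVerts.mpr (Or.inr ⟨j, hj, k, hk, rfl⟩)

theorem mem_iff (h : IsGadget G C v u R J node) {a : ℕ} :
    a ∈ C ↔ a ∈ R ∨ ∃ j ∈ J, a = node j 1 ∨ a = node j 2 ∨ a = node j 3 := by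
  rw [h.eq_gadgetVerts, mem_gadgetVerts]
  refine or_congr_right (exists_congr fun j => and_congr_right fun _ => ⟨?_, ?_⟩)
  · rintro ⟨k, hk, rfl⟩
    interval_cases k <;> simp
  · rintro (rfl | rfl | rfl)
    exacts [⟨0, by simp⟩, ⟨1, by simp⟩, ⟨2, by simp⟩]

theorem adj_outside (h : IsGadget G C v u R J node) {a d : ℕ} (ha : a ∈ C) (hd : d ∉ C)
    (had : G.Adj a d) : a ∈ R ∧ (d = v ∨ d = u) := by
  rcases h.mem_iff.mp ha with haR | ⟨j, hj, hja⟩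
  · refine ⟨haR, ?_⟩
    rcases (h.adj_root a haR d).mp had with hdv | hdu | ⟨j, hj, -, rfl⟩
    · exact Or.inl hdv
    · exact Or.inr hdu
    · exact absurd (h.leg_mem_gadget hj (k := 0) three_pos) hd
  · refine absurd ?_ hd
    rcases hja with rfl | rfl | rfl
    · rcases (h.adj_one j hj d).mp had with rfl | rfl
      · exact h.root_mem_gadget (h.root_mem j hj)
      · exact h.leg_mem_gadget hj (k := 1) (by norm_num)
    · rcases (h.adj_two j hj d).mp had with rfl | rfl
      · exact h.leg_mem_gadget hj (k := 0) (by norm_num)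
      · exact h.leg_mem_gadget hj (k := 2) (by norm_num)
    · obtain rfl := (h.adj_three j hj d).mp had
      exact h.leg_mem_gadget hj (k := 1) (by norm_num)

theorem openNbhd_eq (h : IsGadget G C v u R J node) (hR : R.Nonempty) :
    openNbhd G (C : Set ℕ) = {v, u} := by
  ext d
  constructor
  · rintro ⟨⟨a, ha, had⟩, hd⟩
    exact (h.adj_outside ha hd had).2
  · obtain ⟨c, hc⟩ := hR
    rintro (rfl | rfl)
    · exact ⟨⟨c, h.root_mem_gadget hc, (h.adj_root c hc _).mpr (Or.inl rfl)⟩, h.v_notMem⟩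
    · exact ⟨⟨c, h.root_mem_gadget hc, (h.adj_root c hc _).mpr (Or.inr (Or.inl rfl))⟩, h.u_notMem⟩

theorem v_mem_deleteVerts (h : IsGadget G C v u R J node) :
    v ∈ (G.deleteVerts (C : Set ℕ)).verts :=
  mem_verts_deleteVerts_coe.mpr ⟨h.v_mem, h.v_notMem⟩

theorem u_mem_deleteVerts (h : IsGadget G C v u R J node) :
    u ∈ (G.deleteVerts (C : Set ℕ)).verts :=
  mem_verts_deleteVerts_coe.mpr ⟨h.u_mem, h.u_notMem⟩

theorem card_eq (h : IsGadget G C v u R J node) (D : Finset ℕ) :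
    D.card = (D \ C).card + ((R.filter (· ∈ D)).card + ∑ j ∈ J, legCount node D j) := by
  have hdisj : Disjoint (R.filter (· ∈ D))
      (((J ×ˢ Finset.range 3).image fun x => node x.1 (x.2 + 1)).filter (· ∈ D)) := by
    refine Finset.disjoint_filter_filter (Finset.disjoint_right.mpr fun a ha => ?_)
    obtain ⟨⟨j, k⟩, hjk, rfl⟩ := Finset.mem_image.mp ha
    rw [Finset.mem_product, Finset.mem_range] at hjk
    exact h.notMem_root j hjk.1 k hjk.2
  have hinj : Set.InjOn (fun x : ι × ℕ => node x.1 (x.2 + 1))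
      ((J ×ˢ Finset.range 3).filter fun x => node x.1 (x.2 + 1) ∈ D) := by
    rintro ⟨j, k⟩ hjk ⟨j', k'⟩ hjk' heq
    simp only [Finset.coe_filter, Finset.mem_product, Finset.mem_range, mem_ofPred_eq] at hjk hjk'
    obtain ⟨rfl, rfl⟩ := h.inj j hjk.1.1 k hjk.1.2 j' hjk'.1.1 k' hjk'.1.2 heq
    rfl
  rw [← Finset.card_sdiff_add_card_inter D C, Finset.inter_comm, ← Finset.filter_mem_eq_inter,
    h.eq_gadgetVerts, gadgetVerts, Finset.filter_union, Finset.card_union_of_disjoint hdisj,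
    Finset.filter_image, Finset.card_image_of_injOn hinj]
  simp only [Finset.card_filter, Finset.sum_product, legCount]

end IsGadget

end Gadget

variable {G : NatGraph} {C : Finset ℕ} {v u : ℕ} {R : Finset ℕ} {ι : Type*} {J : Finset ι}
  {node : ι → ℕ → ℕ} {D D₀ S : Finset ℕ}

namespace IsGadget

section LegSet

variable [DecidableEq ι] {T : Finset ι}

theorem legSet_subset (h : IsGadget G C v u R J node) : legSet J node T ⊆ C := fun a ha => by
  obtain ⟨j, hj, ⟨-, rfl⟩ | ⟨-, rfl⟩⟩ := mem_legSet.mp ha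
  · exact h.leg_mem_gadget hj (k := 2) (by norm_num)
  · exact h.leg_mem_gadget hj (k := 1) (by norm_num)

theorem card_legSet (h : IsGadget G C v u R J node) : (legSet J node T).card = J.card := by
  refine Finset.card_image_of_injOn fun j hj j' hj' hjj => ?_
  split_ifs at hjj
  · exact (h.inj j hj 2 (by norm_num) j' hj' 2 (by norm_num) hjj).1
  · exact (h.inj j hj 2 (by norm_num) j' hj' 1 (by norm_num) hjj).1
  · exact (h.inj j hj 1 (by norm_num) j' hj' 2 (by norm_num) hjj).1
  · exact (h.inj j hj 1 (by norm_num) j' hj' 1 (by norm_num) hjj).1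

theorem root_notMem_legSet (h : IsGadget G C v u R J node) {c : ℕ} (hc : c ∈ R) :
    c ∉ legSet J node T := fun hcm => by
  obtain ⟨j, hj, ⟨-, rfl⟩ | ⟨-, rfl⟩⟩ := mem_legSet.mp hcm
  · exact h.notMem_root j hj 2 (by norm_num) hc
  · exact h.notMem_root j hj 1 (by norm_num) hc

theorem node_three_mem_legSet (h : IsGadget G C v u R J node) {j : ι} (hj : j ∈ J) :
    node j 3 ∈ legSet J node T ↔ j ∈ T := by
  rw [mem_legSet]
  refine ⟨?_, fun hT => ⟨j, hj, Or.inl ⟨hT, rfl⟩⟩⟩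
  rintro ⟨j', hj', ⟨hT, heq⟩ | ⟨-, heq⟩⟩
  · rwa [(h.inj j hj 2 (by norm_num) j' hj' 2 (by norm_num) heq).1]
  · exact absurd (h.inj j hj 2 (by norm_num) j' hj' 1 (by norm_num) heq).2 (by norm_num)

theorem legSet_subset_cancel (h : IsGadget G C v u R J node) {c : ℕ} (hc : c ∈ R) {T' : Finset ι}
    (hT : T ⊆ J) (hsub : insert c (legSet J node T) ⊆ insert c (legSet J node T')) : T ⊆ T' :=
  fun j hj => by
    have hmem := hsub (Finset.mem_insert_of_mem ((h.node_three_mem_legSet (hT hj)).mpr hj))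
    refine (h.node_three_mem_legSet (hT hj)).mp ((Finset.mem_insert.mp hmem).resolve_left ?_)
    exact fun heq => h.notMem_root j (hT hj) 2 (by norm_num) (heq ▸ hc)

theorem leg_dominated (h : IsGadget G C v u R J node) (hTS : legSet J node T ⊆ S)
    (hroot : ∀ j ∈ T, node j 0 ∈ S) {j : ι} (hj : j ∈ J) {a : ℕ}
    (ha : a = node j 1 ∨ a = node j 2 ∨ a = node j 3) : a ∈ S ∨ ∃ d ∈ S, G.Adj d a := by
  by_cases hjT : j ∈ T
  · have h3 : node j 3 ∈ S := hTS (mem_legSet.mpr ⟨j, hj, Or.inl ⟨hjT, rfl⟩⟩)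
    rcases ha with rfl | rfl | rfl
    · exact Or.inr ⟨node j 0, hroot j hjT, ((h.adj_one j hj _).mpr (Or.inl rfl)).symm⟩
    · exact Or.inr ⟨node j 3, h3, (h.adj_three j hj _).mpr rfl⟩
    · exact Or.inl h3
  · have h2 : node j 2 ∈ S := hTS (mem_legSet.mpr ⟨j, hj, Or.inr ⟨hjT, rfl⟩⟩)
    rcases ha with rfl | rfl | rfl
    · exact Or.inr ⟨node j 2, h2, (h.adj_two j hj _).mpr (Or.inl rfl)⟩
    · exact Or.inl h2
    · exact Or.inr ⟨node j 2, h2, (h.adj_two j hj _).mpr (Or.inr rfl)⟩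

theorem isDominatingSet_union (h : IsGadget G C v u R J node) (hvu : v ∈ D₀ ∨ u ∈ D₀) {X : Set ℕ}
    (hoff : DominatesOff (G.deleteVerts (C : Set ℕ)) X D₀) (hSC : S ⊆ C)
    (hTS : legSet J node T ⊆ S) (hroot : ∀ j ∈ T, node j 0 ∈ S)
    (hX : ∀ a ∈ X, ∃ d ∈ S, G.Adj d a) : IsDominatingSet G (D₀ ∪ S) := by
  refine isDominatingSet_iff.mpr ⟨?_, fun a ha _ => ?_⟩
  · rw [Finset.coe_union]
    exact union_subset (fun a ha => (mem_verts_deleteVerts_coe.mp (hoff.1 ha)).1)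
      fun a ha => h.subset (hSC ha)
  suffices h' : (a ∈ D₀ ∨ ∃ d ∈ D₀, G.Adj d a) ∨ (a ∈ S ∨ ∃ d ∈ S, G.Adj d a) by
    simpa only [Finset.mem_union, or_and_right, exists_or, or_or_or_comm] using h'
  by_cases haC : a ∈ C
  · rcases h.mem_iff.mp haC with haR | ⟨j, hj, hja⟩
    · refine Or.inl (Or.inr ?_)
      rcases hvu with hv | hu
      · exact ⟨v, hv, ((h.adj_root a haR v).mpr (Or.inl rfl)).symm⟩
      · exact ⟨u, hu, ((h.adj_root a haR u).mpr (Or.inr (Or.inl rfl))).symm⟩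
    · exact Or.inr (h.leg_dominated hTS hroot hj hja)
  · by_cases haX : a ∈ X
    · exact Or.inr (Or.inr (hX a haX))
    · exact Or.inl ((hoff.2 a (mem_verts_deleteVerts_coe.mpr ⟨ha, haC⟩) haX).imp_right
        fun ⟨d, hd, hda⟩ => ⟨d, hd, (adj_deleteVerts_coe.mp hda).1⟩)

end LegSet

section Necessity

theorem touching_sdiff (h : IsGadget G C v u R J node) (hvu : v ∈ D ∨ u ∈ D) :
    v ∈ D \ C ∨ u ∈ D \ C :=
  hvu.imp (fun hv => Finset.mem_sdiff.mpr ⟨hv, h.v_notMem⟩)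
    fun hu => Finset.mem_sdiff.mpr ⟨hu, h.u_notMem⟩

variable (h : IsGadget G C v u R J node) (hD : IsDominatingSet G D)

include h hD

theorem two_or_three_mem {j : ι} (hj : j ∈ J) : node j 2 ∈ D ∨ node j 3 ∈ D := by
  have h3C := h.subset (h.leg_mem_gadget hj (k := 2) (by norm_num))
  rcases (isDominatingSet_iff.mp hD).2 _ h3C (notMem_empty _) with h3 | ⟨d, hd, hda⟩
  · exact Or.inr h3
  · obtain rfl := (h.adj_three j hj d).mp hda.symm
    exact Or.inl hd

theorem zero_or_one_or_two_mem {j : ι} (hj : j ∈ J) :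
    node j 0 ∈ D ∨ node j 1 ∈ D ∨ node j 2 ∈ D := by
  have h1C := h.subset (h.leg_mem_gadget hj (k := 0) (by norm_num))
  rcases (isDominatingSet_iff.mp hD).2 _ h1C (notMem_empty _) with h1 | ⟨d, hd, hda⟩
  · exact Or.inr (Or.inl h1)
  · rcases (h.adj_one j hj d).mp hda.symm with rfl | rfl
    · exact Or.inl hd
    · exact Or.inr (Or.inr hd)

theorem one_le_legCount {j : ι} (hj : j ∈ J) : 1 ≤ legCount node D j := by
  have := h.two_or_three_mem hD hj
  rw [legCount_eq]
  split_ifs <;> first | omega | tauto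

theorem mem_leg_of_legCount_eq_one {j : ι} (hj : j ∈ J) (hone : legCount node D j = 1) :
    node j 1 ∉ D ∧ (node j 2 ∈ D ↔ node j 3 ∉ D) ∧ (node j 3 ∈ D → node j 0 ∈ D) := by
  have h23 := h.two_or_three_mem hD hj
  have h012 := h.zero_or_one_or_two_mem hD hj
  rw [legCount_eq] at hone
  split_ifs at hone <;> first | omega | tauto

theorem card_le_sum_legCount : J.card ≤ ∑ j ∈ J, legCount node D j := by
  rw [Finset.card_eq_sum_ones]
  exact Finset.sum_le_sum fun j hj => h.one_le_legCount hD hj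

theorem legCount_eq_one (hsum : ∑ j ∈ J, legCount node D j = J.card) {j : ι} (hj : j ∈ J) :
    legCount node D j = 1 := by
  rw [Finset.card_eq_sum_ones] at hsum
  exact ((Finset.sum_eq_sum_iff_of_le fun i hi => h.one_le_legCount hD hi).mp hsum.symm j hj).symm

theorem inter_eq [DecidableEq ι] (hsum : ∑ j ∈ J, legCount node D j = J.card) :
    D ∩ C = R.filter (· ∈ D) ∪ legSet J node (J.filter fun j => node j 3 ∈ D) := by
  have hleg (j) (hj : j ∈ J) := h.mem_leg_of_legCount_eq_one hD hj (h.legCount_eq_one hD hsum hj)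
  ext a
  rw [Finset.mem_inter, h.mem_iff, Finset.mem_union, mem_legSet, Finset.mem_filter]
  constructor
  · rintro ⟨haD, haR | ⟨j, hj, rfl | rfl | rfl⟩⟩
    · exact Or.inl ⟨haR, haD⟩
    · exact absurd haD (hleg j hj).1
    · exact Or.inr ⟨j, hj, Or.inr ⟨by simp [(hleg j hj).2.1.mp haD], rfl⟩⟩
    · exact Or.inr ⟨j, hj, Or.inl ⟨by simp [hj, haD], rfl⟩⟩
  · rintro (⟨haR, haD⟩ | ⟨j, hj, ⟨hT, rfl⟩ | ⟨hT, rfl⟩⟩)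
    · exact ⟨haD, Or.inl haR⟩
    · exact ⟨(Finset.mem_filter.mp hT).2, Or.inr ⟨j, hj, by simp⟩⟩
    · exact ⟨(hleg j hj).2.1.mpr fun h3 => hT (Finset.mem_filter.mpr ⟨hj, h3⟩),
        Or.inr ⟨j, hj, by simp⟩⟩

theorem dominatesOff_sdiff : DominatesOff (G.deleteVerts (C : Set ℕ)) {v, u} (D \ C) := by
  refine ⟨fun a ha => ?_, fun a ha hna => ?_⟩
  · obtain ⟨haD, haC⟩ := Finset.mem_sdiff.mp ha
    exact mem_verts_deleteVerts_coe.mpr ⟨hD.1 haD, haC⟩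
  obtain ⟨haG, haC⟩ := mem_verts_deleteVerts_coe.mp ha
  rcases (isDominatingSet_iff.mp hD).2 a haG (notMem_empty a) with haD | ⟨d, hd, hda⟩
  · exact Or.inl (Finset.mem_sdiff.mpr ⟨haD, haC⟩)
  · have hdC : d ∉ C := fun hdC => hna (h.adj_outside hdC haC hda).2
    exact Or.inr ⟨d, Finset.mem_sdiff.mpr ⟨hd, hdC⟩, adj_deleteVerts_coe.mpr ⟨hda, hdC, haC⟩⟩

theorem isDominatingSet_sdiff (hR : R.filter (· ∈ D) = ∅) :
    IsDominatingSet (G.deleteVerts (C : Set ℕ)) (D \ C) := by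
  refine isDominatingSet_iff.mpr ⟨(h.dominatesOff_sdiff hD).1, fun a ha _ => ?_⟩
  obtain ⟨haG, haC⟩ := mem_verts_deleteVerts_coe.mp ha
  rcases (isDominatingSet_iff.mp hD).2 a haG (notMem_empty a) with haD | ⟨d, hd, hda⟩
  · exact Or.inl (Finset.mem_sdiff.mpr ⟨haD, haC⟩)
  · have hdC : d ∉ C := fun hdC =>
      Finset.filter_eq_empty_iff.mp hR (h.adj_outside hdC haC hda).1 hd
    exact Or.inr ⟨d, Finset.mem_sdiff.mpr ⟨hd, hdC⟩, adj_deleteVerts_coe.mpr ⟨hda, hdC, haC⟩⟩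

/-- A root is dominated by itself or by the first vertex of one of its legs, and such a leg
contains a second vertex of `D`. -/
theorem card_add_card_le_of_notMem (hv : v ∉ D) (hu : u ∉ D) :
    R.card + J.card ≤ (R.filter (· ∈ D)).card + ∑ j ∈ J, legCount node D j := by
  have hroots : R ⊆ R.filter (· ∈ D) ∪ (J.filter (node · 1 ∈ D)).image (node · 0) := fun c hc => by
    rcases (isDominatingSet_iff.mp hD).2 c (h.subset (h.root_mem_gadget hc)) (notMem_empty c) with
      hcD | ⟨d, hd, hda⟩
    · exact Finset.mem_union_left _ (Finset.mem_filter.mpr ⟨hc, hcD⟩)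
    · rcases (h.adj_root c hc d).mp hda.symm with rfl | rfl | ⟨j, hj, rfl, rfl⟩
      · exact absurd hd hv
      · exact absurd hd hu
      · exact Finset.mem_union_right _
          (Finset.mem_image_of_mem (node · 0) (Finset.mem_filter.mpr ⟨hj, hd⟩))
  have hlegs : J.card + (J.filter (node · 1 ∈ D)).card ≤ ∑ j ∈ J, legCount node D j := by
    rw [Finset.card_filter, Finset.card_eq_sum_ones, ← Finset.sum_add_distrib]
    refine Finset.sum_le_sum fun j hj => ?_
    have := h.two_or_three_mem hD hj
    rw [legCount_eq]
    split_ifs <;> first | omega | tauto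
  have hcard := (Finset.card_le_card hroots).trans (Finset.card_union_le _ _)
  have himage := Finset.card_image_le (s := J.filter (node · 1 ∈ D)) (f := (node · 0))
  omega

/-- A dominating set avoiding `v` and `u` pays for every root, so with at least three roots it is
cheaper to add `v` and `u` to its part outside the gadget. -/
theorem touchingNumber_add_card_lt (hR : 3 ≤ R.card) (hv : v ∉ D) (hu : u ∉ D) :
    touchingNumber (G.deleteVerts (C : Set ℕ)) v u + J.card < D.card := by
  have hcard := h.card_eq D
  have hpay := h.card_add_card_le_of_notMem hD hv hu
  have htouch := touchingNumber_le_card_add_two (h.dominatesOff_sdiff hD) h.v_mem_deleteVerts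
    h.u_mem_deleteVerts
  omega

end Necessity

end IsGadget

/-- The sets consisting of one root `c`, the third vertices of some of the legs at `c` and the
second vertices of all other legs. -/
def rootSets [DecidableEq ι] (R : Finset ℕ) (J : Finset ι) (node : ι → ℕ → ℕ) :
    Finset (Finset ℕ) :=
  (R.sigma fun c => (J.filter fun j => node j 0 = c).powerset).image
    fun p => insert p.1 (legSet J node p.2)

theorem mem_rootSets [DecidableEq ι] : S ∈ rootSets R J node ↔
    ∃ c ∈ R, ∃ T ⊆ J.filter (fun j => node j 0 = c), insert c (legSet J node T) = S := by
  simp [rootSets, and_assoc]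

/-- For a gadget between `v` and `u` with roots `R` and legs `J`, whose removal leaves `H`, the
pairs formed by the parts of a minimum dominating set outside and inside the gadget. -/
def minDSParts [DecidableEq ι] (H : NatGraph) (v u : ℕ) (R : Finset ℕ) (J : Finset ι)
    (node : ι → ℕ → ℕ) : Set (Finset ℕ × Finset ℕ) :=
  minTouchingDS H v u ×ˢ {legSet J node ∅} ∪ savingSets H v u ×ˢ ↑(rootSets R J node)

/-- The number of minimum dominating sets of size at most `k`, plus the number of legs, of a graph
with a gadget between `v` and `u` whose removal leaves `H`; here `n` is the number of root sets. -/
noncomputable def gadgetCount (H : NatGraph) (v u : ℕ) (k : ℤ) (n : ℕ) : ℕ :=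
  if (touchingNumber H v u : ℤ) ≤ k then (minTouchingDS H v u).ncard + (savingSets H v u).ncard * n
  else 0

namespace IsGadget

theorem card_rootSets [DecidableEq ι] (h : IsGadget G C v u R J node) :
    (rootSets R J node).card = ∑ c ∈ R, 2 ^ (J.filter fun j => node j 0 = c).card := by
  rw [rootSets, Finset.card_image_of_injOn, Finset.card_sigma]
  · simp only [Finset.card_powerset]
  rintro ⟨c, T⟩ hp ⟨c', T'⟩ hp' heq
  rw [Finset.mem_coe, Finset.mem_sigma, Finset.mem_powerset] at hp hp'
  obtain ⟨hc, hT⟩ : c ∈ R ∧ T ⊆ J.filter fun j => node j 0 = c := hp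
  have hT' : T' ⊆ J := hp'.2.trans (Finset.filter_subset _ _)
  change insert c (legSet J node T) = insert c' (legSet J node T') at heq
  obtain rfl : c = c' := (Finset.mem_insert.mp (heq ▸ Finset.mem_insert_self _ _)).resolve_right
    (h.root_notMem_legSet hc)
  rw [(h.legSet_subset_cancel hc (hT.trans (Finset.filter_subset _ _)) heq.subset).antisymm
    (h.legSet_subset_cancel hc hT' heq.superset)]

theorem parts_subset_of_mem_minDSParts [DecidableEq ι] (h : IsGadget G C v u R J node)
    (hp : (D₀, S) ∈ minDSParts (G.deleteVerts (C : Set ℕ)) v u R J node) :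
    (D₀ : Set ℕ) ⊆ (G.deleteVerts (C : Set ℕ)).verts ∧ S ⊆ C := by
  rcases hp with ⟨hD₀, rfl⟩ | ⟨hD₀, hS⟩
  · exact ⟨hD₀.1.2.1, h.legSet_subset⟩
  · obtain ⟨c, hc, T, -, rfl⟩ := mem_rootSets.mp hS
    exact ⟨hD₀.2.1.1, Finset.insert_subset (h.root_mem_gadget hc) h.legSet_subset⟩

theorem disjoint_of_mem_minDSParts [DecidableEq ι] (h : IsGadget G C v u R J node)
    (hp : (D₀, S) ∈ minDSParts (G.deleteVerts (C : Set ℕ)) v u R J node) : Disjoint D₀ C :=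
  Finset.disjoint_left.mpr fun _ ha =>
    (mem_verts_deleteVerts_coe.mp ((h.parts_subset_of_mem_minDSParts hp).1 ha)).2

theorem isDominatingSet_of_mem_minDSParts [DecidableEq ι] (h : IsGadget G C v u R J node)
    (hp : (D₀, S) ∈ minDSParts (G.deleteVerts (C : Set ℕ)) v u R J node) :
    IsDominatingSet G (D₀ ∪ S) := by
  have hSC := (h.parts_subset_of_mem_minDSParts hp).2
  rcases hp with ⟨⟨⟨hvu, hdom⟩, -⟩, rfl⟩ | ⟨⟨hvu, hoff, -⟩, hS⟩
  · exact h.isDominatingSet_union (T := ∅) hvu (isDominatingSet_iff.mp hdom) hSC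
      (Finset.Subset.refl _) (by simp) (by simp)
  · obtain ⟨c, hc, T, hT, rfl⟩ := mem_rootSets.mp hS
    refine h.isDominatingSet_union hvu hoff hSC (Finset.subset_insert _ _) (fun j hj => ?_) ?_
    · rw [(Finset.mem_filter.mp (hT hj)).2]
      exact Finset.mem_insert_self _ _
    · rintro a (rfl | rfl)
      · exact ⟨c, Finset.mem_insert_self _ _, (h.adj_root c hc _).mpr (Or.inl rfl)⟩
      · exact ⟨c, Finset.mem_insert_self _ _, (h.adj_root c hc _).mpr (Or.inr (Or.inl rfl))⟩

theorem card_union_of_mem_minDSParts [DecidableEq ι] (h : IsGadget G C v u R J node)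
    (hp : (D₀, S) ∈ minDSParts (G.deleteVerts (C : Set ℕ)) v u R J node) :
    (D₀ ∪ S).card = touchingNumber (G.deleteVerts (C : Set ℕ)) v u + J.card := by
  have hdisj := (h.disjoint_of_mem_minDSParts hp).mono_right (h.parts_subset_of_mem_minDSParts hp).2
  rw [Finset.card_union_of_disjoint hdisj]
  rcases hp with ⟨⟨-, hcard⟩, rfl⟩ | ⟨⟨-, -, hcard⟩, hS⟩
  · rw [hcard, h.card_legSet]
  · obtain ⟨c, hc, T, -, rfl⟩ := mem_rootSets.mp hS
    rw [Finset.card_insert_of_notMem (h.root_notMem_legSet hc), h.card_legSet, ← hcard,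
      add_assoc, add_comm 1]

theorem touchingNumber_add_card_le (h : IsGadget G C v u R J node) (hR : 3 ≤ R.card)
    (hD : IsDominatingSet G D) :
    touchingNumber (G.deleteVerts (C : Set ℕ)) v u + J.card ≤ D.card := by
  by_cases hvu : v ∈ D ∨ u ∈ D
  · have hcard := h.card_eq D
    have hlegs := h.card_le_sum_legCount hD
    rcases (R.filter (· ∈ D)).eq_empty_or_nonempty with hempty | hne
    · have := touchingNumber_le ⟨touching_sdiff h hvu, h.isDominatingSet_sdiff hD hempty⟩
      omega
    · have := hne.card_pos
      have := touchingNumber_le_card_add_one (h.dominatesOff_sdiff hD) h.v_mem_deleteVerts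
        h.u_mem_deleteVerts (touching_sdiff h hvu)
      omega
  · rw [not_or] at hvu
    exact (h.touchingNumber_add_card_lt hD hR hvu.1 hvu.2).le

theorem sdiff_inter_mem_minDSParts [DecidableEq ι] (h : IsGadget G C v u R J node)
    (hR : 3 ≤ R.card) (hD : IsDominatingSet G D)
    (hcard : D.card = touchingNumber (G.deleteVerts (C : Set ℕ)) v u + J.card) :
    (D \ C, D ∩ C) ∈ minDSParts (G.deleteVerts (C : Set ℕ)) v u R J node := by
  have hvu : v ∈ D ∨ u ∈ D := by
    by_contra! hvu
    exact (h.touchingNumber_add_card_lt hD hR hvu.1 hvu.2).ne' hcard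
  have hsplit := h.card_eq D
  have hlegs := h.card_le_sum_legCount hD
  have hroot (hsum : ∑ j ∈ J, legCount node D j = J.card) (j) (hj : j ∈ J) (h3 : node j 3 ∈ D) :
      node j 0 ∈ R.filter (· ∈ D) :=
    Finset.mem_filter.mpr ⟨h.root_mem j hj,
      (h.mem_leg_of_legCount_eq_one hD hj (h.legCount_eq_one hD hsum hj)).2.2 h3⟩
  rcases (R.filter (· ∈ D)).eq_empty_or_nonempty with hempty | hne
  · have hmem := And.intro (touching_sdiff h hvu) (h.isDominatingSet_sdiff hD hempty)
    have hle := touchingNumber_le hmem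
    have hsum : ∑ j ∈ J, legCount node D j = J.card := by omega
    refine Or.inl ⟨⟨hmem, by dsimp only; omega⟩, ?_⟩
    have hT : (J.filter fun j => node j 3 ∈ D) = ∅ := Finset.filter_eq_empty_iff.mpr fun j hj h3 =>
      Finset.notMem_empty _ (hempty ▸ hroot hsum j hj h3)
    rw [mem_singleton_iff, h.inter_eq hD hsum, hempty, hT, Finset.empty_union]
  · have hpos := hne.card_pos
    have hoff := h.dominatesOff_sdiff hD
    have hle := touchingNumber_le_card_add_one hoff h.v_mem_deleteVerts h.u_mem_deleteVerts
      (touching_sdiff h hvu)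
    have hsum : ∑ j ∈ J, legCount node D j = J.card := by omega
    refine Or.inr ⟨⟨touching_sdiff h hvu, hoff, by dsimp only; omega⟩, ?_⟩
    obtain ⟨c, hc⟩ := Finset.card_eq_one.mp (show (R.filter (· ∈ D)).card = 1 by omega)
    refine mem_rootSets.mpr ⟨c, Finset.filter_subset _ R (hc ▸ Finset.mem_singleton_self c),
      J.filter fun j => node j 3 ∈ D, fun j hj => ?_, ?_⟩
    · obtain ⟨hjJ, h3⟩ := Finset.mem_filter.mp hj
      exact Finset.mem_filter.mpr ⟨hjJ, Finset.mem_singleton.mp (hc ▸ hroot hsum j hjJ h3)⟩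
    · rw [h.inter_eq hD hsum, hc, Finset.insert_eq]

theorem isMinDominatingSet_iff (h : IsGadget G C v u R J node) (hfin : G.verts.Finite)
    (hR : 3 ≤ R.card) : IsMinDominatingSet G D ↔ IsDominatingSet G D ∧
      D.card = touchingNumber (G.deleteVerts (C : Set ℕ)) v u + J.card := by
  classical
  obtain ⟨D₁, hD₁⟩ := minTouchingDS_nonempty (u := u)
    (hfin.subset fun a ha => (mem_verts_deleteVerts_coe.mp ha).1) h.v_mem_deleteVerts
  have hp : (D₁, legSet J node ∅) ∈ minDSParts (G.deleteVerts (C : Set ℕ)) v u R J node :=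
    Or.inl ⟨hD₁, rfl⟩
  refine and_congr_right fun hD => ⟨fun hmin => ?_, fun hcard D' hD' => ?_⟩
  · refine le_antisymm ?_ (h.touchingNumber_add_card_le hR hD)
    rw [← h.card_union_of_mem_minDSParts hp]
    exact hmin _ (h.isDominatingSet_of_mem_minDSParts hp)
  · exact hcard.trans_le (h.touchingNumber_add_card_le hR hD')

theorem setOf_isMinDominatingSet [DecidableEq ι] (h : IsGadget G C v u R J node)
    (hfin : G.verts.Finite) (hR : 3 ≤ R.card) : {D | IsMinDominatingSet G D} =
      (fun p => p.1 ∪ p.2) '' minDSParts (G.deleteVerts (C : Set ℕ)) v u R J node := by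
  ext D
  rw [mem_ofPred_eq, h.isMinDominatingSet_iff hfin hR]
  constructor
  · rintro ⟨hD, hcard⟩
    exact ⟨_, h.sdiff_inter_mem_minDSParts hR hD hcard, Finset.sdiff_union_inter D C⟩
  · rintro ⟨p, hp, rfl⟩
    exact ⟨h.isDominatingSet_of_mem_minDSParts hp, h.card_union_of_mem_minDSParts hp⟩

theorem injOn_minDSParts [DecidableEq ι] (h : IsGadget G C v u R J node) :
    InjOn (fun p => p.1 ∪ p.2) (minDSParts (G.deleteVerts (C : Set ℕ)) v u R J node) := by
  have hsdiff {D₀ S} (hp : (D₀, S) ∈ minDSParts (G.deleteVerts (C : Set ℕ)) v u R J node) :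
      (D₀ ∪ S) \ C = D₀ := by
    rw [Finset.union_sdiff_distrib,
      Finset.sdiff_eq_self_of_disjoint (h.disjoint_of_mem_minDSParts hp),
      Finset.sdiff_eq_empty_iff_subset.mpr (h.parts_subset_of_mem_minDSParts hp).2,
      Finset.union_empty]
  have hinter {D₀ S} (hp : (D₀, S) ∈ minDSParts (G.deleteVerts (C : Set ℕ)) v u R J node) :
      (D₀ ∪ S) ∩ C = S := by
    rw [Finset.union_inter_distrib_right,
      Finset.disjoint_iff_inter_eq_empty.mp (h.disjoint_of_mem_minDSParts hp),
      Finset.inter_eq_left.mpr (h.parts_subset_of_mem_minDSParts hp).2, Finset.empty_union]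
  rintro ⟨D₀, S⟩ hp ⟨D₀', S'⟩ hp' heq
  change D₀ ∪ S = D₀' ∪ S' at heq
  exact Prod.ext ((hsdiff hp).symm.trans (heq ▸ hsdiff hp'))
    ((hinter hp).symm.trans (heq ▸ hinter hp'))

theorem ncard_minDSParts [DecidableEq ι] (h : IsGadget G C v u R J node) (hfin : G.verts.Finite) :
    (minDSParts (G.deleteVerts (C : Set ℕ)) v u R J node).ncard =
      (minTouchingDS (G.deleteVerts (C : Set ℕ)) v u).ncard +
        (savingSets (G.deleteVerts (C : Set ℕ)) v u).ncard *
          ∑ c ∈ R, 2 ^ (J.filter fun j => node j 0 = c).card := by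
  have hHfin := hfin.subset fun a (ha : a ∈ (G.deleteVerts (C : Set ℕ)).verts) =>
    (mem_verts_deleteVerts_coe.mp ha).1
  rw [minDSParts, ncard_union_eq (disjoint_minTouchingDS_savingSets.set_prod_left _ _)
    ((finite_of_forall_subset_verts hHfin fun D hD => hD.1.2.1).prod (finite_singleton _))
    ((finite_of_forall_subset_verts hHfin fun D hD => hD.2.1.1).prod (Finset.finite_toSet _)),
    ncard_prod, ncard_prod, ncard_singleton, mul_one, ncard_coe_finset, h.card_rootSets]

theorem numMinDS_eq (h : IsGadget G C v u R J node) (hfin : G.verts.Finite) (hR : 3 ≤ R.card)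
    (k : ℤ) : numMinDS G (k + J.card) = gadgetCount (G.deleteVerts (C : Set ℕ)) v u k
      (∑ c ∈ R, 2 ^ (J.filter fun j => node j 0 = c).card) := by
  classical
  have hle {D} (hD : IsMinDominatingSet G D) : (D.card : ℤ) ≤ k + J.card ↔
      (touchingNumber (G.deleteVerts (C : Set ℕ)) v u : ℤ) ≤ k := by
    rw [((h.isMinDominatingSet_iff hfin hR).mp hD).2]
    push_cast
    exact add_le_add_iff_right _
  rw [numMinDS, gadgetCount]
  split_ifs with hk
  · rw [← h.ncard_minDSParts hfin, ← h.injOn_minDSParts.ncard_image,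
      ← h.setOf_isMinDominatingSet hfin hR]
    exact congrArg ncard (Set.ext fun D => and_iff_left_of_imp fun hD => (hle hD).mpr hk)
  · rw [← ncard_empty (Finset ℕ)]
    exact congrArg ncard (eq_empty_of_forall_notMem fun D hD => hk ((hle hD.1).mp hD.2))

end IsGadget

end Counting

section LegGraph

variable {ι : Type*} {ℓ : ℕ} {R : Finset ℕ} {J J' : Finset ι} {node : ι → ℕ → ℕ}

theorem legGraph_union [DecidableEq ι] :
    legGraph ℓ (J ∪ J') node = legGraph ℓ J node ⊔ legGraph ℓ J' node := by
  ext a b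
  · simp only [legGraph, SimpleGraph.Subgraph.verts_sup, Finset.mem_union, or_and_right, exists_or]
    rfl
  · simp only [legGraph, LegEdge, SimpleGraph.Subgraph.sup_adj, Finset.mem_union, or_and_right,
      exists_or, ← and_or_left, or_or_or_comm]

namespace IsLegFamily

theorem filter_root (h : IsLegFamily ℓ R J node) {c : ℕ} (hc : c ∈ R) :
    IsLegFamily ℓ {c} (J.filter fun j => node j 0 = c) node where
  root_mem _ hj := Finset.mem_singleton.mpr (Finset.mem_filter.mp hj).2
  notMem_root _ hj k hk hjk :=
    h.notMem_root _ (Finset.mem_filter.mp hj).1 k hk (Finset.mem_singleton.mp hjk ▸ hc)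
  inj _ hj k hk _ hj' := h.inj _ (Finset.mem_filter.mp hj).1 k hk _ (Finset.mem_filter.mp hj').1

theorem legEdge_asymm (h : IsLegFamily ℓ R J node) {a b : ℕ} (hab : LegEdge ℓ J node a b) :
    ¬ LegEdge ℓ J node b a := by
  obtain ⟨j, hj, k, hk, rfl, rfl⟩ := hab
  rintro ⟨j', hj', k', hk', e, e'⟩
  rcases k' with _ | k'
  · exact h.notMem_root j hj k hk (e ▸ h.root_mem j' hj')
  obtain ⟨rfl, rfl⟩ := h.inj j hj k hk j' hj' k' (by omega) e
  rcases k with _ | k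
  · exact h.notMem_root j hj 1 hk' (e' ▸ h.root_mem j hj)
  · exact absurd (h.inj j hj k (by omega) j hj (k + 2) hk' e').2 (by omega)

theorem legGraph_adj (h : IsLegFamily ℓ R J node) {a b : ℕ} :
    (legGraph ℓ J node).Adj a b ↔ LegEdge ℓ J node a b ∨ LegEdge ℓ J node b a :=
  and_iff_right_of_imp <| by
    rintro hab rfl
    exact or_self_iff.mp hab |> fun haa => h.legEdge_asymm haa haa

theorem legGraph_adj_root (h : IsLegFamily ℓ R J node) (hℓ : 0 < ℓ) {a c : ℕ} (hc : c ∈ R) :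
    (legGraph ℓ J node).Adj c a ↔ ∃ j ∈ J, node j 0 = c ∧ a = node j 1 := by
  rw [h.legGraph_adj]
  constructor
  · rintro (⟨j, hj, k, hk, rfl, rfl⟩ | ⟨j, hj, k, hk, -, rfl⟩)
    · rcases k with _ | k
      · exact ⟨j, hj, rfl, rfl⟩
      · exact absurd hc (h.notMem_root j hj k (by omega))
    · exact absurd hc (h.notMem_root j hj k hk)
  · rintro ⟨j, hj, rfl, rfl⟩
    exact Or.inl ⟨j, hj, 0, hℓ, rfl, rfl⟩

theorem legGraph_adj_succ (h : IsLegFamily ℓ R J node) {a k : ℕ} {j : ι} (hj : j ∈ J)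
    (hk : k < ℓ) : (legGraph ℓ J node).Adj (node j (k + 1)) a ↔
      a = node j k ∨ k + 1 < ℓ ∧ a = node j (k + 2) := by
  rw [h.legGraph_adj]
  constructor
  · rintro (⟨j', hj', k', hk', heq, rfl⟩ | ⟨j', hj', k', hk', rfl, heq⟩)
    · rcases k' with _ | k'
      · exact absurd (heq ▸ h.root_mem j' hj') (h.notMem_root j hj k hk)
      · obtain ⟨rfl, rfl⟩ := h.inj j hj k hk j' hj' k' (by omega) heq
        exact Or.inr ⟨hk', rfl⟩
    · obtain ⟨rfl, rfl⟩ := h.inj j hj k hk j' hj' k' hk' heq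
      exact Or.inl rfl
  · rintro (rfl | ⟨hk', rfl⟩)
    · exact Or.inr ⟨j, hj, k, hk, rfl, rfl⟩
    · exact Or.inl ⟨j, hj, k + 1, hk', rfl, rfl⟩

end IsLegFamily

theorem IsPlanar.sup_legGraph_of_roots {K : NatGraph} (hK : IsPlanar K) (hfin : K.verts.Finite)
    {v u : ℕ} (hvu : v ≠ u) (hN : ∀ c ∈ R, K.neighborSet c = {v, u}) (hℓ : 0 < ℓ)
    (h : IsLegFamily ℓ R J node) (hnew : ∀ j ∈ J, ∀ k < ℓ, node j (k + 1) ∉ K.verts) :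
    IsPlanar (K ⊔ legGraph ℓ J node) := by
  classical
  suffices key : ∀ S ⊆ R, IsPlanar (K ⊔ legGraph ℓ (J.filter fun j => node j 0 ∈ S) node) by
    simpa only [Finset.filter_true_of_mem h.root_mem] using key R (Finset.Subset.refl R)
  intro S
  induction S using Finset.induction_on with
  | empty => simpa [legGraph_empty] using hK
  | insert c S hcS ih =>
    intro hSR
    obtain ⟨hc, hSR⟩ := Finset.insert_subset_iff.mp hSR
    simp only [Finset.mem_insert, Finset.filter_or]
    rw [Finset.union_comm, legGraph_union, ← sup_assoc]
    have hlegs : IsLegFamily ℓ R (J.filter fun j => node j 0 ∈ S) node :=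
      h.mono (Finset.filter_subset _ _)
    refine (ih hSR).sup_legGraph (hfin.union finite_verts_legGraph) hvu ?_ hℓ (h.filter_root hc) ?_
    · rw [← hN c hc]
      ext a
      refine or_iff_left fun hca => ?_
      obtain ⟨j, hj, rfl, -⟩ := (hlegs.legGraph_adj_root hℓ hc).mp hca
      exact hcS (Finset.mem_filter.mp hj).2
    · intro j hj k hk
      rw [Finset.mem_filter] at hj
      rintro (hjK | ⟨j', hj', k', hk', heq⟩)
      · exact hnew j hj.1 k hk hjK
      · rw [Finset.mem_filter] at hj'
        rcases k' with _ | k'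
        · exact h.notMem_root j hj.1 k hk (heq ▸ h.root_mem j' hj'.1)
        · obtain ⟨rfl, -⟩ := h.inj j' hj'.1 k' hk' j hj.1 k hk heq
          exact hcS (hj.2 ▸ hj'.2)

end LegGraph

section Replace

variable {G : NatGraph} {C : Finset ℕ} {v u : ℕ} {R : Finset ℕ} {ι κ : Type*} {J : Finset ι}
  {node : ι → ℕ → ℕ} {node₀ : κ → ℕ → ℕ}

/-- The graph obtained from `G` by deleting the vertices of `C` outside `R` and attaching legs of
length three, whose vertices are named by deleted ones, to the vertices in `R`. -/
def replaceWithLegs (G : NatGraph) (C R : Finset ℕ) (J : Finset ι) (node : ι → ℕ → ℕ) : NatGraph :=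
  G.deleteVerts ((C \ R : Finset ℕ) : Set ℕ) ⊔ legGraph 3 J node

theorem replaceWithLegs_adj {a b : ℕ} : (replaceWithLegs G C R J node).Adj a b ↔
    G.Adj a b ∧ (a ∈ C → a ∈ R) ∧ (b ∈ C → b ∈ R) ∨ (legGraph 3 J node).Adj a b := by
  rw [replaceWithLegs, SimpleGraph.Subgraph.sup_adj, adj_deleteVerts_coe]
  simp only [Finset.mem_sdiff, not_and, not_not]

theorem IsLegFamily.verts_legGraph_subset (h : IsLegFamily 3 R J node) {a : ℕ}
    (ha : a ∈ (legGraph 3 J node).verts) : a ∈ gadgetVerts R J node := by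
  obtain ⟨j, hj, k, hk, rfl⟩ := ha
  rcases k with _ | k
  · exact mem_gadgetVerts.mpr (Or.inl (h.root_mem j hj))
  · exact mem_gadgetVerts.mpr (Or.inr ⟨j, hj, k, hk, rfl⟩)

theorem mem_verts_replaceWithLegs (hCG : (C : Set ℕ) ⊆ G.verts) (h : IsLegFamily 3 R J node)
    (hC : gadgetVerts R J node ⊆ C) {a : ℕ} : a ∈ (replaceWithLegs G C R J node).verts ↔
      a ∈ G.verts ∧ (a ∈ C → a ∈ gadgetVerts R J node) := by
  rw [replaceWithLegs, SimpleGraph.Subgraph.verts_sup, Set.mem_union, mem_verts_deleteVerts_coe,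
    Finset.mem_sdiff, not_and, not_not]
  constructor
  · rintro (⟨haG, haR⟩ | ha)
    · exact ⟨haG, fun haC => mem_gadgetVerts.mpr (Or.inl (haR haC))⟩
    · have hmem := h.verts_legGraph_subset ha
      exact ⟨hCG (hC hmem), fun _ => hmem⟩
  · rintro ⟨haG, ha⟩
    by_cases haC : a ∈ C
    · rcases mem_gadgetVerts.mp (ha haC) with haR | ⟨j, hj, k, hk, rfl⟩
      · exact Or.inl ⟨haG, fun _ => haR⟩
      · exact Or.inr ⟨j, hj, k + 1, hk, rfl⟩
    · exact Or.inl ⟨haG, fun hh => absurd hh haC⟩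

theorem replaceWithLegs_deleteVerts (hCG : (C : Set ℕ) ⊆ G.verts) (h : IsLegFamily 3 R J node)
    (hC : gadgetVerts R J node ⊆ C) :
    (replaceWithLegs G C R J node).deleteVerts (gadgetVerts R J node : Set ℕ) =
      G.deleteVerts (C : Set ℕ) := by
  have hR {a} (haR : a ∈ R) : a ∈ gadgetVerts R J node := mem_gadgetVerts.mpr (Or.inl haR)
  ext a b
  · rw [mem_verts_deleteVerts_coe, mem_verts_replaceWithLegs hCG h hC, mem_verts_deleteVerts_coe]
    exact ⟨fun ⟨⟨haG, ha⟩, hna⟩ => ⟨haG, fun haC => hna (ha haC)⟩,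
      fun ⟨haG, haC⟩ => ⟨⟨haG, fun hh => absurd hh haC⟩, fun hh => haC (hC hh)⟩⟩
  · rw [adj_deleteVerts_coe, adj_deleteVerts_coe, replaceWithLegs_adj]
    constructor
    · rintro ⟨⟨hab, haR, hbR⟩ | hab, ha, hb⟩
      · exact ⟨hab, fun haC => ha (hR (haR haC)), fun hbC => hb (hR (hbR hbC))⟩
      · exact absurd (h.verts_legGraph_subset ((legGraph 3 J node).edge_vert hab)) ha
    · rintro ⟨hab, ha, hb⟩
      exact ⟨Or.inl ⟨hab, fun haC => absurd haC ha, fun hbC => absurd hbC hb⟩,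
        fun hh => ha (hC hh), fun hh => hb (hC hh)⟩

namespace IsGadget

variable (hG : IsGadget G C v u C (∅ : Finset κ) node₀) (h : IsLegFamily 3 R J node)
  (hC : gadgetVerts R J node ⊆ C)

include hG h hC

theorem replaceWithLegs_adj_root {a c : ℕ} (hc : c ∈ R) :
    (replaceWithLegs G C R J node).Adj c a ↔
      a = v ∨ a = u ∨ ∃ j ∈ J, node j 0 = c ∧ a = node j 1 := by
  have hadj := hG.adj_root c (hC (mem_gadgetVerts.mpr (Or.inl hc))) a
  simp only [Finset.notMem_empty, false_and, exists_false, or_false] at hadj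
  rw [replaceWithLegs_adj, h.legGraph_adj_root three_pos hc, hadj, ← or_assoc]
  refine or_congr_left ⟨And.left, fun ha => ⟨ha, fun _ => hc, fun haC => ?_⟩⟩
  rcases ha with rfl | rfl
  exacts [absurd haC hG.v_notMem, absurd haC hG.u_notMem]

omit hG in
theorem replaceWithLegs_adj_succ {a k : ℕ} {j : ι} (hj : j ∈ J) (hk : k < 3) :
    (replaceWithLegs G C R J node).Adj (node j (k + 1)) a ↔
      a = node j k ∨ k + 1 < 3 ∧ a = node j (k + 2) := by
  rw [replaceWithLegs_adj, h.legGraph_adj_succ hj hk]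
  refine or_iff_right fun hadj => h.notMem_root j hj k hk (hadj.2.1 (hC ?_))
  exact mem_gadgetVerts.mpr (Or.inr ⟨j, hj, k, hk, rfl⟩)

theorem isGadget_replaceWithLegs :
    IsGadget (replaceWithLegs G C R J node) (gadgetVerts R J node) v u R J node where
  toIsLegFamily := h
  ne := hG.ne
  v_mem := (mem_verts_replaceWithLegs hG.subset h hC).mpr
    ⟨hG.v_mem, fun hv => absurd hv hG.v_notMem⟩
  v_notMem hv := hG.v_notMem (hC hv)
  u_mem := (mem_verts_replaceWithLegs hG.subset h hC).mpr
    ⟨hG.u_mem, fun hu => absurd hu hG.u_notMem⟩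
  u_notMem hu := hG.u_notMem (hC hu)
  subset a ha := (mem_verts_replaceWithLegs hG.subset h hC).mpr ⟨hG.subset (hC ha), fun _ => ha⟩
  eq_gadgetVerts := rfl
  adj_root c hc a := hG.replaceWithLegs_adj_root h hC hc
  adj_one j hj a := by simpa using replaceWithLegs_adj_succ h hC hj (k := 0) (by norm_num)
  adj_two j hj a := by simpa using replaceWithLegs_adj_succ h hC hj (k := 1) (by norm_num)
  adj_three j hj a := by simpa using replaceWithLegs_adj_succ h hC hj (k := 2) (by norm_num)

theorem isPlanar_replaceWithLegs (hfin : G.verts.Finite) (hpl : IsPlanar G) :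
    IsPlanar (replaceWithLegs G C R J node) := by
  have hle : G.deleteVerts ((C \ R : Finset ℕ) : Set ℕ) ≤ G := SimpleGraph.Subgraph.deleteVerts_le
  refine (hpl.mono hle).sup_legGraph_of_roots (hfin.subset hle.1) hG.ne (fun c hc => ?_) three_pos h
    fun j hj k hk => ?_
  · have hadj := hG.adj_root c (hC (mem_gadgetVerts.mpr (Or.inl hc)))
    simp only [Finset.notMem_empty, false_and, exists_false, or_false] at hadj
    ext a
    rw [SimpleGraph.Subgraph.mem_neighborSet, adj_deleteVerts_coe, hadj]
    simp only [Finset.mem_sdiff, hc, not_true_eq_false, and_false, not_false_eq_true, true_and]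
    refine and_iff_left_of_imp ?_
    rintro (rfl | rfl) hmem
    exacts [hG.v_notMem hmem.1, hG.u_notMem hmem.1]
  · rw [mem_verts_deleteVerts_coe, Finset.mem_sdiff]
    exact fun hmem => hmem.2 ⟨hC (mem_gadgetVerts.mpr (Or.inr ⟨j, hj, k, hk, rfl⟩)),
      h.notMem_root j hj k hk⟩

theorem numMinDS_replaceWithLegs (hfin : G.verts.Finite) (hC3 : 3 ≤ C.card) (hR : 3 ≤ R.card)
    (hweight : ∑ c ∈ R, 2 ^ (J.filter fun j => node j 0 = c).card = C.card) (k : ℤ) :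
    numMinDS (replaceWithLegs G C R J node) (k + J.card) = numMinDS G k := by
  have hfin' : (replaceWithLegs G C R J node).verts.Finite :=
    hfin.subset fun a ha => ((mem_verts_replaceWithLegs hG.subset h hC).mp ha).1
  rw [(hG.isGadget_replaceWithLegs h hC).numMinDS_eq hfin' hR, hweight,
    replaceWithLegs_deleteVerts hG.subset h hC]
  simpa using (hG.numMinDS_eq hfin hC3 k).symm

end IsGadget

end Replace

/-! ### Program logic for the random access machine -/

namespace RAM

/-- The commands of a list, one after the other. -/
def block (l : List Cmd) : Cmd := l.foldr Cmd.seq Cmd.skip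

/-- Commands that take one step. -/
def IsBasic : Cmd → Prop
  | .seq _ _ | .ifPos _ _ _ | .whilePos _ _ => False
  | _ => True

/-- The effect of a basic command (the identity for all others). -/
def step (σ : State) : Cmd → State
  | .const r z => { σ with reg := Function.update σ.reg r z }
  | .add r s t => { σ with reg := Function.update σ.reg r (σ.reg s + σ.reg t) }
  | .sub r s t => { σ with reg := Function.update σ.reg r (σ.reg s - σ.reg t) }
  | .load r s => { σ with reg := Function.update σ.reg r (σ.mem (σ.reg s)) }
  | .store r s => { σ with mem := Function.update σ.mem (σ.reg r) (σ.reg s) }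
  | .write r => { σ with out := σ.out ++ [σ.reg r] }
  | _ => σ

theorem exec_of_isBasic {c : Cmd} (hc : IsBasic c) (σ : State) : Exec c σ 1 (step σ c) := by
  cases c <;> first | exact hc.elim | constructor

/-- Total correctness with a time bound: started in `σ`, the command halts within `n` steps in a
configuration satisfying `Q`. -/
def Halts (c : Cmd) (σ : State) (n : ℕ) (Q : State → Prop) : Prop :=
  ∃ t ≤ n, ∃ τ, Exec c σ t τ ∧ Q τ

namespace Halts

variable {a b : Cmd} {σ τ : State} {m n : ℕ} {Q Q' : State → Prop}

theorem mono (h : Halts a σ m Q) (hmn : m ≤ n) (hQ : ∀ τ, Q τ → Q' τ) : Halts a σ n Q' := by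
  obtain ⟨t, ht, τ, he, hτ⟩ := h
  exact ⟨t, ht.trans hmn, τ, he, hQ τ hτ⟩

theorem mono_time (h : Halts a σ m Q) (hmn : m ≤ n) : Halts a σ n Q := h.mono hmn fun _ hτ => hτ

theorem seq (h : Halts a σ m Q) (h' : ∀ τ, Q τ → Halts b τ n Q') :
    Halts (.seq a b) σ (m + n) Q' := by
  obtain ⟨t, ht, τ, he, hτ⟩ := h
  obtain ⟨t', ht', υ, he', hυ⟩ := h' τ hτ
  exact ⟨t + t', Nat.add_le_add ht ht', υ, .seq he he', hυ⟩

theorem seq_eq (h : Halts a σ m (· = τ)) (h' : Halts b τ n Q) : Halts (.seq a b) σ (m + n) Q :=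
  h.seq fun _ e => e ▸ h'

theorem skip (h : Q σ) : Halts .skip σ 1 Q := ⟨1, le_rfl, σ, .skip σ, h⟩

theorem block {l : List Cmd} (hl : ∀ c ∈ l, IsBasic c) (h : Q (l.foldl step σ)) :
    Halts (block l) σ (l.length + 1) Q := by
  induction l generalizing σ with
  | nil => exact skip h
  | cons c l ih =>
    obtain ⟨hc, hl⟩ := List.forall_mem_cons.mp hl
    exact (seq_eq ⟨1, le_rfl, _, exec_of_isBasic hc σ, rfl⟩ (ih hl h)).mono_time
      (by rw [List.length_cons]; omega)

theorem ifPos {r : ℕ} (hpos : 0 < σ.reg r → Halts a σ n Q)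
    (hneg : ¬ 0 < σ.reg r → Halts b σ n Q) : Halts (.ifPos r a b) σ (1 + n) Q := by
  by_cases h : 0 < σ.reg r
  · obtain ⟨t, ht, τ, he, hτ⟩ := hpos h
    exact ⟨1 + t, by omega, τ, .ifPos_true h he, hτ⟩
  · obtain ⟨t, ht, τ, he, hτ⟩ := hneg h
    exact ⟨1 + t, by omega, τ, .ifPos_false h he, hτ⟩

theorem whilePos_of_pos {r : ℕ} (hr : 0 < σ.reg r) (h : Halts a σ m Q)
    (h' : ∀ τ, Q τ → Halts (.whilePos r a) τ n Q') :
    Halts (.whilePos r a) σ (1 + m + n) Q' := by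
  obtain ⟨t, ht, τ, he, hτ⟩ := h
  obtain ⟨t', ht', υ, he', hυ⟩ := h' τ hτ
  exact ⟨1 + t + t', by omega, υ, .while_true hr he he', hυ⟩

theorem whilePos_of_not_pos {r : ℕ} (hr : ¬ 0 < σ.reg r) (h : Q σ) : Halts (.whilePos r a) σ 1 Q :=
  ⟨1, le_rfl, σ, .while_false hr, h⟩

theorem whilePos {r K : ℕ} (Inv : ℕ → State → Prop)
    (hstep : ∀ m σ, Inv m σ → 0 < σ.reg r → Halts a σ K fun τ => ∃ m' < m, Inv m' τ)
    (h : Inv m σ) :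
    Halts (.whilePos r a) σ ((K + 1) * m + 1) fun τ => (∃ m', Inv m' τ) ∧ ¬ 0 < τ.reg r := by
  induction m using Nat.strong_induction_on generalizing σ with
  | _ m ih =>
    by_cases hr : 0 < σ.reg r
    · rcases m with _ | m
      · obtain ⟨-, -, -, -, m', hm', -⟩ := hstep 0 σ h hr
        exact absurd hm' (Nat.not_lt_zero m')
      · refine (whilePos_of_pos hr (hstep (m + 1) σ h hr) (n := (K + 1) * m + 1) ?_).mono_time ?_
        · rintro τ ⟨m', hm', hτ⟩
          exact (ih m' hm' hτ).mono_time (by gcongr; omega)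
        · rw [Nat.mul_succ]; omega
    · exact (whilePos_of_not_pos hr ⟨⟨m, h⟩, hr⟩).mono_time (by omega)

end Halts

/-- Registers with the values listed, and `0` from there on. -/
def regs (l : List ℤ) : ℕ → ℤ := fun i => l.getD i 0

theorem update_regs {l : List ℤ} {r : ℕ} (h : r < l.length) (z : ℤ) :
    Function.update (regs l) r z = regs (l.set r z) := by
  funext i
  by_cases hi : i = r
  · subst hi
    simp [regs, h]
  · rw [Function.update_of_ne hi]
    simp [regs, List.getD_eq_getElem?_getD, List.getElem?_set_ne (Ne.symm hi)]

/-- A memory holding the input word at the nonnegative addresses, and a table `f` of flags, with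
the flag of `a` at the address `-1 - a`. -/
def memOf (w : List ℤ) (f : ℕ → ℤ) : ℤ → ℤ :=
  fun i => if 0 ≤ i then w.getD i.toNat 0 else f (-1 - i).toNat

theorem memOf_natCast (w : List ℤ) (f : ℕ → ℤ) (i : ℕ) : memOf w f i = w.getD i 0 := by
  simp [memOf]

theorem memOf_neg (w : List ℤ) (f : ℕ → ℤ) (a : ℕ) : memOf w f (-(a : ℤ) - 1) = f a := by
  rw [memOf, if_neg (by omega)]
  congr 1; omega

theorem update_memOf (w : List ℤ) (f : ℕ → ℤ) (a : ℕ) (z : ℤ) :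
    Function.update (memOf w f) (-(a : ℤ) - 1) z = memOf w (Function.update f a z) := by
  funext i
  by_cases hi : i = -(a : ℤ) - 1
  · subst hi
    rw [Function.update_self, memOf_neg, Function.update_self]
  · rw [Function.update_of_ne hi, memOf, memOf]
    split_ifs with h
    · rfl
    · rw [Function.update_of_ne]; omega

theorem init_eq (w : List ℤ) :
    init w = ⟨regs (w.length :: List.replicate 13 0), memOf w fun _ => 0, []⟩ := by
  simp only [init, State.mk.injEq, and_true]
  refine ⟨funext fun r => ?_, rfl⟩
  rcases r with _ | r
  · simp [regs]
  · rw [if_neg (Nat.succ_ne_zero r), regs, List.getD_cons_succ, List.getD_eq_getElem?_getD,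
      List.getElem?_replicate]
    split_ifs <;> rfl

/-- The word `l` stands in `w` at position `i`. -/
def At (w : List ℤ) (i : ℕ) (l : List ℤ) : Prop := ∃ pre post, w = pre ++ l ++ post ∧ pre.length = i

variable {w : List ℤ}

namespace At

variable {i : ℕ} {l l' : List ℤ}

theorem getD {a : ℤ} (h : At w i (a :: l)) : w.getD i 0 = a := by
  obtain ⟨pre, post, rfl, rfl⟩ := h
  simp [List.getD_eq_getElem?_getD]

theorem right (h : At w i (l ++ l')) : At w (i + l.length) l' := by
  obtain ⟨pre, post, rfl, rfl⟩ := h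
  exact ⟨pre ++ l, post, by simp, by simp⟩

theorem left (h : At w i (l ++ l')) : At w i l := by
  obtain ⟨pre, post, rfl, rfl⟩ := h
  exact ⟨pre, l' ++ post, by simp, rfl⟩

theorem self (w : List ℤ) : At w 0 w := ⟨[], [], by simp, rfl⟩

end At

/-- The configurations in the course of the computation: registers `0` and `3` hold the constants
`0` and `1`, register `1` a position `i` of the input word, registers `2` and `4` are scratch, and
`l` lists the values of the registers from `5` on. -/
def conf (w : List ℤ) (i t s : ℤ) (l : List ℤ) (f : ℕ → ℤ) (o : List ℤ) : State :=
  ⟨regs (0 :: i :: t :: 1 :: s :: l), memOf w f, o⟩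

/-- The position of the reading head is `i`; the registers from `5` on, the flags and the output
satisfy `Q`. -/
def ConfAt (w : List ℤ) (i : ℤ) (Q : List ℤ → (ℕ → ℤ) → List ℤ → Prop) (τ : State) : Prop :=
  ∃ t s l f o, τ = conf w i t s l f o ∧ Q l f o

/-- Move the reading head to the next entry; register `4` is positive unless the entry is
negative. -/
def advance : Cmd := block [.add 1 1 3, .load 2 1, .add 4 2 3]

/-- Run `a` for all entries of a list in memory, up to the first negative entry, which ends it. -/
def foreach (a : Cmd) : Cmd :=
  .seq (block [.load 2 1, .add 4 2 3]) (.whilePos 4 (.seq a advance))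

namespace Halts

variable {t s : ℤ} {l : List ℤ} {f : ℕ → ℤ} {o : List ℤ} {i : ℕ}

theorem advance :
    Halts advance (conf w i t s l f o) 4
      (· = conf w (i + 1 : ℕ) (w.getD (i + 1) 0) (w.getD (i + 1) 0 + 1) l f o) := by
  have hload : memOf w f ((i : ℤ) + 1) = w.getD (i + 1) 0 := mod_cast memOf_natCast w f (i + 1)
  exact Halts.block (by simp [IsBasic]) (by simp [step, conf, update_regs, regs, hload])

variable {α : Type*} {hd : α → ℕ} {tl : α → List ℤ} {body : Cmd} {K : ℕ} {L : List α}

theorem foreach_loop (Inv : List α → List ℤ → (ℕ → ℤ) → List ℤ → Prop)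
    (hbody : ∀ P a i l f o, Inv P l f o → At w i ((hd a : ℤ) :: tl a) →
      Halts body (conf w i (hd a) (hd a + 1) l f o) K
        (ConfAt w (i + (tl a).length : ℕ) (Inv (P ++ [a]))))
    {P : List α} (hInv : Inv P l f o)
    (hat : At w i (L.flatMap (fun a => (hd a : ℤ) :: tl a) ++ [-1])) :
    Halts (.whilePos 4 (.seq body RAM.advance)) (conf w i (w.getD i 0) (w.getD i 0 + 1) l f o)
      ((K + 5) * L.length + 1)
      (ConfAt w (i + (L.flatMap fun a => (hd a : ℤ) :: tl a).length : ℕ) (Inv (P ++ L))) := by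
  induction L generalizing P i l f o with
  | nil =>
    rw [At.getD (a := -1) hat]
    exact whilePos_of_not_pos (by simp [conf, regs])
      ⟨-1, 0, l, f, o, by simp, by rwa [List.append_nil]⟩
  | cons a L ih =>
    rw [List.flatMap_cons, List.append_assoc] at hat
    rw [At.getD (a := hd a) hat]
    have hround := (hbody P a i l f o hInv hat.left).seq (b := RAM.advance) (n := 4)
      (Q' := fun τ => ∃ l f o, τ = conf w (i + (tl a).length + 1 : ℕ)
        (w.getD (i + (tl a).length + 1) 0) (w.getD (i + (tl a).length + 1) 0 + 1) l f o ∧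
        Inv (P ++ [a]) l f o) (by
        rintro _ ⟨t, s, l, f, o, rfl, hInv'⟩
        exact advance.mono le_rfl fun τ hτ => ⟨l, f, o, hτ, hInv'⟩)
    have hpos : (0 : ℤ) < hd a + 1 := by omega
    refine (whilePos_of_pos hpos hround (n := (K + 5) * L.length + 1) ?_).mono_time ?_
    · rintro _ ⟨l, f, o, rfl, hInv'⟩
      have hrest := ih hInv' hat.right
      rw [List.length_cons, ← Nat.add_assoc] at hrest
      simpa [Nat.add_assoc, Nat.add_left_comm, Nat.add_comm] using hrest
    · rw [List.length_cons, Nat.mul_succ]; omega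

theorem foreach (Inv : List α → List ℤ → (ℕ → ℤ) → List ℤ → Prop)
    (hbody : ∀ P a i l f o, Inv P l f o → At w i ((hd a : ℤ) :: tl a) →
      Halts body (conf w i (hd a) (hd a + 1) l f o) K
        (ConfAt w (i + (tl a).length : ℕ) (Inv (P ++ [a]))))
    (hInv : Inv [] l f o) (hat : At w i (L.flatMap (fun a => (hd a : ℤ) :: tl a) ++ [-1])) :
    Halts (foreach body) (conf w i t s l f o) ((K + 5) * L.length + 4)
      (ConfAt w (i + (L.flatMap fun a => (hd a : ℤ) :: tl a).length : ℕ) (Inv L)) :=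
  (seq_eq (m := 3)
    (Halts.block (by simp [IsBasic]) (by simp [step, conf, update_regs, regs, memOf_natCast]))
    (foreach_loop Inv hbody hInv hat)).mono_time (by omega)

theorem foreach_print (S : List ℤ → Prop) (g : α → List ℤ)
    (hbody : ∀ a i l o, S l → At w i ((hd a : ℤ) :: tl a) →
      Halts body (conf w i (hd a) (hd a + 1) l f o) K
        (ConfAt w (i + (tl a).length : ℕ) fun l' f' o' => S l' ∧ f' = f ∧ o' = o ++ g a))
    (hS : S l) (hat : At w i (L.flatMap (fun a => (hd a : ℤ) :: tl a) ++ [-1])) :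
    Halts (RAM.foreach body) (conf w i t s l f o) ((K + 5) * L.length + 4)
      (ConfAt w (i + (L.flatMap fun a => (hd a : ℤ) :: tl a).length : ℕ)
        fun l' f' o' => S l' ∧ f' = f ∧ o' = o ++ L.flatMap g) := by
  refine foreach (fun P l' f' o' => S l' ∧ f' = f ∧ o' = o ++ P.flatMap g) ?_
    ⟨hS, rfl, by simp⟩ hat
  rintro P a i l _ _ ⟨hS, rfl, rfl⟩ hat
  simpa [List.append_assoc] using hbody a i l (o ++ P.flatMap g) hS hat

end Halts

end RAM

namespace IsLegFamily

variable {ι : Type*} {ℓ : ℕ} {R : Finset ℕ} {J : Finset ι} {node : ι → ℕ → ℕ}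

theorem insert_root (h : IsLegFamily ℓ R J node) {c : ℕ}
    (hc : ∀ j ∈ J, ∀ k < ℓ, node j (k + 1) ≠ c) : IsLegFamily ℓ (insert c R) J node where
  root_mem j hj := Finset.mem_insert_of_mem (h.root_mem j hj)
  notMem_root j hj k hk hmem :=
    (Finset.mem_insert.mp hmem).elim (hc j hj k hk) (h.notMem_root j hj k hk)
  inj := h.inj

theorem insert_leg [DecidableEq ι] (h : IsLegFamily ℓ R J node) {i : ι} (hroot : node i 0 ∈ R)
    (hR : ∀ k < ℓ, node i (k + 1) ∉ R)
    (hJ : ∀ k < ℓ, ∀ j ∈ J, ∀ k' < ℓ, node j (k' + 1) ≠ node i (k + 1))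
    (hinj : ∀ k < ℓ, ∀ k' < ℓ, node i (k + 1) = node i (k' + 1) → k = k') :
    IsLegFamily ℓ R (insert i J) node where
  root_mem := Finset.forall_mem_insert .. |>.mpr ⟨hroot, h.root_mem⟩
  notMem_root := Finset.forall_mem_insert .. |>.mpr ⟨hR, h.notMem_root⟩
  inj := by
    intro j hj k hk j' hj' k' hk' e
    rcases Finset.mem_insert.mp hj with rfl | hjJ <;>
      rcases Finset.mem_insert.mp hj' with rfl | hjJ'
    · exact ⟨rfl, hinj k hk k' hk' e⟩
    · exact absurd e.symm (hJ k hk j' hjJ' k' hk')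
    · exact absurd e (hJ k' hk' j hjJ k hk)
    · exact h.inj j hjJ k hk j' hjJ' k' hk' e

end IsLegFamily

/-- The vertices of the leg `(c, x, y, z)`, from its root `c` outwards. -/
def legNode : ℕ × ℕ × ℕ × ℕ → ℕ → ℕ
  | (c, _, _, _), 0 => c
  | (_, x, _, _), 1 => x
  | (_, _, y, _), 2 => y
  | (_, _, _, z), _ => z

theorem mem_leg_iff (c : ℕ) {a x y z : ℕ} :
    a ∈ [x, y, z] ↔ ∃ k < 3, legNode (c, x, y, z) (k + 1) = a := by
  constructor
  · intro ha
    simp only [List.mem_cons, List.not_mem_nil, or_false] at ha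
    rcases ha with rfl | rfl | rfl
    exacts [⟨0, by simp, rfl⟩, ⟨1, by simp, rfl⟩, ⟨2, by simp, rfl⟩]
  · rintro ⟨k, hk, rfl⟩
    interval_cases k <;> simp [legNode]

theorem legNode_injOn {c x y z : ℕ} (h : [x, y, z].Nodup) {k k' : ℕ} (hk : k < 3) (hk' : k' < 3)
    (e : legNode (c, x, y, z) (k + 1) = legNode (c, x, y, z) (k' + 1)) : k = k' := by
  simp only [List.nodup_cons, List.mem_cons, List.not_mem_nil, or_false, not_or] at h
  interval_cases k <;> interval_cases k' <;> simp_all [legNode]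

/-- The number of legs at `c`. -/
def legNumber (J : Finset (ℕ × ℕ × ℕ × ℕ)) (c : ℕ) : ℕ := (J.filter fun j => legNode j 0 = c).card

/-- The weight of a gadget: the number of ways to spend one more vertex on a root. -/
def gadgetWeight (R : Finset ℕ) (J : Finset (ℕ × ℕ × ℕ × ℕ)) : ℕ := ∑ c ∈ R, 2 ^ legNumber J c

/-! ### Greedy layout of a gadget -/

/-- `Layout f₀ U R J f`: the names `U` have been used up, in this order, for the roots `R` and the
legs `J`, and the flags `f₀` have become `f`: zero for roots, the successor of the preceding vertex
for vertices of legs. -/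
inductive Layout (f₀ : ℕ → ℤ) :
    List ℕ → Finset ℕ → Finset (ℕ × ℕ × ℕ × ℕ) → (ℕ → ℤ) → Prop
  | nil : Layout f₀ [] ∅ ∅ f₀
  | root {U : List ℕ} {R : Finset ℕ} {J : Finset (ℕ × ℕ × ℕ × ℕ)} {f : ℕ → ℤ} {c : ℕ} :
      Layout f₀ U R J f → c ∉ U → Layout f₀ (U ++ [c]) (insert c R) J (Function.update f c 0)
  | leg {U : List ℕ} {R : Finset ℕ} {J : Finset (ℕ × ℕ × ℕ × ℕ)} {f : ℕ → ℤ} {c x y z : ℕ} :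
      Layout f₀ U R J f → c ∈ R → (U ++ [x, y, z]).Nodup →
      Layout f₀ (U ++ [x, y, z]) R (insert (c, x, y, z) J)
        (Function.update (Function.update (Function.update f x (c + 1)) y (x + 1)) z (y + 1))

namespace Layout

variable {f₀ f : ℕ → ℤ} {U : List ℕ} {R : Finset ℕ} {J : Finset (ℕ × ℕ × ℕ × ℕ)} {a c x y z : ℕ}

theorem mem_iff (h : Layout f₀ U R J f) : a ∈ U ↔ a ∈ gadgetVerts R J legNode := by
  rw [mem_gadgetVerts]
  induction h with
  | nil => simp
  | root _ _ ih =>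
    rw [List.mem_append, ih, Finset.mem_insert, List.mem_singleton]
    exact or_comm.trans or_assoc.symm
  | @leg _ _ _ _ c _ _ _ _ _ _ ih =>
    rw [List.mem_append, ih, Finset.exists_mem_insert, mem_leg_iff c, or_assoc]
    exact or_congr_right or_comm

theorem root_mem (h : Layout f₀ U R J f) (hc : c ∈ R) : c ∈ U :=
  h.mem_iff.mpr (mem_gadgetVerts.mpr (Or.inl hc))

theorem leg_mem (h : Layout f₀ U R J f) {j : ℕ × ℕ × ℕ × ℕ} (hj : j ∈ J) {k : ℕ} (hk : k < 3) :
    legNode j (k + 1) ∈ U :=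
  h.mem_iff.mpr (mem_gadgetVerts.mpr (Or.inr ⟨j, hj, k, hk, rfl⟩))

theorem isLegFamily (h : Layout f₀ U R J f) : IsLegFamily 3 R J legNode := by
  induction h with
  | nil => constructor <;> simp
  | root h hc ih => exact ih.insert_root fun j hj k hk e => hc (e ▸ h.leg_mem hj hk)
  | @leg U _ _ _ c x y z h hc hnd ih =>
    have hnew : ∀ k < 3, legNode (c, x, y, z) (k + 1) ∉ U := fun k hk hmem =>
      List.disjoint_of_nodup_append hnd hmem ((mem_leg_iff c).mpr ⟨k, hk, rfl⟩)
    exact ih.insert_leg hc (fun k hk hR => hnew k hk (h.root_mem hR))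
      (fun k hk j hj k' hk' e => hnew k hk (e ▸ h.leg_mem hj hk'))
      (fun k hk k' hk' => legNode_injOn (List.nodup_append.mp hnd).2.1 hk hk')

theorem update_leg_of_mem (hnd : (U ++ [x, y, z]).Nodup) (ha : a ∈ U) (r s t : ℤ) :
    Function.update (Function.update (Function.update f x r) y s) z t a = f a := by
  have hd : a ∉ [x, y, z] := List.disjoint_of_nodup_append hnd ha
  simp only [List.mem_cons, List.not_mem_nil, or_false, not_or] at hd
  rw [Function.update_of_ne hd.2.2, Function.update_of_ne hd.2.1, Function.update_of_ne hd.1]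

theorem flag_of_notMem (h : Layout f₀ U R J f) (ha : a ∉ U) : f a = f₀ a := by
  induction h with
  | nil => rfl
  | root _ _ ih =>
    simp only [List.mem_append, List.mem_singleton, not_or] at ha
    rw [Function.update_of_ne ha.2, ih ha.1]
  | leg _ _ _ ih =>
    simp only [List.mem_append, List.mem_cons, List.not_mem_nil, or_false, not_or] at ha
    rw [Function.update_of_ne ha.2.2.2, Function.update_of_ne ha.2.2.1,
      Function.update_of_ne ha.2.1, ih ha.1]

theorem flag_root (h : Layout f₀ U R J f) (ha : a ∈ R) : f a = 0 := by
  induction h with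
  | nil => simp at ha
  | @root _ _ _ _ c _ _ ih =>
    by_cases hac : a = c
    · rw [hac, Function.update_self]
    · rw [Function.update_of_ne hac, ih (Finset.mem_of_mem_insert_of_ne ha hac)]
  | leg h _ hnd ih => rw [update_leg_of_mem hnd (h.root_mem ha), ih ha]

theorem flag_leg (h : Layout f₀ U R J f) {j : ℕ × ℕ × ℕ × ℕ} (hj : j ∈ J) {k : ℕ} (hk : k < 3) :
    f (legNode j (k + 1)) = legNode j k + 1 := by
  induction h with
  | nil => simp at hj
  | root h hc ih => rw [Function.update_of_ne (ne_of_mem_of_not_mem (h.leg_mem hj hk) hc), ih hj]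
  | @leg _ _ _ _ _ x y z h _ hnd ih =>
    rcases Finset.mem_insert.mp hj with rfl | hj
    · obtain ⟨⟨hxy, hxz⟩, hyz⟩ : (x ≠ y ∧ x ≠ z) ∧ y ≠ z := by
        simpa using (List.nodup_append.mp hnd).2.1
      interval_cases k
      · simp [legNode, Function.update_of_ne hxy, Function.update_of_ne hxz]
      · simp [legNode, Function.update_of_ne hyz]
      · simp [legNode]
    · rw [update_leg_of_mem hnd (h.leg_mem hj hk), ih hj]

theorem nodup (h : Layout f₀ U R J f) : U.Nodup := by
  induction h with
  | nil => exact List.nodup_nil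
  | root _ hc ih => exact ih.append (List.nodup_singleton _) (List.disjoint_singleton.mpr hc)
  | leg _ _ hnd _ => exact hnd

theorem leg_notMem (h : Layout f₀ U R J f) (hnd : (U ++ [x, y, z]).Nodup) : (c, x, y, z) ∉ J :=
  fun hj => List.disjoint_of_nodup_append hnd (h.leg_mem hj (k := 0) (by simp)) (by simp [legNode])

theorem length_eq (h : Layout f₀ U R J f) : U.length = R.card + 3 * J.card := by
  induction h with
  | nil => simp
  | root h hc ih =>
    rw [List.length_append, ih, Finset.card_insert_of_notMem fun hcR => hc (h.root_mem hcR),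
      List.length_singleton]
    omega
  | leg h _ hnd ih =>
    rw [List.length_append, ih, Finset.card_insert_of_notMem (h.leg_notMem hnd)]
    simp only [List.length_cons, List.length_nil]
    omega

theorem legNumber_insert (h : Layout f₀ U R J f) (hnd : (U ++ [x, y, z]).Nodup) (d : ℕ) :
    legNumber (insert (c, x, y, z) J) d = legNumber J d + if c = d then 1 else 0 := by
  rw [legNumber, Finset.filter_insert, legNode]
  split_ifs
  · exact Finset.card_insert_of_notMem fun hj => h.leg_notMem hnd (Finset.mem_filter.mp hj).1
  · rfl

theorem legNumber_of_notMem (h : Layout f₀ U R J f) (hc : c ∉ U) : legNumber J c = 0 := by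
  rw [legNumber, Finset.card_eq_zero, Finset.filter_eq_empty_iff]
  rintro j hj rfl
  exact hc (h.root_mem (h.isLegFamily.root_mem j hj))

theorem gadgetWeight_root (h : Layout f₀ U R J f) (hc : c ∉ U) :
    gadgetWeight (insert c R) J = gadgetWeight R J + 1 := by
  rw [gadgetWeight, Finset.sum_insert fun hcR => hc (h.root_mem hcR), h.legNumber_of_notMem hc,
    pow_zero, add_comm, gadgetWeight]

theorem gadgetWeight_leg (h : Layout f₀ U R J f) (hc : c ∈ R) (hnd : (U ++ [x, y, z]).Nodup) :
    gadgetWeight R (insert (c, x, y, z) J) = gadgetWeight R J + 2 ^ legNumber J c := by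
  have hrest : ∑ d ∈ R.erase c, 2 ^ legNumber (insert (c, x, y, z) J) d =
      ∑ d ∈ R.erase c, 2 ^ legNumber J d :=
    Finset.sum_congr rfl fun d hd => by
      rw [h.legNumber_insert hnd, if_neg (Finset.ne_of_mem_erase hd).symm, add_zero]
  rw [gadgetWeight, gadgetWeight, ← Finset.add_sum_erase _ _ hc, hrest, h.legNumber_insert hnd,
    if_pos rfl, ← Finset.add_sum_erase R (fun d => 2 ^ legNumber J d) hc]
  ring

end Layout

theorem exists_append_singleton_prefix {α : Type*} {l L : List α} (h : l <+: L)
    (hl : l.length < L.length) : ∃ a, l ++ [a] <+: L :=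
  ⟨L[l.length], by simpa using List.concat_get_prefix h hl⟩

/-- A layout using the names from the front of `L`, when the weight `r` still has to be distributed
and at most `B` names may be used altogether. -/
structure PartialLayout (L : List ℕ) (f₀ : ℕ → ℤ) (B r : ℕ) (U : List ℕ) (R : Finset ℕ)
    (J : Finset (ℕ × ℕ × ℕ × ℕ)) (f : ℕ → ℤ) : Prop where
  layout : Layout f₀ U R J f
  prefix_names : U <+: L
  two_le_card : 2 ≤ R.card
  three_le_card : r = 0 → 3 ≤ R.card
  weight : gadgetWeight R J + r = L.length
  length_le : U.length + 2 * r.size ^ 2 ≤ B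

/-- The situation while legs are added to the last root `c`, which has `b` of them: the weight `r`
was left before `c` was placed, so that the weight `2 ^ b` of `c` counts twice. -/
structure OpenLayout (L : List ℕ) (f₀ : ℕ → ℤ) (B r c b : ℕ) (U : List ℕ) (R : Finset ℕ)
    (J : Finset (ℕ × ℕ × ℕ × ℕ)) (f : ℕ → ℤ) : Prop where
  layout : Layout f₀ U R J f
  prefix_names : U <+: L
  three_le_card : 3 ≤ R.card
  root_mem : c ∈ R
  legNumber_eq : legNumber J c = b
  pow_le : 2 ^ b ≤ r
  weight : gadgetWeight R J + r = L.length + 2 ^ b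
  length_le : U.length + 2 * r.size ^ 2 ≤ B + 1 + 3 * b

section PartialLayout

variable {L U : List ℕ} {f₀ f : ℕ → ℤ} {B r b c : ℕ} {R : Finset ℕ}
  {J : Finset (ℕ × ℕ × ℕ × ℕ)}

theorem PartialLayout.exists_root (h : PartialLayout L f₀ B r U R J f) (hL : L.Nodup)
    (hB : B ≤ L.length) (hr : 0 < r) :
    ∃ a, U ++ [a] <+: L ∧
      OpenLayout L f₀ B r a 0 (U ++ [a]) (insert a R) J (Function.update f a 0) := by
  have hsize : 0 < r.size ^ 2 := pow_pos (Nat.size_pos.mpr hr) 2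
  have hlen := h.length_le
  obtain ⟨a, ha⟩ := exists_append_singleton_prefix h.prefix_names (by omega)
  have haU : a ∉ U := (List.disjoint_of_nodup_append (hL.sublist ha.sublist)).symm (by simp)
  have hcard := Finset.card_insert_of_notMem fun haR => haU (h.layout.root_mem haR)
  have htwo := h.two_le_card
  have hweight := h.weight
  refine ⟨a, ha, h.layout.root haU, ha, by omega, Finset.mem_insert_self a R,
    h.layout.legNumber_of_notMem haU, hr, ?_,
    by rw [List.length_append, List.length_singleton]; omega⟩
  rw [h.layout.gadgetWeight_root haU, pow_zero]
  omega

theorem OpenLayout.exists_leg (h : OpenLayout L f₀ B r c b U R J f) (hL : L.Nodup)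
    (hB : B ≤ L.length) (hr : 2 ^ (b + 1) ≤ r) :
    ∃ x y z, U ++ [x, y, z] <+: L ∧ (c, x, y, z) ∉ J ∧
      OpenLayout L f₀ B r c (b + 1) (U ++ [x, y, z]) R (insert (c, x, y, z) J)
        (Function.update (Function.update (Function.update f x (c + 1)) y (x + 1)) z (y + 1)) := by
  have hsize : b + 1 < r.size := Nat.lt_size.mpr hr
  have hroom : U.length + 3 ≤ L.length := by
    have := h.length_le
    nlinarith
  obtain ⟨x, hx⟩ := exists_append_singleton_prefix h.prefix_names (by omega)
  obtain ⟨y, hy⟩ := exists_append_singleton_prefix hx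
    (by rw [List.length_append, List.length_singleton]; omega)
  obtain ⟨z, hz⟩ := exists_append_singleton_prefix hy
    (by simp only [List.length_append, List.length_singleton]; omega)
  have hxyz : U ++ [x, y, z] <+: L := by simpa using hz
  have hnd := hL.sublist hxyz.sublist
  have hnum := h.layout.legNumber_insert (c := c) hnd c
  have hweight := h.layout.gadgetWeight_leg h.root_mem hnd
  rw [if_pos rfl, h.legNumber_eq] at hnum
  rw [h.legNumber_eq] at hweight
  refine ⟨x, y, z, hxyz, h.layout.leg_notMem hnd, h.layout.leg h.root_mem hnd, hxyz,
    h.three_le_card, h.root_mem, hnum, hr, ?_, ?_⟩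
  · have := h.weight
    rw [hweight, pow_succ]
    omega
  · have := h.length_le
    simp only [List.length_append, List.length_cons, List.length_nil]
    omega

theorem OpenLayout.close (h : OpenLayout L f₀ B r c b U R J f) (hr : r < 2 ^ (b + 1)) :
    PartialLayout L f₀ B (r - 2 ^ b) U R J f where
  layout := h.layout
  prefix_names := h.prefix_names
  two_le_card := (Nat.le_succ 2).trans h.three_le_card
  three_le_card _ := h.three_le_card
  weight := by
    have := h.weight
    have := h.pow_le
    omega
  length_le := by
    have hrest : (r - 2 ^ b).size ≤ b := Nat.size_le.mpr (by rw [pow_succ] at hr; omega)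
    have hsize : b < r.size := Nat.lt_size.mpr h.pow_le
    have := h.length_le
    nlinarith

theorem two_mul_sq_le_two_pow {m : ℕ} (hm : 7 ≤ m) : 2 * (m + 1) ^ 2 ≤ 2 ^ m := by
  induction m, hm using Nat.le_induction with
  | base => norm_num
  | succ m hm ih =>
    rw [pow_succ 2 m]
    nlinarith

theorem two_add_size_le {n : ℕ} (hn : 128 ≤ n) : 2 + 2 * (n - 2).size ^ 2 ≤ n := by
  by_cases hsize : (n - 2).size ≤ 7
  · have := Nat.pow_le_pow_left hsize 2
    omega
  · obtain ⟨m, hm⟩ := Nat.exists_eq_succ_of_ne_zero (n := (n - 2).size) (by omega)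
    have hpow : 2 ^ m ≤ n - 2 := Nat.lt_size.mp (by omega)
    have hsq := two_mul_sq_le_two_pow (m := m) (by omega)
    rw [hm, Nat.succ_eq_add_one]
    omega

theorem PartialLayout.exists_two_roots (f₀ : ℕ → ℤ) (hL : L.Nodup) (hlen : 128 ≤ L.length) :
    ∃ a a', [a, a'] <+: L ∧
      PartialLayout L f₀ (2 + 2 * (L.length - 2).size ^ 2) (L.length - 2) [a, a'] {a', a} ∅
        (Function.update (Function.update f₀ a 0) a' 0) := by
  obtain ⟨a, ha⟩ := exists_append_singleton_prefix (l := []) (L := L)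
    List.nil_prefix (by rw [List.length_nil]; omega)
  obtain ⟨a', ha'⟩ := exists_append_singleton_prefix ha
    (by rw [List.nil_append, List.length_singleton]; omega)
  have hnotMem : a' ∉ [a] := (List.disjoint_of_nodup_append (hL.sublist ha'.sublist)).symm (by simp)
  have hcard : ({a', a} : Finset ℕ).card = 2 := Finset.card_pair (by simpa using hnotMem)
  refine ⟨a, a', ha', (Layout.nil.root (by simp)).root hnotMem, ha', hcard.ge, by omega, ?_, le_rfl⟩
  simp only [gadgetWeight, legNumber, Finset.filter_empty, Finset.card_empty, pow_zero,
    Finset.sum_const, hcard, smul_eq_mul, mul_one]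
  omega

end PartialLayout

/-- The word for a list of vertices. -/
def natWord (L : List ℕ) : List ℤ := L.map (fun a : ℕ => (a : ℤ)) ++ [-1]

theorem natWord_eq_flatMap (L : List ℕ) :
    natWord L = L.flatMap (fun a : ℕ => [(a : ℤ)]) ++ [-1] := by
  rw [natWord, List.map_eq_flatMap]

namespace RAM

variable {w : List ℤ}

theorem At.getD_of_prefix {i a : ℕ} {U L : List ℕ} (hat : At w i (natWord L))
    (h : U ++ [a] <+: L) : w.getD (i + U.length) 0 = a := by
  obtain ⟨rest, rfl⟩ := h
  have hat' : At w i (U.map (fun a : ℕ => (a : ℤ)) ++ ((a : ℤ) :: natWord rest)) := by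
    simpa [natWord] using hat
  simpa using hat'.right.getD

/-- Set the flags of all vertices of a list to `-1`. -/
def markAll : Cmd := foreach (block [.sub 4 0 2, .sub 4 4 3, .sub 12 0 3, .store 4 12])

/-- Take the next name as a root. -/
def placeRoot : Cmd := block [.load 9 7, .add 7 7 3, .sub 4 0 9, .sub 4 4 3, .store 4 0]

/-- Take the next name as the next vertex of a leg, its predecessor being in register `12`. -/
def placeNext : Cmd :=
  block [.load 2 7, .add 7 7 3, .sub 4 0 2, .sub 4 4 3, .add 12 12 3, .store 4 12, .add 12 2 0]

/-- Add one more leg to the current root, which doubles its weight in register `8`. -/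
def placeLeg : Cmd :=
  .seq (block [.add 8 8 8, .add 12 9 0]) (.seq placeNext (.seq placeNext (.seq placeNext
    (block [.add 10 10 3, .add 13 8 8, .sub 13 6 13, .add 13 13 3]))))

/-- Add legs to the current root as long as twice its weight does not exceed register `6`. -/
def placeLegs : Cmd := .whilePos 13 placeLeg

/-- Take the next name as a root of weight `1` to which legs are to be added. -/
def openRoot : Cmd :=
  .seq placeRoot (block [.add 8 3 0, .add 13 8 8, .sub 13 6 13, .add 13 13 3])

/-- Place roots greedily, each with as many legs as possible, until the weight in register `6` is
used up. -/
def placeRoots : Cmd := .whilePos 6 (.seq openRoot (.seq placeLegs (block [.sub 6 6 8])))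

/-- Lay out a gadget. The first two roots get no legs, so that there will be three of them. -/
def build : Cmd :=
  .seq (block [.add 7 5 0]) (.seq placeRoot (.seq placeRoot (.seq (block [.sub 6 6 3, .sub 6 6 3])
    placeRoots)))

variable {i t s r5 r6 r8 r9 r10 r11 r12 r13 : ℤ} {f : ℕ → ℤ} {o : List ℤ} {p : ℕ}

theorem halts_markAll {i : ℕ} {r7 : ℤ} {L : List ℕ} (hat : At w i (natWord L)) :
    Halts markAll (conf w i t s [r5, r6, r7, r8, r9, r10, r11, r12, r13] (fun _ => 0) o)
      (10 * L.length + 4) (ConfAt w (i + L.length : ℕ) fun l f o' => o' = o ∧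
        (∃ x, l = [r5, r6, r7, r8, r9, r10, r11, x, r13]) ∧
        f = fun a => if a ∈ L then -1 else 0) := by
  rw [natWord_eq_flatMap] at hat
  have h := Halts.foreach (t := t) (s := s) (f := fun _ => 0) (o := o)
    (l := [r5, r6, r7, r8, r9, r10, r11, r12, r13]) (K := 5) (hd := id) (tl := fun _ => [])
    (body := block [.sub 4 0 2, .sub 4 4 3, .sub 12 0 3, .store 4 12])
    (fun P l f o' => o' = o ∧ (∃ x, l = [r5, r6, r7, r8, r9, r10, r11, x, r13]) ∧
      f = fun a => if a ∈ P then -1 else 0) ?_ ⟨rfl, ⟨r12, rfl⟩, by simp⟩ hat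
  · simpa [markAll, ← List.map_eq_flatMap] using h
  · rintro P a i l _ _ ⟨rfl, ⟨x, rfl⟩, rfl⟩ -
    refine Halts.block (by simp [IsBasic]) ⟨a, -a - 1, [r5, r6, r7, r8, r9, r10, r11, -1, r13],
      Function.update (fun b => if b ∈ P then -1 else 0) a (-1), _, ?_, rfl, ⟨-1, rfl⟩, ?_⟩
    · rw [conf, conf, ← update_memOf]
      simp [step, update_regs, regs]
    · funext b
      by_cases hb : b = a <;> simp [hb]

theorem halts_placeRoot {r7 : ℤ} {a : ℕ} (hp : r7 = p) (h : w.getD p 0 = a) :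
    Halts placeRoot (conf w i t s [r5, r6, r7, r8, r9, r10, r11, r12, r13] f o) 6
      (· = conf w i t (-a - 1) [r5, r6, (p + 1 : ℕ), r8, a, r10, r11, r12, r13]
        (Function.update f a 0) o) := by
  have hload := memOf_natCast w f p
  rw [h] at hload
  refine Halts.block (by simp [IsBasic]) ?_
  rw [hp, conf, conf, ← update_memOf]
  simp [step, update_regs, regs, hload]

theorem halts_placeNext {a q : ℕ} (h : w.getD p 0 = a) :
    Halts placeNext (conf w i t s [r5, r6, p, r8, r9, r10, r11, q, r13] f o) 8
      (· = conf w i a (-a - 1) [r5, r6, (p + 1 : ℕ), r8, r9, r10, r11, a, r13]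
        (Function.update f a (q + 1)) o) := by
  have hload := memOf_natCast w f p
  rw [h] at hload
  refine Halts.block (by simp [IsBasic]) ?_
  rw [conf, conf, ← update_memOf]
  simp [step, update_regs, regs, hload]

theorem halts_placeLeg {c x y z : ℕ} (hx : w.getD p 0 = x) (hy : w.getD (p + 1) 0 = y)
    (hz : w.getD (p + 1 + 1) 0 = z) :
    Halts placeLeg (conf w i t s [r5, r6, p, r8, c, r10, r11, r12, r13] f o) 32
      (· = conf w i z (-z - 1) [r5, r6, (p + 1 + 1 + 1 : ℕ), r8 + r8, c, r10 + 1, r11, z,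
        r6 - (r8 + r8 + (r8 + r8)) + 1]
        (Function.update (Function.update (Function.update f x (c + 1)) y (x + 1)) z (y + 1))
        o) := by
  have hstart : Halts (block [.add 8 8 8, .add 12 9 0])
      (conf w i t s [r5, r6, p, r8, c, r10, r11, r12, r13] f o) 3
      (· = conf w i t s [r5, r6, p, r8 + r8, c, r10, r11, c, r13] f o) :=
    Halts.block (by simp [IsBasic]) (by simp [step, conf, update_regs, regs])
  exact hstart.seq_eq <| (halts_placeNext hx).seq_eq <| (halts_placeNext hy).seq_eq <|
    (halts_placeNext hz).seq_eq <|
      Halts.block (by simp [IsBasic]) (by simp [step, conf, update_regs, regs])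

section Greedy

variable {L U : List ℕ} {f₀ : ℕ → ℤ} {B c₀ r c b : ℕ} {R : Finset ℕ} {J : Finset (ℕ × ℕ × ℕ × ℕ)}
  {k : ℤ} {l : List ℤ}

/-- The registers and flags while legs are added to the root `c`. Register `13` is positive if
another leg does not exceed the remaining weight. -/
def OpenRegs (L : List ℕ) (f₀ : ℕ → ℤ) (B c₀ : ℕ) (k : ℤ) (r : ℕ) (R : Finset ℕ) (c b : ℕ)
    (l : List ℤ) (f : ℕ → ℤ) : Prop :=
  ∃ (x : ℤ) (U : List ℕ) (J : Finset (ℕ × ℕ × ℕ × ℕ)), OpenLayout L f₀ B r c b U R J f ∧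
    l = [(c₀ : ℤ), (r : ℤ), (c₀ + U.length : ℕ), 2 ^ b, (c : ℤ), (J.card : ℤ), k, x,
      r - (2 ^ b + 2 ^ b) + 1]

/-- The registers and flags while no root is open and the weight `r` remains. -/
def PartialRegs (L : List ℕ) (f₀ : ℕ → ℤ) (B c₀ : ℕ) (k : ℤ) (r : ℕ) (l : List ℤ) (f : ℕ → ℤ) :
    Prop :=
  ∃ (q c x y : ℤ) (U : List ℕ) (R : Finset ℕ) (J : Finset (ℕ × ℕ × ℕ × ℕ)),
    PartialLayout L f₀ B r U R J f ∧
      l = [(c₀ : ℤ), (r : ℤ), (c₀ + U.length : ℕ), q, c, (J.card : ℤ), k, x, y]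

theorem halts_placeLeg_of_openRegs (hat : At w c₀ (natWord L)) (hL : L.Nodup) (hB : B ≤ L.length)
    (h : OpenRegs L f₀ B c₀ k r R c b l f) (hr : 2 ^ (b + 1) ≤ r) :
    Halts placeLeg (conf w i t s l f o) 32 (ConfAt w i fun l f o' =>
      o' = o ∧ OpenRegs L f₀ B c₀ k r R c (b + 1) l f) := by
  obtain ⟨x₀, U, J, hlayout, rfl⟩ := h
  obtain ⟨x, y, z, hxyz, hnotMem, hlayout'⟩ := hlayout.exists_leg hL hB hr
  have hx := hat.getD_of_prefix (U := U) (a := x) ((by simp : _ <+: U ++ [x, y, z]).trans hxyz)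
  have hy := hat.getD_of_prefix (U := U ++ [x]) (a := y)
    ((by simp : _ <+: U ++ [x, y, z]).trans hxyz)
  have hz := hat.getD_of_prefix (U := U ++ [x, y]) (a := z) (by simpa using hxyz)
  refine (halts_placeLeg hx (by simpa [Nat.add_assoc] using hy)
    (by simpa [Nat.add_assoc] using hz)).mono le_rfl ?_
  rintro _ rfl
  refine ⟨_, _, _, _, _, rfl, rfl, z, _, _, hlayout', ?_⟩
  simp [Finset.card_insert_of_notMem hnotMem, pow_succ, mul_two, Nat.add_assoc]

theorem halts_placeLegs (hat : At w c₀ (natWord L)) (hL : L.Nodup) (hB : B ≤ L.length)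
    (h : OpenRegs L f₀ B c₀ k r R c b l f) :
    Halts placeLegs (conf w i t s l f o) (33 * r + 1) (ConfAt w i fun l f o' =>
      o' = o ∧ ∃ b, OpenRegs L f₀ B c₀ k r R c b l f ∧ r < 2 ^ (b + 1)) := by
  refine (Halts.whilePos (K := 32) (fun m τ => ∃ b, m = r - 2 ^ b ∧ ConfAt w i (fun l f o' =>
    o' = o ∧ OpenRegs L f₀ B c₀ k r R c b l f) τ) ?_ ⟨b, rfl, t, s, l, f, o, rfl, rfl, h⟩).mono
    (by gcongr; exact Nat.sub_le r _) ?_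
  · rintro m σ ⟨b, rfl, t, s, l, f, _, rfl, rfl, h⟩ hpos
    have hr : 2 ^ (b + 1) ≤ r := by
      obtain ⟨x, U, J, -, rfl⟩ := h
      have hpos : (0 : ℤ) < r - (2 ^ b + 2 ^ b) + 1 := hpos
      rw [pow_succ]
      zify
      omega
    have hlt : 2 ^ b < 2 ^ (b + 1) := Nat.pow_lt_pow_succ one_lt_two
    exact (halts_placeLeg_of_openRegs hat hL hB h hr).mono le_rfl
      fun τ hτ => ⟨r - 2 ^ (b + 1), by omega, b + 1, rfl, hτ⟩
  · rintro _ ⟨⟨m, b, -, t, s, l, f, _, rfl, rfl, h⟩, hneg⟩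
    refine ⟨t, s, l, f, _, rfl, rfl, b, h, ?_⟩
    obtain ⟨x, U, J, -, rfl⟩ := h
    have hneg : ¬ (0 : ℤ) < r - (2 ^ b + 2 ^ b) + 1 := hneg
    rw [pow_succ]
    zify
    omega

theorem halts_openRoot (hat : At w c₀ (natWord L)) (hL : L.Nodup) (hB : B ≤ L.length)
    (h : PartialRegs L f₀ B c₀ k r l f) (hr : 0 < r) :
    Halts openRoot (conf w i t s l f o) 11 (ConfAt w i fun l f o' =>
        o' = o ∧ ∃ R c, OpenRegs L f₀ B c₀ k r R c 0 l f) := by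
  obtain ⟨q, c, x, y, U, R, J, hlayout, rfl⟩ := h
  obtain ⟨a, ha, hlayout'⟩ := hlayout.exists_root hL hB hr
  refine (halts_placeRoot rfl (hat.getD_of_prefix ha)).seq_eq (Halts.block (by simp [IsBasic]) ?_)
  refine ⟨t, -a - 1, _, Function.update f a 0, o, ?_, rfl, _, a, x, _, _, hlayout', rfl⟩
  simp [step, conf, update_regs, regs, Int.add_assoc]

theorem halts_placeRoot_legs (hat : At w c₀ (natWord L)) (hL : L.Nodup) (hB : B ≤ L.length)
    (h : PartialRegs L f₀ B c₀ k r l f) (hr : 0 < r) :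
    Halts (.seq openRoot (.seq placeLegs (block [.sub 6 6 8]))) (conf w i t s l f o) (33 * r + 14)
      fun τ => ∃ r' < r, ConfAt w i (fun l f o' => o' = o ∧ PartialRegs L f₀ B c₀ k r' l f) τ := by
  refine ((halts_openRoot hat hL hB h hr).seq (n := 33 * r + 1 + 2) ?_).mono_time (by omega)
  rintro _ ⟨t, s, l, f, _, rfl, rfl, R, c, hopen⟩
  refine (halts_placeLegs hat hL hB hopen).seq ?_
  rintro _ ⟨t, s, l, f, _, rfl, rfl, b, ⟨x, U, J, hlayout, rfl⟩, hb⟩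
  have hle := hlayout.pow_le
  refine Halts.block (by simp [IsBasic]) ⟨r - 2 ^ b, Nat.sub_lt hr (by positivity), t, s, _, f, _,
    ?_, rfl, 2 ^ b, c, x, r - (2 ^ b + 2 ^ b) + 1, U, R, J, hlayout.close hb, rfl⟩
  simp [step, conf, update_regs, regs, Nat.cast_sub hle]

theorem halts_placeRoots (hat : At w c₀ (natWord L)) (hL : L.Nodup) (hB : B ≤ L.length)
    (h : PartialRegs L f₀ B c₀ k r l f) :
    Halts placeRoots (conf w i t s l f o) ((33 * r + 15) * r + 1) (ConfAt w i fun l f o' =>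
      o' = o ∧ PartialRegs L f₀ B c₀ k 0 l f) := by
  refine (Halts.whilePos (K := 33 * r + 14) (fun m τ => m ≤ r ∧ ConfAt w i (fun l f o' =>
    o' = o ∧ PartialRegs L f₀ B c₀ k m l f) τ) ?_ ⟨le_rfl, t, s, l, f, o, rfl, rfl, h⟩).mono
    le_rfl ?_
  · rintro m σ ⟨hm, t, s, l, f, _, rfl, rfl, h⟩ hpos
    have hpos : 0 < m := by
      obtain ⟨q, c, x, y, U, R, J, -, rfl⟩ := h
      exact Int.natCast_pos.mp hpos
    exact (halts_placeRoot_legs hat hL hB h hpos).mono (by gcongr)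
      fun τ ⟨m', hm', hτ⟩ => ⟨m', hm', hm'.le.trans hm, hτ⟩
  · rintro _ ⟨⟨m, -, t, s, l, f, _, rfl, rfl, h⟩, hneg⟩
    obtain rfl : m = 0 := by
      obtain ⟨q, c, x, y, U, R, J, -, rfl⟩ := h
      exact Nat.eq_zero_of_not_pos fun hm => hneg (Int.natCast_pos.mpr hm)
    exact ⟨t, s, l, f, _, rfl, rfl, h⟩

theorem halts_build (hat : At w c₀ (natWord L)) (hL : L.Nodup) (hlen : 128 ≤ L.length) {r7 : ℤ} :
    Halts build (conf w i t s [c₀, L.length, r7, r8, r9, 0, k, r12, r13] f₀ o)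
      ((33 * L.length + 15) * L.length + 18) (ConfAt w i fun l f o' => o' = o ∧
        PartialRegs L f₀ (2 + 2 * (L.length - 2).size ^ 2) c₀ k 0 l f) := by
  obtain ⟨a, a', hpre, hlayout⟩ := PartialLayout.exists_two_roots f₀ hL hlen
  have ha := hat.getD_of_prefix (U := []) (a := a) ((by simp : _ <+: [a, a']).trans hpre)
  have ha' := hat.getD_of_prefix (U := [a]) (a := a') hpre
  have hstart : Halts (block [.add 7 5 0])
      (conf w i t s [c₀, L.length, r7, r8, r9, 0, k, r12, r13] f₀ o) 2
      (· = conf w i t s [c₀, L.length, c₀, r8, r9, 0, k, r12, r13] f₀ o) :=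
    Halts.block (by simp [IsBasic]) (by simp [step, conf, update_regs, regs])
  have hweight : Halts (block [.sub 6 6 3, .sub 6 6 3])
      (conf w i t (-a' - 1) [c₀, L.length, (c₀ + 2 : ℕ), r8, a', 0, k, r12, r13]
        (Function.update (Function.update f₀ a 0) a' 0) o) 3
      (· = conf w i t (-a' - 1) [c₀, (L.length - 2 : ℕ), (c₀ + 2 : ℕ), r8, a', 0, k, r12, r13]
        (Function.update (Function.update f₀ a 0) a' 0) o) := by
    refine Halts.block (by simp [IsBasic]) ?_
    simp [step, conf, update_regs, regs, Nat.cast_sub (by omega : 2 ≤ L.length), Int.sub_sub]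
  have hrun := hstart.seq_eq <| (halts_placeRoot rfl ha).seq_eq <|
    (halts_placeRoot rfl ha').seq_eq <| hweight.seq_eq <|
      halts_placeRoots hat hL (two_add_size_le hlen)
        ⟨r8, a', r12, r13, [a, a'], {a', a}, ∅, hlayout, rfl⟩
  refine hrun.mono_time ?_
  have hle : (33 * (L.length - 2) + 15) * (L.length - 2) ≤ (33 * L.length + 15) * L.length := by
    gcongr <;> exact Nat.sub_le _ _
  omega

end Greedy

end RAM

/-! ### The kernelization program -/

theorem length_natWord (L : List ℕ) : (natWord L).length = L.length + 1 := by simp [natWord]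

/-- The two ends of an edge, written down. -/
def ends (p : ℕ × ℕ) : List ℤ := [(p.1 : ℤ), (p.2 : ℤ)]

/-- The word for a list of edges. -/
def edgeWord (E : List (ℕ × ℕ)) : List ℤ := E.flatMap ends ++ [-1]

theorem edgeWord_eq_natWord (E : List (ℕ × ℕ)) :
    edgeWord E = natWord (E.flatMap fun p => [p.1, p.2]) := by
  rw [edgeWord, natWord, List.map_flatMap]
  rfl

theorem length_edgeWord (E : List (ℕ × ℕ)) : (edgeWord E).length = 2 * E.length + 1 := by
  simp [edgeWord, ends, List.length_flatMap, mul_comm]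

/-- The input word for the vertices `V` and edges `E` of a graph, the wide diamond `C`, and the
bound `k`. -/
def inputWord (V : List ℕ) (E : List (ℕ × ℕ)) (C : List ℕ) (k : ℤ) : List ℤ :=
  natWord V ++ edgeWord E ++ natWord C ++ [k]

theorem flatMap_ite_nil {α β : Type*} (p : α → Prop) [DecidablePred p] (g : α → List β)
    (L : List α) : (L.flatMap fun a => if p a then g a else []) = (L.filter p).flatMap g := by
  induction L with
  | nil => rfl
  | cons a L ih => by_cases h : p a <;> simp [h, ih]

namespace RAM

section Phases

variable {V C : List ℕ} {E : List (ℕ × ℕ)} {k : ℤ}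

theorem at_vertices : At (inputWord V E C k) 0 (natWord V) := (At.self _).left.left.left

theorem at_edges : At (inputWord V E C k) (V.length + 1) (edgeWord E) := by
  simpa [length_natWord] using (At.self (inputWord V E C k)).left.left.right

theorem at_diamond :
    At (inputWord V E C k) (V.length + 1 + (2 * E.length + 1)) (natWord C) := by
  simpa [length_natWord, length_edgeWord] using (At.self (inputWord V E C k)).left.right

theorem at_bound :
    At (inputWord V E C k) (V.length + 1 + (2 * E.length + 1) + (C.length + 1)) [k] := by
  simpa [length_natWord, length_edgeWord, Nat.add_assoc] using
    (At.self (inputWord V E C k)).right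

theorem length_inputWord : (inputWord V E C k).length =
    V.length + 1 + (2 * E.length + 1) + (C.length + 1) + 1 := by
  simp only [inputWord, List.length_append, length_natWord, length_edgeWord, List.length_singleton]

/-- Move the reading head past a list in memory. -/
def skipList : Cmd := .seq (foreach .skip) (block [.add 1 1 3])

/-- Find the wide diamond, put its position and its length into registers `5` and `6`, and read the
bound into register `11`. -/
def locate : Cmd :=
  .seq (block [.const 0 0, .const 3 1, .const 1 0]) (.seq skipList (.seq skipList
    (.seq (block [.add 5 1 0]) (.seq skipList (block [.sub 6 1 5, .sub 6 6 3, .load 11 1])))))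

/-- Load the flag of the vertex in register `2` into register `4`. -/
def loadFlag : Cmd := block [.sub 4 0 2, .sub 4 4 3, .load 4 4]

/-- Write `-1`. -/
def writeEnd : Cmd := block [.sub 4 0 3, .write 4]

/-- Print the vertices whose flag is not negative. -/
def printVerts : Cmd :=
  .seq (block [.const 1 0]) (.seq (foreach (.seq loadFlag (.seq (block [.add 4 4 3])
    (.ifPos 4 (block [.write 2]) .skip)))) (.seq writeEnd (block [.add 1 1 3])))

/-- Print the edge in registers `2` and `12` if both flags, in registers `4` and `13`, are `0`. -/
def printUnflagged : Cmd :=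
  .ifPos 4 .skip (.ifPos 13 .skip (.seq (block [.add 4 4 13, .sub 4 0 4])
    (.ifPos 4 .skip (block [.write 2, .write 12]))))

/-- Print the edges whose two ends have flag `0`. -/
def printEdges : Cmd :=
  foreach (.seq loadFlag (.seq (block [.add 1 1 3, .load 12 1, .sub 13 0 12, .sub 13 13 3,
    .load 13 13]) printUnflagged))

/-- Print the edges of the legs, and the bound increased by the number of legs. -/
def printLegs : Cmd :=
  .seq (block [.add 1 5 0]) (.seq (foreach (.seq loadFlag
    (.ifPos 4 (block [.sub 4 4 3, .write 2, .write 4]) .skip)))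
    (.seq writeEnd (block [.add 11 11 10, .write 11])))

variable {w : List ℤ} {i : ℕ} {t s r5 r6 r7 r8 r9 r10 r11 r12 r13 : ℤ} {l : List ℤ} {f : ℕ → ℤ}
  {o : List ℤ}

theorem halts_skipList {L : List ℕ} (hat : At w i (natWord L)) :
    Halts skipList (conf w i t s l f o) (6 * L.length + 6) fun τ => ∃ t s,
      τ = conf w (i + (L.length + 1) : ℕ) t s l f o := by
  rw [natWord_eq_flatMap] at hat
  refine (Halts.foreach_print (hd := id) (tl := fun _ => []) (K := 1) (· = l) (fun _ => [])
    ?_ rfl hat).seq (n := 2) ?_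
  · rintro a i _ o rfl -
    exact Halts.skip ⟨a, a + 1, _, f, o, rfl, rfl, rfl, by simp⟩
  · rintro _ ⟨t, s, _, _, _, rfl, rfl, rfl, rfl⟩
    refine Halts.block (by simp [IsBasic]) ⟨t, s, ?_⟩
    simp [step, conf, update_regs, regs, Int.add_assoc]

theorem halts_locate :
    Halts locate (init (inputWord V E C k)) (6 * (inputWord V E C k).length + 4) fun τ =>
      ∃ i t s : ℤ, τ = conf (inputWord V E C k) i t s
        [(V.length + 1 + (2 * E.length + 1) : ℕ), C.length, 0, 0, 0, 0, k, 0, 0]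
        (fun _ => 0) [] := by
  have hstart : Halts (block [.const 0 0, .const 3 1, .const 1 0]) (init (inputWord V E C k)) 4
      (· = conf (inputWord V E C k) (0 : ℕ) 0 0 [0, 0, 0, 0, 0, 0, 0, 0, 0] (fun _ => 0) []) := by
    rw [init_eq]
    exact Halts.block (by simp [IsBasic]) (by simp [step, conf, update_regs])
  have hEdges := at_edges (V := V) (E := E) (C := C) (k := k)
  rw [edgeWord_eq_natWord] at hEdges
  have hlen : (E.flatMap fun p => [p.1, p.2]).length = 2 * E.length := by
    simp [List.length_flatMap, mul_comm]
  refine (hstart.seq_eq <| (halts_skipList at_vertices).seq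
    (n := (6 * (2 * E.length) + 6) + (2 + (6 * C.length + 6 + 4))) ?_).mono_time
    (by rw [length_inputWord]; omega)
  rintro _ ⟨t, s, rfl⟩
  rw [← hlen]
  refine (halts_skipList (by rwa [Nat.zero_add])).seq ?_
  rintro _ ⟨t, s, rfl⟩
  rw [hlen, Nat.zero_add]
  refine Halts.seq_eq (m := 2) (τ := conf (inputWord V E C k)
    (V.length + 1 + (2 * E.length + 1) : ℕ) t s
    [(V.length + 1 + (2 * E.length + 1) : ℕ), 0, 0, 0, 0, 0, 0, 0, 0] (fun _ => 0) [])
    (Halts.block (by simp [IsBasic]) (by simp [step, conf, update_regs, regs])) ?_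
  refine (halts_skipList at_diamond).seq ?_
  rintro _ ⟨t, s, rfl⟩
  have hload := memOf_natCast (inputWord V E C k) (fun _ => 0)
    (V.length + 1 + (2 * E.length + 1) + (C.length + 1))
  rw [at_bound.getD] at hload
  refine Halts.block (by simp [IsBasic])
    ⟨(V.length + 1 + (2 * E.length + 1) + (C.length + 1) : ℕ), t, s, ?_⟩
  push_cast at hload
  simp [step, conf, update_regs, regs, hload]

theorem halts_loadFlag {i : ℤ} {a : ℕ} :
    Halts loadFlag (conf w i a s l f o) 4 (· = conf w i a (f a) l f o) :=
  Halts.block (by simp [IsBasic]) (by simp [step, conf, update_regs, regs, memOf_neg])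

theorem halts_writeEnd {i : ℤ} :
    Halts writeEnd (conf w i t s l f o) 3 (· = conf w i t (-1) l f (o ++ [-1])) :=
  Halts.block (by simp [IsBasic]) (by simp [step, conf, update_regs, regs])

theorem halts_printVerts {i : ℤ} {L : List ℕ} (hat : At w 0 (natWord L)) :
    Halts printVerts (conf w i t s l f o) (14 * L.length + 11) fun τ => ∃ t s,
      τ = conf w (L.length + 1 : ℕ) t s l f (o ++ natWord (L.filter fun a => 0 ≤ f a)) := by
  rw [natWord_eq_flatMap] at hat
  have hstart : Halts (block [.const 1 0]) (conf w i t s l f o) 2 (· = conf w (0 : ℕ) t s l f o) :=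
    Halts.block (by simp [IsBasic]) (by simp [step, conf, update_regs])
  refine (hstart.seq_eq <| (Halts.foreach_print (hd := id) (tl := fun _ => []) (K := 9) (· = l)
    (fun a => if 0 ≤ f a then [(a : ℤ)] else []) ?_ rfl hat).seq (n := 3 + 2)
    ?_).mono_time (by omega)
  · rintro a i l o rfl -
    refine halts_loadFlag.seq_eq (Halts.seq_eq (m := 2) (n := 3) (τ := conf w i a (f a + 1) l f o)
      (Halts.block (by simp [IsBasic]) (by simp [step, conf, update_regs, regs])) ?_)
    refine Halts.ifPos (n := 2) (fun hpos => ?_) fun hpos => ?_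
    · have hpos : 0 ≤ f a := Int.lt_add_one_iff.mp hpos
      refine Halts.block (by simp [IsBasic]) ⟨a, f a + 1, _, f, _, ?_, rfl, rfl, rfl⟩
      simp [step, conf, regs, hpos]
    · have hneg : ¬ 0 ≤ f a := fun h => hpos (Int.lt_add_one_iff.mpr h)
      exact (Halts.skip ⟨a, f a + 1, _, f, o, rfl, rfl, rfl, by simp [hneg]⟩).mono_time one_le_two
  · rintro _ ⟨t, s, _, _, _, rfl, rfl, rfl, rfl⟩
    refine halts_writeEnd.seq_eq (Halts.block (by simp [IsBasic]) ⟨t, -1, ?_⟩)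
    simp [step, conf, update_regs, regs, flatMap_ite_nil, natWord_eq_flatMap]

theorem halts_printUnflagged {i x y : ℤ} :
    Halts printUnflagged (conf w i x s [r5, r6, r7, r8, r9, r10, r11, y, r13] f o) 9
      (ConfAt w i fun l f' o' => l = [r5, r6, r7, r8, r9, r10, r11, y, r13] ∧ f' = f ∧
        o' = o ++ if s = 0 ∧ r13 = 0 then [x, y] else []) := by
  have hskip {s' : ℤ} (h : ¬ (s = 0 ∧ r13 = 0)) : Halts .skip
      (conf w i x s' [r5, r6, r7, r8, r9, r10, r11, y, r13] f o) 1
      (ConfAt w i fun l f' o' => l = [r5, r6, r7, r8, r9, r10, r11, y, r13] ∧ f' = f ∧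
        o' = o ++ if s = 0 ∧ r13 = 0 then [x, y] else []) :=
    Halts.skip ⟨x, s', _, f, o, rfl, rfl, rfl, by simp [h]⟩
  refine Halts.ifPos (n := 8) (fun (hs : 0 < s) => ?_) fun (hs : ¬ 0 < s) => ?_
  · exact (hskip (by omega)).mono_time (by norm_num)
  refine Halts.ifPos (n := 7) (fun (hr : 0 < r13) => ?_) fun (hr : ¬ 0 < r13) => ?_
  · exact (hskip (by omega)).mono_time (by norm_num)
  refine Halts.seq_eq (m := 3) (n := 4)
    (τ := conf w i x (-(s + r13)) [r5, r6, r7, r8, r9, r10, r11, y, r13] f o)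
    (Halts.block (by simp [IsBasic]) (by simp [step, conf, update_regs, regs])) ?_
  refine Halts.ifPos (n := 3) (fun (hneg : 0 < -(s + r13)) => ?_)
    fun (hneg : ¬ 0 < -(s + r13)) => ?_
  · exact (hskip (by omega)).mono_time (by norm_num)
  · obtain ⟨rfl, rfl⟩ : s = 0 ∧ r13 = 0 := by omega
    refine Halts.block (by simp [IsBasic]) ⟨x, -(0 + 0), _, f, _, ?_, rfl, rfl, rfl⟩
    simp [step, conf, regs]

theorem halts_printEdges {L : List (ℕ × ℕ)} (hat : At w i (edgeWord L)) :
    Halts printEdges (conf w i t s [r5, r6, r7, r8, r9, r10, r11, r12, r13] f o) (24 * L.length + 4)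
      fun τ => ∃ i t s r12 r13 : ℤ, τ = conf w i t s [r5, r6, r7, r8, r9, r10, r11, r12, r13] f
        (o ++ (L.filter fun p => f p.1 = 0 ∧ f p.2 = 0).flatMap ends) := by
  refine (Halts.foreach_print (hd := Prod.fst) (tl := fun p : ℕ × ℕ => [(p.2 : ℤ)]) (K := 19)
    (fun l => ∃ r12 r13, l = [r5, r6, r7, r8, r9, r10, r11, r12, r13])
    (fun p => if f p.1 = 0 ∧ f p.2 = 0 then ends p else []) ?_ ⟨r12, r13, rfl⟩ hat).mono le_rfl ?_
  · rintro ⟨a, b⟩ i _ o ⟨r12, r13, rfl⟩ hat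
    have hload : memOf w f ((i : ℤ) + 1) = b :=
      mod_cast (memOf_natCast w f (i + 1)).trans (At.right (l := [(a : ℤ)]) hat).getD
    refine halts_loadFlag.seq_eq (Halts.seq_eq (m := 6) (n := 9)
      (τ := conf w (i + 1 : ℕ) a (f a) [r5, r6, r7, r8, r9, r10, r11, b, f b] f o)
      (Halts.block (by simp [IsBasic]) ?_) ?_)
    · simp [step, conf, update_regs, regs, memOf_neg, hload]
    · refine halts_printUnflagged.mono le_rfl ?_
      rintro _ ⟨t, s, _, _, _, rfl, rfl, rfl, rfl⟩
      exact ⟨t, s, _, _, _, rfl, ⟨b, _, rfl⟩, rfl, rfl⟩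
  · rintro _ ⟨t, s, _, _, _, rfl, ⟨r12, r13, rfl⟩, rfl, rfl⟩
    exact ⟨_, t, s, r12, r13, by rw [flatMap_ite_nil]⟩

/-- The edge from a vertex of a leg to its predecessor. -/
def parentEdge (f : ℕ → ℤ) (a : ℕ) : ℕ × ℕ := (a, (f a - 1).toNat)

theorem halts_printLegs {c₀ : ℕ} {i : ℤ} {L : List ℕ} (hat : At w c₀ (natWord L)) :
    Halts printLegs (conf w i t s [c₀, r6, r7, r8, r9, r10, r11, r12, r13] f o) (14 * L.length + 12)
      fun τ => τ.out = o ++ edgeWord ((L.filter fun a => 0 < f a).map (parentEdge f)) ++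
        [r11 + r10] := by
  rw [natWord_eq_flatMap] at hat
  have hstart : Halts (block [.add 1 5 0])
      (conf w i t s [c₀, r6, r7, r8, r9, r10, r11, r12, r13] f o) 2
      (· = conf w c₀ t s [c₀, r6, r7, r8, r9, r10, r11, r12, r13] f o) :=
    Halts.block (by simp [IsBasic]) (by simp [step, conf, update_regs, regs])
  refine (hstart.seq_eq <| (Halts.foreach_print (hd := id) (tl := fun _ => []) (K := 9)
    (· = [(c₀ : ℤ), r6, r7, r8, r9, r10, r11, r12, r13])
    (fun a => if 0 < f a then ends (parentEdge f a) else []) ?_ rfl hat).seq (n := 3 + 3)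
    ?_).mono_time (by omega)
  · rintro a i _ o rfl -
    refine halts_loadFlag.seq_eq (n := 5) ?_
    refine Halts.ifPos (n := 4) (fun (hpos : 0 < f a) => ?_) fun (hpos : ¬ 0 < f a) => ?_
    · refine Halts.block (by simp [IsBasic]) ⟨a, f a - 1, _, f, _, ?_, rfl, rfl, rfl⟩
      simp [step, conf, update_regs, regs, hpos, ends, parentEdge]
    · exact (Halts.skip ⟨a, f a, _, f, o, rfl, rfl, rfl, by simp [hpos]⟩).mono_time (by norm_num)
  · rintro _ ⟨t, s, _, _, _, rfl, rfl, rfl, rfl⟩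
    refine halts_writeEnd.seq_eq (Halts.block (by simp [IsBasic]) ?_)
    simp [step, conf, update_regs, regs, flatMap_ite_nil, edgeWord, List.flatMap_map]

end Phases

section Program

/-- Lay out a gadget on the names of the wide diamond if it has at least `128` vertices. -/
def plan : Cmd :=
  .seq (block [.const 2 127, .sub 2 6 2])
    (.ifPos 2 (.seq (block [.add 1 5 0]) (.seq markAll build)) .skip)

/-- Print the graph in which the gadget that has been laid out replaces the wide diamond, and the
new bound. -/
def print : Cmd := .seq printVerts (.seq printEdges printLegs)

/-- The kernelization program. -/
def program : Cmd := .seq locate (.seq plan print)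

/-- The legs and flags that describe the output: nothing happens to a wide diamond with fewer than
`128` vertices, and any other one is replaced by a gadget. -/
def IsPlan (C : List ℕ) (J : Finset (ℕ × ℕ × ℕ × ℕ)) (f : ℕ → ℤ) : Prop :=
  C.length < 128 ∧ J = ∅ ∧ f = (fun _ => 0) ∨ 128 ≤ C.length ∧ ∃ U R,
    PartialLayout C (fun a => if a ∈ C then -1 else 0) (2 + 2 * (C.length - 2).size ^ 2) 0 U R J f

/-- The registers and flags when the output has been planned. -/
def PlanRegs (C : List ℕ) (c₀ : ℕ) (k : ℤ) (l : List ℤ) (f : ℕ → ℤ) : Prop :=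
  ∃ (r6 r7 r8 r9 r12 r13 : ℤ) (J : Finset (ℕ × ℕ × ℕ × ℕ)), IsPlan C J f ∧
    l = [(c₀ : ℤ), r6, r7, r8, r9, (J.card : ℤ), k, r12, r13]

/-- The edges printed for the flags `f`: the edges of the input graph between vertices that are not
deleted, and the edges of the legs. -/
def outputEdges (E : List (ℕ × ℕ)) (C : List ℕ) (f : ℕ → ℤ) : List (ℕ × ℕ) :=
  (E.filter fun p => f p.1 = 0 ∧ f p.2 = 0) ++ (C.filter fun a => 0 < f a).map (parentEdge f)

/-- The word printed for the flags `f` and the bound `k`. -/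
def outputWord (V : List ℕ) (E : List (ℕ × ℕ)) (C : List ℕ) (f : ℕ → ℤ) (k : ℤ) : List ℤ :=
  natWord (V.filter fun a => 0 ≤ f a) ++ edgeWord (outputEdges E C f) ++ [k]

variable {w : List ℤ} {V C : List ℕ} {E : List (ℕ × ℕ)} {k i t s : ℤ} {l : List ℤ} {f : ℕ → ℤ}
  {c₀ : ℕ}

theorem outputWord_zero :
    outputWord V E C (fun _ => 0) k = natWord V ++ edgeWord E ++ [k] := by
  simp [outputWord, outputEdges]

theorem halts_plan {o : List ℤ} (hat : At w c₀ (natWord C)) (hC : C.Nodup) :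
    Halts plan (conf w i t s [c₀, C.length, 0, 0, 0, 0, k, 0, 0] (fun _ => 0) o)
      ((33 * C.length + 25) * C.length + 28)
      fun τ => ∃ i, ConfAt w i (fun l f o' => o' = o ∧ PlanRegs C c₀ k l f) τ := by
  refine Halts.mono_time (Halts.seq_eq (m := 3)
    (τ := conf w i (C.length - 127) s [c₀, C.length, 0, 0, 0, 0, k, 0, 0] (fun _ => 0) o)
    (Halts.block (by simp [IsBasic]) (by simp [step, conf, update_regs, regs]))
    (Halts.ifPos (n := 2 + (10 * C.length + 4 + ((33 * C.length + 15) * C.length + 18)))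
      (fun (hlen : (0 : ℤ) < C.length - 127) => ?_)
      fun (hlen : ¬ (0 : ℤ) < C.length - 127) => ?_)) (by linarith)
  · refine Halts.seq_eq (τ := conf w c₀ (C.length - 127) s
      [c₀, C.length, 0, 0, 0, 0, k, 0, 0] (fun _ => 0) o)
      (Halts.block (by simp [IsBasic]) (by simp [step, conf, update_regs, regs]))
      ((halts_markAll hat).seq ?_)
    rintro _ ⟨t, s, _, _, _, rfl, rfl, ⟨x, rfl⟩, rfl⟩
    refine (halts_build hat hC (by omega)).mono le_rfl ?_
    rintro _ ⟨t, s, _, f, _, rfl, rfl, q, c, y, z, U, R, J, hlayout, rfl⟩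
    exact ⟨_, t, s, _, f, _, rfl, rfl, _, _, _, _, _, _, J,
      Or.inr ⟨by omega, U, R, hlayout⟩, rfl⟩
  · exact (Halts.skip ⟨i, _, s, _, _, o, rfl, rfl, _, _, _, _, _, _, ∅,
      Or.inl ⟨by omega, rfl, rfl⟩, rfl⟩).mono_time (by omega)

theorem halts_print (hV : At w 0 (natWord V)) (hE : At w (V.length + 1) (edgeWord E))
    (hC : At w c₀ (natWord C)) (h : PlanRegs C c₀ k l f) :
    Halts print (conf w i t s l f [])
      (14 * V.length + 11 + (24 * E.length + 4 + (14 * C.length + 12))) fun τ =>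
        ∃ J f, IsPlan C J f ∧ τ.out = outputWord V E C f (k + J.card) := by
  obtain ⟨r6, r7, r8, r9, r12, r13, J, hplan, rfl⟩ := h
  refine (halts_printVerts hV).seq ?_
  rintro _ ⟨t, s, rfl⟩
  refine (halts_printEdges hE).seq ?_
  rintro _ ⟨i, t, s, r12, r13, rfl⟩
  refine (halts_printLegs hC).mono le_rfl fun τ hτ => ⟨J, f, hplan, ?_⟩
  simp [hτ, outputWord, outputEdges, edgeWord]

theorem halts_program (hC : C.Nodup) :
    Halts program (init (inputWord V E C k)) (1000 * ((inputWord V E C k).length + 1) ^ 2)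
      fun τ => ∃ J f, IsPlan C J f ∧ τ.out = outputWord V E C f (k + J.card) := by
  refine (halts_locate.seq (n := (33 * C.length + 25) * C.length + 28 +
    (14 * V.length + 11 + (24 * E.length + 4 + (14 * C.length + 12)))) ?_).mono_time ?_
  · rintro _ ⟨i, t, s, rfl⟩
    refine (halts_plan at_diamond hC).seq ?_
    rintro _ ⟨i, t, s, l, f, _, rfl, rfl, hregs⟩
    exact halts_print at_vertices at_edges at_diamond hregs
  · rw [length_inputWord]
    nlinarith

theorem length_le_inputSize (w : List ℤ) : w.length ≤ inputSize w := by
  induction w with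
  | nil => exact Nat.zero_le _
  | cons z w ih =>
    rw [inputSize] at ih
    rw [inputSize, List.map_cons, List.sum_cons, List.length_cons]
    omega

theorem exists_outputsWithin_program (hC : C.Nodup) :
    ∃ J f, IsPlan C J f ∧ OutputsWithin program (inputWord V E C k)
      ((Polynomial.C 1000 * (Polynomial.X + 1) ^ 2).eval (inputSize (inputWord V E C k)))
      (outputWord V E C f (k + J.card)) := by
  obtain ⟨t, ht, τ, hτ, J, f, hplan, hout⟩ := halts_program (V := V) (E := E) (k := k) hC
  have hsize := length_le_inputSize (inputWord V E C k)
  refine ⟨J, f, hplan, t, τ, ht.trans ?_, hτ, hout⟩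
  simp only [Polynomial.eval_mul, Polynomial.eval_C, Polynomial.eval_pow, Polynomial.eval_add,
    Polynomial.eval_X, Polynomial.eval_one]
  gcongr

end Program

end RAM

namespace Layout

variable {f : ℕ → ℤ} {C U : List ℕ} {R : Finset ℕ} {J : Finset (ℕ × ℕ × ℕ × ℕ)} {a b : ℕ}

theorem card_gadgetVerts {f₀ : ℕ → ℤ} (h : Layout f₀ U R J f) :
    (gadgetVerts R J legNode).card = U.length := by
  rw [← List.toFinset_card_of_nodup h.nodup]
  congr 1
  ext a
  rw [List.mem_toFinset, h.mem_iff]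

variable (h : Layout (fun a => if a ∈ C then -1 else 0) U R J f)

include h

theorem flag_pos_iff : 0 < f a ↔ ∃ j ∈ J, ∃ k < 3, legNode j (k + 1) = a := by
  constructor
  · intro ha
    by_cases haU : a ∈ U
    · refine (mem_gadgetVerts.mp (h.mem_iff.mp haU)).resolve_left fun haR => ?_
      exact ha.ne' (h.flag_root haR)
    · rw [h.flag_of_notMem haU] at ha
      split_ifs at ha <;> omega
  · rintro ⟨j, hj, k, hk, rfl⟩
    rw [h.flag_leg hj hk]
    omega

theorem legEdge_iff_flag_eq : LegEdge 3 J legNode b a ↔ f a = b + 1 := by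
  constructor
  · rintro ⟨j, hj, k, hk, rfl, rfl⟩
    exact h.flag_leg hj hk
  · intro hab
    obtain ⟨j, hj, k, hk, rfl⟩ := h.flag_pos_iff.mp (by omega : 0 < f a)
    rw [h.flag_leg hj hk] at hab
    exact ⟨j, hj, k, hk, by omega, rfl⟩

theorem flag_nonneg_iff : 0 ≤ f a ↔ (a ∈ C → a ∈ gadgetVerts R J legNode) := by
  rw [← h.mem_iff]
  by_cases haU : a ∈ U
  · refine iff_of_true ?_ fun _ => haU
    rcases mem_gadgetVerts.mp (h.mem_iff.mp haU) with haR | hleg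
    · exact (h.flag_root haR).ge
    · exact (h.flag_pos_iff.mpr hleg).le
  · rw [h.flag_of_notMem haU]
    split_ifs with haC <;> simp [haC, haU]

variable (hU : U ⊆ C)

include hU

theorem flag_eq_zero_iff : f a = 0 ↔ (a ∈ C → a ∈ R) := by
  constructor
  · intro ha haC
    refine (mem_gadgetVerts.mp (h.flag_nonneg_iff.mp ha.ge haC)).resolve_right fun hleg => ?_
    exact (h.flag_pos_iff.mpr hleg).ne' ha
  · intro ha
    have hnonneg : 0 ≤ f a := h.flag_nonneg_iff.mpr fun haC => mem_gadgetVerts.mpr (Or.inl (ha haC))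
    refine (not_lt.mp fun hpos => ?_).antisymm hnonneg
    obtain ⟨j, hj, k, hk, rfl⟩ := h.flag_pos_iff.mp hpos
    exact h.isLegFamily.notMem_root j hj k hk (ha (hU (h.leg_mem hj hk)))

theorem gadgetVerts_subset : gadgetVerts R J legNode ⊆ C.toFinset := fun _ ha =>
  List.mem_toFinset.mpr (hU (h.mem_iff.mpr ha))

end Layout

namespace RAM

variable {f : ℕ → ℤ} {V C U : List ℕ} {E : List (ℕ × ℕ)} {R : Finset ℕ}
  {J : Finset (ℕ × ℕ × ℕ × ℕ)} {G : NatGraph}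

theorem parentEdge_eq_iff {a x y : ℕ} (ha : 0 < f a) :
    s((parentEdge f a).1, (parentEdge f a).2) = s(x, y) ↔
      a = x ∧ f x = y + 1 ∨ a = y ∧ f y = x + 1 := by
  simp only [parentEdge, Sym2.eq_iff]
  refine or_congr (and_congr_right ?_) (and_congr_right ?_) <;> · rintro rfl; omega

theorem nodup_parentEdges (hC : C.Nodup)
    (h : Layout (fun a => if a ∈ C then -1 else 0) U R J f) :
    (((C.filter fun a => 0 < f a).map (parentEdge f)).map fun p => s(p.1, p.2)).Nodup := by
  rw [List.map_map]
  refine (List.nodup_map_iff_inj_on (hC.filter _)).mpr fun a ha b hb hab => ?_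
  simp only [List.mem_filter, decide_eq_true_eq] at ha hb
  have hparent : f b = (parentEdge f b).2 + 1 := by rw [parentEdge]; omega
  rcases (parentEdge_eq_iff ha.2).mp hab with ⟨e, -⟩ | ⟨-, hb'⟩
  · exact e
  · exact absurd (h.legEdge_iff_flag_eq.mpr hb')
      (h.isLegFamily.legEdge_asymm (h.legEdge_iff_flag_eq.mpr hparent))

theorem nodup_outputEdges (hE : (E.map fun p => s(p.1, p.2)).Nodup) (hC : C.Nodup)
    (h : Layout (fun a => if a ∈ C then -1 else 0) U R J f) :
    ((outputEdges E C f).map fun p => s(p.1, p.2)).Nodup := by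
  rw [outputEdges, List.map_append]
  refine (hE.sublist (List.filter_sublist.map _)).append (nodup_parentEdges hC h) ?_
  intro e he he'
  simp only [List.map_map, List.mem_map, List.mem_filter, decide_eq_true_eq,
    Function.comp_apply] at he he'
  obtain ⟨p, ⟨-, hp⟩, rfl⟩ := he
  obtain ⟨a, ⟨-, ha⟩, e⟩ := he'
  rcases (parentEdge_eq_iff ha).mp e with ⟨rfl, -⟩ | ⟨rfl, -⟩
  exacts [ha.ne' hp.1, ha.ne' hp.2]

theorem mem_keptEdges {q : ℕ → Prop} [DecidablePred q] {x y : ℕ} :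
    s(x, y) ∈ (E.filter fun p => q p.1 ∧ q p.2).map (fun p => s(p.1, p.2)) ↔
      s(x, y) ∈ E.map (fun p => s(p.1, p.2)) ∧ q x ∧ q y := by
  simp only [List.mem_map, List.mem_filter, decide_eq_true_eq]
  constructor
  · rintro ⟨p, ⟨hp, hq⟩, e⟩
    refine ⟨⟨p, hp, e⟩, ?_⟩
    rcases Sym2.eq_iff.mp e with ⟨rfl, rfl⟩ | ⟨rfl, rfl⟩
    exacts [hq, hq.symm]
  · rintro ⟨⟨p, hp, e⟩, hq⟩
    refine ⟨p, ⟨hp, ?_⟩, e⟩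
    rcases Sym2.eq_iff.mp e with ⟨rfl, rfl⟩ | ⟨rfl, rfl⟩
    exacts [hq, hq.symm]

theorem mem_parentEdges (h : Layout (fun a => if a ∈ C then -1 else 0) U R J f) (hU : U ⊆ C)
    {x y : ℕ} : s(x, y) ∈ ((C.filter fun a => 0 < f a).map (parentEdge f)).map
      (fun p => s(p.1, p.2)) ↔ (legGraph 3 J legNode).Adj x y := by
  have hmem {a b : ℕ} (hab : f a = b + 1) : a ∈ C ∧ 0 < f a := by
    have ha : 0 < f a := by omega
    obtain ⟨j, hj, k, hk, rfl⟩ := h.flag_pos_iff.mp ha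
    exact ⟨hU (h.leg_mem hj hk), ha⟩
  rw [h.isLegFamily.legGraph_adj, h.legEdge_iff_flag_eq, h.legEdge_iff_flag_eq]
  simp only [List.map_map, List.mem_map, List.mem_filter, decide_eq_true_eq, Function.comp_apply]
  constructor
  · rintro ⟨a, ⟨-, ha⟩, e⟩
    exact ((parentEdge_eq_iff ha).mp e).symm.imp And.right And.right
  · rintro (hyx | hxy)
    · exact ⟨y, hmem hyx, (parentEdge_eq_iff (hmem hyx).2).mpr (Or.inr ⟨rfl, hyx⟩)⟩
    · exact ⟨x, hmem hxy, (parentEdge_eq_iff (hmem hxy).2).mpr (Or.inl ⟨rfl, hxy⟩)⟩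

theorem mem_outputEdges (hE : ∀ e, e ∈ E.map (fun p => s(p.1, p.2)) ↔ e ∈ G.edgeSet)
    (h : Layout (fun a => if a ∈ C then -1 else 0) U R J f) (hU : U ⊆ C) (e : Sym2 ℕ) :
    e ∈ (outputEdges E C f).map (fun p => s(p.1, p.2)) ↔
      e ∈ (replaceWithLegs G C.toFinset R J legNode).edgeSet := by
  induction e with
  | h x y =>
    rw [outputEdges, List.map_append, List.mem_append, mem_parentEdges h hU,
      mem_keptEdges (q := fun a => f a = 0), hE, SimpleGraph.Subgraph.mem_edgeSet,
      SimpleGraph.Subgraph.mem_edgeSet, replaceWithLegs_adj, h.flag_eq_zero_iff hU,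
      h.flag_eq_zero_iff hU, List.mem_toFinset, List.mem_toFinset]

theorem encodesOutput_replaceWithLegs (hVnd : V.Nodup) (hV : ∀ a, a ∈ V ↔ a ∈ G.verts)
    (hEnd : (E.map fun p => s(p.1, p.2)).Nodup)
    (hE : ∀ e, e ∈ E.map (fun p => s(p.1, p.2)) ↔ e ∈ G.edgeSet) (hCnd : C.Nodup)
    (hC : (C.toFinset : Set ℕ) ⊆ G.verts)
    (h : Layout (fun a => if a ∈ C then -1 else 0) U R J f) (hU : U ⊆ C) (k : ℤ) :
    EncodesOutput (outputWord V E C f k) (replaceWithLegs G C.toFinset R J legNode) k := by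
  refine ⟨_, ⟨_, _, ⟨V.filter fun a => 0 ≤ f a, hVnd.filter _, fun a => ?_, rfl⟩,
    ⟨_, nodup_outputEdges hEnd hCnd h, mem_outputEdges hE h hU, rfl⟩, rfl⟩, rfl⟩
  rw [List.mem_filter, decide_eq_true_eq, hV, h.flag_nonneg_iff, ← List.mem_toFinset,
    mem_verts_replaceWithLegs hC h.isLegFamily (h.gadgetVerts_subset hU)]

end RAM

theorem le_mul_log_sq_of_lt {n : ℕ} (hn : n < 128) :
    (n : ℝ) ≤ 1000 * Real.log ((n : ℝ) + 1) ^ 2 := by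
  rcases Nat.eq_zero_or_pos n with rfl | hpos
  · simp
  · have hone : (1 : ℝ) ≤ n := by exact_mod_cast hpos
    have hlt : (n : ℝ) < 128 := by exact_mod_cast hn
    have hlog : Real.log 2 ≤ Real.log ((n : ℝ) + 1) :=
      Real.log_le_log (by norm_num) (by linarith)
    nlinarith [Real.log_two_gt_d9]

theorem size_le_mul_log {m : ℕ} (hm : 0 < m) : (m.size : ℝ) ≤ 3 * Real.log ((m : ℝ) + 1) := by
  obtain ⟨s, hs⟩ : ∃ s, m.size = s + 1 := Nat.exists_eq_succ_of_ne_zero (Nat.size_pos.mpr hm).ne'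
  have hpow : (2 : ℝ) ^ s ≤ m := by exact_mod_cast Nat.lt_size.mp (by omega : s < m.size)
  have hlog : s * Real.log 2 ≤ Real.log ((m : ℝ) + 1) := by
    rw [← Real.log_pow]
    exact Real.log_le_log (by positivity) (by linarith)
  have hone : (1 : ℝ) ≤ m := by exact_mod_cast hm
  have hlog_two : Real.log 2 ≤ Real.log ((m : ℝ) + 1) :=
    Real.log_le_log (by norm_num) (by linarith)
  rw [hs, Nat.cast_add, Nat.cast_one]
  nlinarith [Real.log_two_gt_d9, Nat.cast_nonneg (α := ℝ) s]

theorem two_add_size_le_mul_log_sq {n : ℕ} (hn : 128 ≤ n) :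
    ((2 + 2 * (n - 2).size ^ 2 : ℕ) : ℝ) ≤ 1000 * Real.log ((n : ℝ) + 1) ^ 2 := by
  have hn' : (128 : ℝ) ≤ n := by exact_mod_cast hn
  have hsize : ((n - 2).size : ℝ) ≤ 3 * Real.log ((n : ℝ) + 1) := by
    refine (size_le_mul_log (by omega)).trans ?_
    gcongr
    exact Nat.sub_le n 2
  have hlog : Real.log 2 ≤ Real.log ((n : ℝ) + 1) :=
    Real.log_le_log (by norm_num) (by linarith)
  have hsq : ((n - 2).size : ℝ) ^ 2 ≤ (3 * Real.log ((n : ℝ) + 1)) ^ 2 := by gcongr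
  push_cast
  nlinarith [hsq, Real.log_two_gt_d9]

section Kernel

variable {G : NatGraph} {C : Finset ℕ} {k : ℤ} {B : ℝ}

/-- `G'` arises from `G` by replacing `C` with at most `B` vertices `C'`, and the bound `k'`, which
exceeds `k` by at most `B`, yields the same number of minimum dominating sets. -/
structure IsReplacement (G : NatGraph) (C : Finset ℕ) (k : ℤ) (B : ℝ) (G' : NatGraph)
    (C' : Finset ℕ) (k' : ℤ) : Prop where
  isPlanar : IsPlanar G'
  subset : (C' : Set ℕ) ⊆ G'.verts
  numMinDS_eq : numMinDS G k = numMinDS G' k'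
  deleteVerts_eq : G.deleteVerts (C : Set ℕ) = G'.deleteVerts (C' : Set ℕ)
  openNbhd_eq : openNbhd G (C : Set ℕ) = openNbhd G' (C' : Set ℕ)
  card_le : (C'.card : ℝ) ≤ B
  le : k ≤ k'
  le_add : (k' : ℝ) ≤ k + B

theorem IsReplacement.refl (hpl : IsPlanar G) (hC : (C : Set ℕ) ⊆ G.verts)
    (hB : (C.card : ℝ) ≤ B) : IsReplacement G C k B G C k :=
  ⟨hpl, hC, rfl, rfl, rfl, hB, le_rfl, by linarith [Nat.cast_nonneg (α := ℝ) C.card]⟩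

theorem IsGadget.isReplacement_replaceWithLegs {v u : ℕ} {R : Finset ℕ} {ι κ : Type*}
    {J : Finset ι} {node : ι → ℕ → ℕ} {node₀ : κ → ℕ → ℕ}
    (hG : IsGadget G C v u C (∅ : Finset κ) node₀) (h : IsLegFamily 3 R J node)
    (hC : gadgetVerts R J node ⊆ C) (hfin : G.verts.Finite) (hpl : IsPlanar G)
    (hR : 3 ≤ R.card) (hweight : ∑ c ∈ R, 2 ^ (J.filter fun j => node j 0 = c).card = C.card)
    (hB : ((gadgetVerts R J node).card : ℝ) ≤ B) (hJ : (J.card : ℝ) ≤ B) :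
    IsReplacement G C k B (replaceWithLegs G C R J node) (gadgetVerts R J node)
      (k + J.card) := by
  have hG' := hG.isGadget_replaceWithLegs h hC
  have hRC : R ⊆ C := fun c hc => hC (mem_gadgetVerts.mpr (Or.inl hc))
  have hRne : R.Nonempty := Finset.card_pos.mp (by omega)
  exact
    { isPlanar := hG.isPlanar_replaceWithLegs h hC hfin hpl
      subset := hG'.subset
      numMinDS_eq := (hG.numMinDS_replaceWithLegs h hC hfin
        (hR.trans (Finset.card_le_card hRC)) hR hweight k).symm
      deleteVerts_eq := (replaceWithLegs_deleteVerts hG.subset h hC).symm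
      openNbhd_eq := by rw [hG.openNbhd_eq (hRne.mono hRC), hG'.openNbhd_eq hRne]
      card_le := hB
      le := by simp
      le_add := by push_cast; linarith }

variable {V L : List ℕ} {E : List (ℕ × ℕ)} {J : Finset (ℕ × ℕ × ℕ × ℕ)} {f : ℕ → ℤ}

theorem RAM.IsPlan.exists_isReplacement (hpl : IsPlanar G) (hwd : IsWideDiamond G L.toFinset)
    (hVnd : V.Nodup) (hV : ∀ a, a ∈ V ↔ a ∈ G.verts) (hEnd : (E.map fun p => s(p.1, p.2)).Nodup)
    (hE : ∀ e, e ∈ E.map (fun p => s(p.1, p.2)) ↔ e ∈ G.edgeSet) (hL : L.Nodup)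
    (h : RAM.IsPlan L J f) :
    ∃ G' C', EncodesOutput (RAM.outputWord V E L f (k + J.card)) G' (k + J.card) ∧
      IsReplacement G L.toFinset k (1000 * Real.log (L.toFinset.card + 1) ^ 2) G' C'
        (k + J.card) := by
  have hcard : L.toFinset.card = L.length := List.toFinset_card_of_nodup hL
  rw [hcard]
  rcases h with ⟨hlt, rfl, rfl⟩ | ⟨hge, U, R, h⟩
  · simp only [Finset.card_empty, Nat.cast_zero, add_zero]
    refine ⟨G, L.toFinset, ⟨_, ⟨_, _, ⟨V, hVnd, hV, rfl⟩, ⟨E, hEnd, hE, rfl⟩, rfl⟩,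
      outputWord_zero⟩, .refl hpl hwd.1 ?_⟩
    rw [hcard]
    exact le_mul_log_sq_of_lt hlt
  · obtain ⟨v, u, hG⟩ := hwd.exists_isGadget
    have hU : U ⊆ L := h.prefix_names.subset
    have hfin : G.verts.Finite := V.finite_toSet.subset fun a ha => (hV a).mpr ha
    have hbound : (U.length : ℝ) ≤ 1000 * Real.log ((L.length : ℝ) + 1) ^ 2 :=
      (Nat.cast_le.mpr h.length_le).trans (two_add_size_le_mul_log_sq hge)
    have hJ : J.card ≤ U.length := by rw [h.layout.length_eq]; omega
    exact ⟨_, _, encodesOutput_replaceWithLegs hVnd hV hEnd hE hL hG.subset h.layout hU _,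
      hG.isReplacement_replaceWithLegs h.layout.isLegFamily (h.layout.gadgetVerts_subset hU) hfin
        hpl (h.three_le_card rfl) (hcard ▸ h.weight) (h.layout.card_gadgetVerts ▸ hbound)
        ((Nat.cast_le.mpr hJ).trans hbound)⟩

end Kernel

theorem mainTheorem5 :
    ∃ (prog : RAM.Cmd) (p : Polynomial ℕ) (c : ℝ),
      ∀ (G : NatGraph) (C : Finset ℕ) (k : ℤ) (w : List ℤ),
        IsPlanar G → IsWideDiamond G C → EncodesInput w G C k →
        ∃ (w' : List ℤ) (G' : NatGraph) (C' : Finset ℕ) (k' : ℤ),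
          RAM.OutputsWithin prog w (p.eval (RAM.inputSize w)) w' ∧
          EncodesOutput w' G' k' ∧
          IsPlanar G' ∧
          (C' : Set ℕ) ⊆ G'.verts ∧
          numMinDS G k = numMinDS G' k' ∧
          G.deleteVerts (C : Set ℕ) = G'.deleteVerts (C' : Set ℕ) ∧
          openNbhd G (C : Set ℕ) = openNbhd G' (C' : Set ℕ) ∧
          (C'.card : ℝ) ≤ c * Real.log ((C.card : ℝ) + 1) ^ 2 ∧
          k ≤ k' ∧
          (k' : ℝ) ≤ (k : ℝ) + c * Real.log ((C.card : ℝ) + 1) ^ 2 := by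
  refine ⟨RAM.program, Polynomial.C 1000 * (Polynomial.X + 1) ^ 2, 1000, ?_⟩
  rintro G C k w hpl hwd ⟨_, _, ⟨_, _, ⟨V, hVnd, hV, rfl⟩, ⟨E, hEnd, hE, rfl⟩, rfl⟩,
    ⟨L, hLnd, hL, rfl⟩, hw⟩
  obtain rfl : C = L.toFinset := by
    ext a
    rw [List.mem_toFinset, hL, Finset.mem_coe]
  obtain rfl : w = inputWord V E L k := hw
  obtain ⟨J, f, hplan, hout⟩ := RAM.exists_outputsWithin_program (V := V) (E := E) (k := k) hLnd
  obtain ⟨G', C', henc, h⟩ := hplan.exists_isReplacement hpl hwd hVnd hV hEnd hE hLnd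
  exact ⟨_, G', C', _, hout, henc, h.isPlanar, h.subset, h.numMinDS_eq, h.deleteVerts_eq,
    h.openNbhd_eq, h.card_le, h.le, h.le_add⟩
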